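/- Let $d\ge 1$ be an integer, $\beta\ge 0$ and $h\in\mathbb{R}$. For $n\ge 1$ let $\varepsilon=(\varepsilon_1,\dots,\varepsilon_n)$ be the spins of the Curie-Weiss model, i.e. for $\sigma\in\{-1,1\}^n$, $$P(\varepsilon=\sigma)=\frac{1}{Z_{d,\beta,h}}\exp\Big\{\frac{d\beta}{n}\Big(\sum_{j=1}^n\sigma_j\Big)^2+h\sum_{j=1}^n\sigma_j\Big\},$$ where $Z_{d,\beta,h}$ is the normalizing constant (it depends on $n$). Put $$Q_n=\sup_{x\in\mathbb{R}}\ \sup_{v_1,\dots,v_n\in\mathbb{R},\ |v_1|,\dots,|v_n|\ge 1}P\Big(\sum_{i=1}^n v_i\varepsilon_i\in(x-1,x+1)\Big)$$ and $\beta_c=\frac{1}{2d}$. Then the mean-field equation $\tanh\big(\frac{\beta}{\beta_c}z+|h|\big)=z$ has a largest real solution $z_*$, and $z_*\ge 0$. Put $t_*=2d\beta z_*+|h|$. As $n\to\infty$ (with $d,\beta,h$ fixed), $$Q_n\sim n^{-1/2}\sqrt{\frac{2}{\pi}}\,\cosh t_*.$$ More precisely, as $n\to\infty$: 1. If $h=0$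 and $\beta<\beta_c$, then $t_*=0$ and $Q_n=\sqrt{\frac{2}{\pi}}\,n^{-1/2}+O(n^{-3/2})$. 2. If $h=0$ and $\beta=\beta_c$, then $t_*=0$ and $Q_n=\sqrt{\frac{2}{\pi}}\,n^{-1/2}+\frac{2\sqrt{3}\sqrt{\pi}}{\Gamma(1/4)^2}\,n^{-1}+o(n^{-1})$. 3. If $h=0$ and $\beta>\beta_c$, then $t_*>0$ and $Q_n=\sqrt{\frac{2}{\pi}}\cosh(t_*)\,n^{-1/2}+O(n^{-3/2})$. 4. If $h\neq 0$, then $t_*>0$ and $Q_n=\sqrt{\frac{2}{\pi}}\cosh(t_*)\,n^{-1/2}+O(n^{-3/2})$. The implied constants may depend on $d,\beta,h$. -/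

import Mathlib

open Filter Asymptotics

noncomputable section

namespace CurieWeiss

/-- Spin configurations on `n` vertices; the group `ℤˣ` of units of `ℤ` is `{-1, 1}`. -/
abbrev Config (n : ℕ) : Type := Fin n → ℤˣ

/-- The spin of the configuration `σ` at the vertex `i`, as a real number (`1` or `-1`). -/
def spin {n : ℕ} (σ : Config n) (i : Fin n) : ℝ := ((σ i : ℤ) : ℝ)

/-- The unnormalized weight `exp {(dβ/n) (∑ σ_j)² + h ∑ σ_j}` of a configuration. -/
def weight (d : ℕ) (β h : ℝ) (n : ℕ) (σ : Config n) : ℝ :=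
  Real.exp ((d : ℝ) * β / (n : ℝ) * (∑ j, spin σ j) ^ 2 + h * ∑ j, spin σ j)

/-- The partition function (normalizing constant). -/
def partitionFunction (d : ℕ) (β h : ℝ) (n : ℕ) : ℝ :=
  ∑ σ : Config n, weight d β h n σ

/-- The probability `P (ε = σ)` in the Curie-Weiss model. -/
def mass (d : ℕ) (β h : ℝ) (n : ℕ) (σ : Config n) : ℝ :=
  weight d β h n σ / partitionFunction d β h n

/-- The probability `P (ε ∈ A)` of an event in the Curie-Weiss model. -/
def prob (d : ℕ) (β h : ℝ) (n : ℕ) (A : Set (Config n)) : ℝ :=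
  ∑ σ : Config n, A.indicator (mass d β h n) σ

/-- The Littlewood-Offord concentration bound
`Q_n = sup_x sup_{|v_1|, …, |v_n| ≥ 1} P (∑ v_i ε_i ∈ (x - 1, x + 1))`. The supremum is over a
nonempty set of reals contained in `[0, 1]`. -/
def Q (d : ℕ) (β h : ℝ) (n : ℕ) : ℝ :=
  sSup {p : ℝ | ∃ (x : ℝ) (v : Fin n → ℝ), (∀ i, 1 ≤ |v i|) ∧
    p = prob d β h n {σ | ∑ i, v i * spin σ i ∈ Set.Ioo (x - 1) (x + 1)}}

/-- The critical inverse temperature `β_c = 1 / (2d)`. -/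
def criticalBeta (d : ℕ) : ℝ := 1 / (2 * (d : ℝ))

/-- The real solutions `z` of the mean-field equation `tanh ((β/β_c) z + |h|) = z`. -/
def meanFieldSolutions (d : ℕ) (β h : ℝ) : Set ℝ :=
  {z : ℝ | Real.tanh (β / criticalBeta d * z + |h|) = z}

end CurieWeiss

end

/-! Put `b = 2dβ`. Linearising the square in the weight by a Gaussian integral
(Hubbard-Stratonovich) turns the model into a mixture: draw a field `T` whose law has density
proportional to `cosh^n T` with respect to the Gaussian of mean `h` and variance `b/n`, then draw
independent spins with weights proportional to `exp (± T)`.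

For a fixed field the question is a Littlewood-Offord problem for biased independent spins. Once
signs are flipped so that every `v i` is positive, the event is an antichain, since changing one
spin upwards moves the sum by at least the width 2 of the open interval. The LYM inequality for
product weights (`sum_antichain_le`) bounds it by the heaviest level, and Fourier inversion bounds
every level by `(1/π) ∫ (2 √(cosh² T - sin² u))^n du`, whatever the signs were. The alternating
choice `v i = (-1)^i` reaches the same integral exactly for even `n` and up to negligible terms for
odd `n`. It does so for all `T` at once, so averaging over the field loses nothing. Since the
integral is `√(2/π) n^{-1/2} cosh T + O(n^{-3/2} cosh³ T)` after normalisation,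
`exists_abs_Q_sub_le` reduces everything to the mean of `cosh T`.

That mean is found from Stein's identity `integral_stein`: `E[ψ(T)(T - h - b tanh T)] = (b/n)
E[ψ'(T)]`. The drift `T - h - b tanh T` vanishes at `t_*` and, away from criticality, has positive
slope there. Taking `ψ = sinh` and convexity gives `E cosh T ≤ cosh t_* + O(1/n)`. The reverse bound
has a quadratic remainder, controlled by `ψ = sinh · (cosh - cosh t_*)` as a Lyapunov function
together with a Laplace estimate on compact sets where the potential is below its maximum.

At criticality the slope vanishes and the potential behaves like `-T⁴/12`, so `T` lives on the scale
`n^{-1/4}`. Dominated convergence gives the limit of `√n (E cosh T - 1)` as a quotient of two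
quartic integrals, and the reflection formula for `Γ` turns it into the stated constant. Negative
`h` is reduced to `|h|` by a global spin flip. -/

namespace CurieWeiss

/-! ### Newton's and LYM inequalities for product weights on the Boolean lattice. -/

section WeightedLYM

variable {ι : Type*}

/-- The total weight of the `k`-element subsets of `s`, where `A` has weight `∏ i ∈ A, r i`. -/
def levelWeight (r : ι → ℝ) (s : Finset ι) (k : ℕ) : ℝ :=
  ∑ A ∈ s.powersetCard k, ∏ i ∈ A, r i

lemma levelWeight_zero (r : ι → ℝ) (s : Finset ι) : levelWeight r s 0 = 1 := by
  simp [levelWeight]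

lemma levelWeight_insert_succ [DecidableEq ι] (r : ι → ℝ) {s : Finset ι} {e : ι} (he : e ∉ s) (k : ℕ) :
    levelWeight r (insert e s) (k + 1) = levelWeight r s (k + 1) + r e * levelWeight r s k := by
  unfold levelWeight
  rw [Finset.powersetCard_succ_insert he, Finset.sum_union, Finset.sum_image, Finset.mul_sum]
  · congr 1
    refine Finset.sum_congr rfl fun A hA => ?_
    rw [Finset.mem_powersetCard] at hA
    rw [Finset.prod_insert fun h => he (hA.1 h)]
  · intro A hA B hB hAB
    rw [Finset.mem_coe, Finset.mem_powersetCard] at hA hB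
    have hA' : e ∉ A := fun h => he (hA.1 h)
    have hB' : e ∉ B := fun h => he (hB.1 h)
    rw [← Finset.erase_insert hA', ← Finset.erase_insert hB', hAB]
  · rw [Finset.disjoint_left]
    intro A hA hA'
    rw [Finset.mem_image] at hA'
    obtain ⟨B, -, rfl⟩ := hA'
    rw [Finset.mem_powersetCard] at hA
    exact he (hA.1 (Finset.mem_insert_self e B))

lemma levelWeight_nonneg {r : ι → ℝ} (hr : ∀ i, 0 < r i) (s : Finset ι) (k : ℕ) :
    0 ≤ levelWeight r s k :=
  Finset.sum_nonneg fun _ _ => Finset.prod_nonneg fun i _ => (hr i).le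

lemma levelWeight_pos {r : ι → ℝ} (hr : ∀ i, 0 < r i) {s : Finset ι} {k : ℕ} (hk : k ≤ s.card) :
    0 < levelWeight r s k :=
  Finset.sum_pos (fun _ _ => Finset.prod_pos fun i _ => hr i)
    (Finset.powersetCard_nonempty.2 hk)

lemma levelWeight_eq_zero (r : ι → ℝ) {s : Finset ι} {k : ℕ} (hk : s.card < k) :
    levelWeight r s k = 0 := by
  simp [levelWeight, Finset.powersetCard_eq_empty.2 hk]

/-- Newton's inequality: the level weights form a log-concave sequence. -/
lemma levelWeight_mul_le [DecidableEq ι] {r : ι → ℝ} (hr : ∀ i, 0 < r i) (s : Finset ι) :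
    ∀ i j : ℕ, i ≤ j →
      levelWeight r s i * levelWeight r s (j + 1) ≤ levelWeight r s (i + 1) * levelWeight r s j := by
  induction s using Finset.induction_on with
  | empty =>
    intro i j _
    rw [levelWeight_eq_zero r (s := ∅) (k := j + 1) (by simp), mul_zero]
    exact mul_nonneg (levelWeight_nonneg hr _ _) (levelWeight_nonneg hr _ _)
  | insert e s he ih =>
    intro i j hij
    have hW := levelWeight_nonneg hr s
    have hre := hr e
    rcases i with _ | i
    · rcases j with _ | j
      · rw [mul_comm]
      · simp only [levelWeight_insert_succ r he, levelWeight_zero, zero_add] at *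
        have h1 := ih 0 (j + 1) (by omega)
        simp only [levelWeight_zero, zero_add] at h1
        have h2 := mul_nonneg hre.le (mul_nonneg (hW 1) (hW j))
        have h3 := mul_nonneg (mul_nonneg hre.le hre.le) (hW j)
        nlinarith
    · rcases j with _ | j
      · omega
      · simp only [levelWeight_insert_succ r he]
        have h1 := ih (i + 1) (j + 1) hij
        have h3 := ih i j (by omega)
        -- This is the part linear in `r e`. It compares levels two apart, which is why the
        -- induction needs all pairs `i ≤ j` and not only adjacent levels: for `i < j` two instances
        -- of the hypothesis are chained, and for `i = j` both sides agree.
        have h2 : levelWeight r s i * levelWeight r s (j + 2) + levelWeight r s (i + 1) *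
            levelWeight r s (j + 1) ≤ levelWeight r s (i + 1) * levelWeight r s (j + 1) +
              levelWeight r s (i + 2) * levelWeight r s j := by
          rcases (show i ≤ j by omega).eq_or_lt with rfl | hlt
          · linarith
          · have h4 := ih i (j + 1) (by omega)
            have h5 := ih (i + 1) j (by omega)
            linarith
        have h2' := mul_le_mul_of_nonneg_left h2 hre.le
        have h3' := mul_le_mul_of_nonneg_left h3 (mul_nonneg hre.le hre.le)
        nlinarith

lemma sum_range_ite_le_sub (a : ℕ → ℝ) {k N : ℕ} (hk : k ≤ N) :
    ∑ j ∈ Finset.range N, (if k ≤ j then a j - a (j + 1) else 0) = a k - a N := by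
  induction N, hk using Nat.le_induction with
  | base =>
    rw [sub_self]
    refine Finset.sum_eq_zero fun j hj => if_neg ?_
    rw [Finset.mem_range] at hj
    omega
  | succ N hN ih => rw [Finset.sum_range_succ, ih, if_pos hN]; ring

lemma sum_range_ite_ge_sub (a : ℕ → ℝ) {k N : ℕ} (hk : k + 1 ≤ N) :
    ∑ j ∈ Finset.range N, (if j ≤ k then a j - a (j + 1) else 0) = a 0 - a (k + 1) := by
  induction N, hk using Nat.le_induction with
  | base =>
    rw [← Finset.sum_range_sub']
    refine Finset.sum_congr rfl fun j hj => if_pos ?_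
    rw [Finset.mem_range] at hj
    omega
  | succ N hN ih => rw [Finset.sum_range_succ, ih, if_neg (by omega)]; ring

open Classical in
/-- The LYM inequality for product weights on the Boolean lattice. -/
theorem sum_antichain_div_levelWeight_le_one [DecidableEq ι] {r : ι → ℝ} (hr : ∀ i, 0 < r i) (s : Finset ι) :
    ∀ P : Finset ι → Prop, (∀ A B, B ⊆ s → P A → P B → A ⊆ B → A = B) →
      ∑ A ∈ s.powerset, (if P A then (∏ i ∈ A, r i) / levelWeight r s A.card else 0) ≤ 1 := by
  induction s using Finset.induction_on with
  | empty =>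
    intro P _
    simp only [Finset.powerset_empty, Finset.sum_singleton, Finset.prod_empty, Finset.card_empty,
      levelWeight_zero, div_one]
    split_ifs <;> norm_num
  | insert e s he ih =>
    intro P hP
    set n := s.card with hn
    -- `a k` is the probability that a random `k`-subset of `insert e s`, drawn according to its
    -- weight, avoids `e`. It runs from 1 at `k = 0` to 0 at `k = n + 1`.
    set a : ℕ → ℝ := fun k => levelWeight r s k / levelWeight r (insert e s) k with ha
    have hW := levelWeight_nonneg hr s
    have hW' : ∀ k, k ≤ n + 1 → 0 < levelWeight r (insert e s) k := fun k hk =>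
      levelWeight_pos hr (by rw [Finset.card_insert_of_notMem he]; exact hk)
    have ha0 : a 0 = 1 := by simp [ha, levelWeight_zero]
    have haN : a (n + 1) = 0 := by simp [ha, levelWeight_eq_zero r (Nat.lt_succ_self s.card), hn]
    -- By Newton's inequality `a` decreases, so its differences are nonnegative and sum to 1: they
    -- serve as averaging weights over thresholds.
    have hanti : ∀ j, j < n + 1 → 0 ≤ a j - a (j + 1) := by
      intro j hj
      rw [sub_nonneg, ha]
      simp only
      rw [div_le_div_iff₀ (hW' _ (by omega)) (hW' _ (by omega))]
      rcases j with _ | j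
      · rw [levelWeight_zero, levelWeight_zero, levelWeight_insert_succ r he]
        have := mul_nonneg (hr e).le (hW 0)
        linarith
      · rw [levelWeight_insert_succ r he, levelWeight_insert_succ r he]
        have := mul_le_mul_of_nonneg_left (levelWeight_mul_le hr s j (j + 1) (by omega)) (hr e).le
        nlinarith
    have hmem : ∀ A ∈ s.powerset, e ∉ A ∧ A.card ≤ n := fun A hA =>
      ⟨fun h => he (Finset.mem_powerset.1 hA h), Finset.card_le_card (Finset.mem_powerset.1 hA)⟩
    set w : Finset ι → ℝ := fun A => (∏ i ∈ A, r i) / levelWeight r s A.card with hw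
    -- For each threshold `j` the antichain is projected to `s`: members without `e` are kept when
    -- of size at most `j`, members with `e` lose it and are kept when at least `j` elements remain.
    -- The two conditions on size make the projection an antichain, so the induction hypothesis
    -- applies.
    have hcomb : ∀ j, ∑ A ∈ s.powerset, ((if P A ∧ A.card ≤ j then w A else 0) +
        (if P (insert e A) ∧ j ≤ A.card then w A else 0)) ≤ 1 := by
      intro j
      refine le_trans (le_of_eq ?_)
        (ih (fun A => e ∉ A ∧ ((P A ∧ A.card ≤ j) ∨ (P (insert e A) ∧ j ≤ A.card))) ?_)
      · refine Finset.sum_congr rfl fun A hA => ?_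
        obtain ⟨heA, -⟩ := hmem A hA
        have hnot : ¬ (P A ∧ P (insert e A)) := fun h => by
          have := hP A (insert e A)
            (Finset.insert_subset_insert e (Finset.mem_powerset.1 hA)) h.1 h.2
            (Finset.subset_insert e A)
          exact heA (this ▸ Finset.mem_insert_self e A)
        by_cases h1 : P A ∧ A.card ≤ j <;> by_cases h2 : P (insert e A) ∧ j ≤ A.card
        · exact absurd ⟨h1.1, h2.1⟩ hnot
        all_goals simp [h1, h2, heA, hw]
      · rintro A B hB ⟨hA1, hA2⟩ ⟨hB1, hB2⟩ hAB
        have hBi : B ⊆ insert e s := hB.trans (Finset.subset_insert e s)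
        have hBi' : insert e B ⊆ insert e s := Finset.insert_subset_insert e hB
        rcases hA2 with ⟨hA2, hA3⟩ | ⟨hA2, hA3⟩ <;> rcases hB2 with ⟨hB2, hB3⟩ | ⟨hB2, hB3⟩
        · exact hP A B hBi hA2 hB2 hAB
        · have := hP A (insert e B) hBi' hA2 hB2 (hAB.trans (Finset.subset_insert e B))
          exact absurd (this ▸ Finset.mem_insert_self e B) hA1
        · exact Finset.eq_of_subset_of_card_le hAB (by omega)
        · have := hP (insert e A) (insert e B) hBi' hA2 hB2 (Finset.insert_subset_insert e hAB)
          rw [← Finset.erase_insert hA1, ← Finset.erase_insert hB1, this]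
    -- Averaging over thresholds recovers the original sum: a member of size `k` without `e`
    -- collects the total `a k`, and `insert e A` with `A` of size `k` collects `1 - a (k + 1)`,
    -- exactly the ratios between the normalisations on `s` and on `insert e s`.
    have hmain : ∑ A ∈ (insert e s).powerset,
          (if P A then (∏ i ∈ A, r i) / levelWeight r (insert e s) A.card else 0) =
        ∑ j ∈ Finset.range (n + 1), (a j - a (j + 1)) *
          ∑ A ∈ s.powerset, ((if P A ∧ A.card ≤ j then w A else 0) +
            (if P (insert e A) ∧ j ≤ A.card then w A else 0)) := by
      rw [Finset.sum_powerset_insert he, ← Finset.sum_add_distrib]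
      simp only [Finset.mul_sum]
      rw [Finset.sum_comm]
      refine Finset.sum_congr rfl fun A hA => ?_
      obtain ⟨heA, hcard⟩ := hmem A hA
      have hWA : 0 < levelWeight r s A.card := levelWeight_pos hr hcard
      simp only [mul_add, Finset.sum_add_distrib]
      congr 1
      · by_cases h : P A
        · have h1 := sum_range_ite_le_sub a (k := A.card) (N := n + 1) (by omega)
          rw [haN, sub_zero] at h1
          simp only [h, true_and, if_true]
          have h2 : ∑ j ∈ Finset.range (n + 1), (a j - a (j + 1)) * (if A.card ≤ j then w A else 0)
              = (∑ j ∈ Finset.range (n + 1), if A.card ≤ j then a j - a (j + 1) else 0) * w A := by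
            rw [Finset.sum_mul]
            refine Finset.sum_congr rfl fun j _ => ?_
            split_ifs <;> simp
          rw [h2, h1]
          simp only [ha, hw]
          field_simp
        · simp [h]
      · by_cases h : P (insert e A)
        · have h1 := sum_range_ite_ge_sub a (k := A.card) (N := n + 1) (by omega)
          rw [ha0] at h1
          simp only [h, true_and, if_true]
          have h2 : ∑ j ∈ Finset.range (n + 1), (a j - a (j + 1)) * (if j ≤ A.card then w A else 0)
              = (∑ j ∈ Finset.range (n + 1), if j ≤ A.card then a j - a (j + 1) else 0) * w A := by
            rw [Finset.sum_mul]
            refine Finset.sum_congr rfl fun j _ => ?_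
            split_ifs <;> simp
          rw [h2, h1, Finset.prod_insert heA, Finset.card_insert_of_notMem heA]
          have h3 := hW' (A.card + 1) (by omega)
          have h4 : 1 - a (A.card + 1) =
              r e * levelWeight r s A.card / levelWeight r (insert e s) (A.card + 1) := by
            rw [eq_div_iff h3.ne', ha]
            simp only
            rw [sub_mul, div_mul_cancel₀ _ h3.ne', levelWeight_insert_succ r he]
            ring
          rw [h4]
          simp only [hw]
          field_simp
        · simp [h]
    rw [hmain]
    calc _ ≤ ∑ j ∈ Finset.range (n + 1), (a j - a (j + 1)) * 1 := by
          refine Finset.sum_le_sum fun j hj => mul_le_mul_of_nonneg_left (hcomb j) (hanti j ?_)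
          exact Finset.mem_range.1 hj
      _ = 1 := by
          simp only [mul_one]
          rw [Finset.sum_range_sub', ha0, haN, sub_zero]

open Classical in
/-- An antichain weighs at most as much as the heaviest level. -/
theorem sum_antichain_le [DecidableEq ι] {r : ι → ℝ} (hr : ∀ i, 0 < r i) (s : Finset ι) (P : Finset ι → Prop)
    (hP : ∀ A B, B ⊆ s → P A → P B → A ⊆ B → A = B) {M : ℝ}
    (hM : ∀ k, levelWeight r s k ≤ M) :
    ∑ A ∈ s.powerset, (if P A then ∏ i ∈ A, r i else 0) ≤ M := by
  have hM0 : 0 ≤ M := (levelWeight_nonneg hr s 0).trans (hM 0)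
  calc _ ≤ ∑ A ∈ s.powerset, M * (if P A then (∏ i ∈ A, r i) / levelWeight r s A.card else 0) := by
        refine Finset.sum_le_sum fun A hA => ?_
        split_ifs with h
        · have hWA : 0 < levelWeight r s A.card :=
            levelWeight_pos hr (Finset.card_le_card (Finset.mem_powerset.1 hA))
          rw [mul_div_assoc', le_div_iff₀ hWA, mul_comm]
          exact mul_le_mul_of_nonneg_right (hM _) (Finset.prod_nonneg fun i _ => (hr i).le)
        · simp
    _ = M * ∑ A ∈ s.powerset, (if P A then (∏ i ∈ A, r i) / levelWeight r s A.card else 0) := by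
        rw [Finset.mul_sum]
    _ ≤ M * 1 := mul_le_mul_of_nonneg_left (sum_antichain_div_levelWeight_le_one hr s P hP) hM0
    _ = M := mul_one M

end WeightedLYM

/-! ### Upper bound for independent spins in a fixed field. -/

section LittlewoodOfford

lemma integral_exp_two_mul_I (j : ℤ) :
    ∫ u in (-(Real.pi / 2))..(Real.pi / 2), Complex.exp ((2 * j * Complex.I) * (u : ℂ)) =
      if j = 0 then (Real.pi : ℂ) else 0 := by
  split_ifs with hj
  · subst hj
    simp
  · have hc : (2 * j * Complex.I : ℂ) ≠ 0 := by
      simp [hj]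
    rw [integral_exp_mul_complex hc, div_eq_zero_iff]
    left
    rw [sub_eq_zero, Complex.exp_eq_exp_iff_exists_int]
    refine ⟨j, ?_⟩
    push_cast
    ring

/-- Fourier inversion for the level weights. -/
lemma levelWeight_eq_integral {ι : Type*} (r : ι → ℝ) (s : Finset ι) (k : ℕ) :
    ((Real.pi * levelWeight r s k : ℝ) : ℂ) =
      ∫ u in (-(Real.pi / 2))..(Real.pi / 2), Complex.exp ((2 * (-k : ℤ) * Complex.I) * (u : ℂ)) *
        ∏ i ∈ s, (1 + (r i : ℂ) * Complex.exp (2 * Complex.I * (u : ℂ))) := by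
  have h1 : ∀ u : ℝ, Complex.exp ((2 * (-k : ℤ) * Complex.I) * (u : ℂ)) *
        ∏ i ∈ s, (1 + (r i : ℂ) * Complex.exp (2 * Complex.I * (u : ℂ))) =
      ∑ A ∈ s.powerset, ((∏ i ∈ A, (r i : ℂ)) *
        Complex.exp ((2 * ((A.card - k : ℤ)) * Complex.I) * (u : ℂ))) := by
    intro u
    rw [Finset.prod_one_add, Finset.mul_sum]
    refine Finset.sum_congr rfl fun A _ => ?_
    rw [Finset.prod_mul_distrib, Finset.prod_const, ← Complex.exp_nat_mul, mul_left_comm,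
      ← Complex.exp_add]
    congr 2
    push_cast
    ring
  simp_rw [h1]
  have h2 : ∀ A : Finset ι, ∫ u in (-(Real.pi / 2))..(Real.pi / 2), ((∏ i ∈ A, (r i : ℂ)) *
        Complex.exp ((2 * ((A.card - k : ℤ) : ℂ) * Complex.I) * (u : ℂ))) =
      if A.card = k then (Real.pi : ℂ) * ∏ i ∈ A, (r i : ℂ) else 0 := by
    intro A
    have h3 := integral_exp_two_mul_I (A.card - k : ℤ)
    rw [intervalIntegral.integral_const_mul, h3]
    by_cases h : A.card = k
    · simp [h, mul_comm]
    · have : ((A.card : ℤ) - k) ≠ 0 := by omega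
      simp [h, this]
  rw [intervalIntegral.integral_finsetSum]
  · simp_rw [h2]
    rw [← Finset.sum_filter, levelWeight, Finset.powersetCard_eq_filter]
    push_cast
    rw [Finset.mul_sum]
  · intro A _
    apply Continuous.intervalIntegrable
    fun_prop

lemma cosh_sq_sub_sin_sq_nonneg (T u : ℝ) : 0 ≤ Real.cosh T ^ 2 - Real.sin u ^ 2 := by
  nlinarith [Real.cosh_sq T, Real.sin_sq_add_cos_sq u, sq_nonneg (Real.sinh T),
    sq_nonneg (Real.cos u)]

/-- Factoring out `exp (Tε + iu)` leaves `2 cosh (Tε + iu)`, whose modulus is even in `T`. The sign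
`ε` therefore survives only in the prefactor. -/
lemma norm_one_add_exp_mul (T u ε : ℝ) (hε : ε = 1 ∨ ε = -1) :
    ‖1 + ((Real.exp (2 * T * ε) : ℝ) : ℂ) * Complex.exp (2 * Complex.I * (u : ℂ))‖ =
      Real.exp (T * ε) * (2 * Real.sqrt (Real.cosh T ^ 2 - Real.sin u ^ 2)) := by
  have h0 := cosh_sq_sub_sin_sq_nonneg T u
  rw [← sq_eq_sq₀ (norm_nonneg _) (by positivity), mul_pow, mul_pow, Real.sq_sqrt h0,
    Complex.sq_norm, Complex.normSq_apply]
  have h1 : Complex.exp (2 * Complex.I * (u : ℂ)) =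
      ((Real.cos (2 * u) : ℝ) : ℂ) + ((Real.sin (2 * u) : ℝ) : ℂ) * Complex.I := by
    rw [show 2 * Complex.I * (u : ℂ) = ((2 * u : ℝ) : ℂ) * Complex.I by push_cast; ring,
      Complex.exp_mul_I]
    push_cast
    rfl
  rw [h1]
  simp only [Complex.add_re, Complex.add_im, Complex.mul_re, Complex.mul_im, Complex.one_re,
    Complex.one_im, Complex.ofReal_re, Complex.ofReal_im, Complex.I_re, Complex.I_im]
  have h2 : Real.exp (2 * T * ε) = Real.exp (T * ε) ^ 2 := by
    rw [← Real.exp_nat_mul]; congr 1; push_cast; ring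
  have h4 : Real.cosh T = (Real.exp (T * ε) + (Real.exp (T * ε))⁻¹) / 2 := by
    rw [← Real.exp_neg, Real.cosh_eq]
    rcases hε with rfl | rfl
    · simp
    · simp [add_comm]
  have h5 := Real.sin_sq_add_cos_sq (2 * u)
  have h6 : Real.cos (2 * u) = 1 - 2 * Real.sin u ^ 2 := by
    rw [Real.cos_two_mul, Real.cos_sq']; ring
  have h7 : Real.sin u ^ 2 = (1 - Real.cos (2 * u)) / 2 := by rw [h6]; ring
  rw [h2, h4, h7]
  have h8 := Real.exp_pos (T * ε)
  set x := Real.exp (T * ε)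
  have h9 : Real.sin (2 * u) ^ 2 = 1 - Real.cos (2 * u) ^ 2 := by linarith
  field_simp
  linear_combination x ^ 4 * h9

/-- The phase in Fourier inversion has modulus 1 and the prefactors `exp (T ε i)` cancel against the
normalisation, so the bound depends neither on the level `k` nor on the signs. -/
lemma levelWeight_le_integral {n : ℕ} (T : ℝ) (ε : Fin n → ℝ) (hε : ∀ i, ε i = 1 ∨ ε i = -1)
    (k : ℕ) :
    (∏ i, Real.exp (-(T * ε i))) *
      levelWeight (fun i => Real.exp (2 * T * ε i)) Finset.univ k ≤
      1 / Real.pi * ∫ u in (-(Real.pi / 2))..(Real.pi / 2),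
        (2 * Real.sqrt (Real.cosh T ^ 2 - Real.sin u ^ 2)) ^ n := by
  have hpi := Real.pi_pos
  have h1 := congrArg norm (levelWeight_eq_integral (fun i => Real.exp (2 * T * ε i))
    (Finset.univ : Finset (Fin n)) k)
  rw [Complex.norm_real, Real.norm_eq_abs, abs_of_nonneg (mul_nonneg hpi.le
    (levelWeight_nonneg (fun i => Real.exp_pos _) _ _))] at h1
  have h2 := intervalIntegral.norm_integral_le_integral_norm
    (f := fun u : ℝ => Complex.exp ((2 * (-k : ℤ) * Complex.I) * (u : ℂ)) *
        ∏ i : Fin n, (1 + ((Real.exp (2 * T * ε i) : ℝ) : ℂ) *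
          Complex.exp (2 * Complex.I * (u : ℂ)))) (μ := MeasureTheory.volume)
          (show -(Real.pi / 2) ≤ Real.pi / 2 by linarith)
  have h3 : ∀ u : ℝ, ‖Complex.exp ((2 * (-k : ℤ) * Complex.I) * (u : ℂ)) *
        ∏ i : Fin n, (1 + ((Real.exp (2 * T * ε i) : ℝ) : ℂ) *
          Complex.exp (2 * Complex.I * (u : ℂ)))‖ =
      (∏ i, Real.exp (T * ε i)) * (2 * Real.sqrt (Real.cosh T ^ 2 - Real.sin u ^ 2)) ^ n := by
    intro u
    rw [norm_mul, norm_prod]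
    simp_rw [norm_one_add_exp_mul T u _ (hε _)]
    rw [Finset.prod_mul_distrib, Finset.prod_const, Finset.card_univ, Fintype.card_fin,
      show (2 * ((-k : ℤ) : ℂ) * Complex.I) * (u : ℂ) = ((2 * (-k : ℤ) * u : ℝ) : ℂ) * Complex.I by
        push_cast; ring, Complex.norm_exp_ofReal_mul_I, one_mul]
  rw [← h1] at h2
  simp_rw [h3] at h2
  rw [intervalIntegral.integral_const_mul] at h2
  have h4 : (∏ i, Real.exp (-(T * ε i))) * (∏ i, Real.exp (T * ε i)) = 1 := by
    rw [← Finset.prod_mul_distrib]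
    exact Finset.prod_eq_one fun i _ => by rw [← Real.exp_add]; simp
  have h5 : (0 : ℝ) < ∏ i, Real.exp (-(T * ε i)) := Finset.prod_pos fun i _ => Real.exp_pos _
  have h6 := mul_le_mul_of_nonneg_left h2 h5.le
  rw [← mul_assoc _ (∏ i, Real.exp (T * ε i)), h4, one_mul] at h6
  rw [one_div, ← div_eq_inv_mul, le_div_iff₀ hpi]
  linarith

open Classical in
/-- The Littlewood-Offord bound for independent spins in a field `T`. -/
theorem sum_event_exp_le {n : ℕ} (T x : ℝ) (v : Fin n → ℝ) (hv : ∀ i, 1 ≤ |v i|) :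
    ∑ σ : Config n, (if ∑ i, v i * spin σ i ∈ Set.Ioo (x - 1) (x + 1)
        then Real.exp (T * ∑ i, spin σ i) else 0) ≤
      1 / Real.pi * ∫ u in (-(Real.pi / 2))..(Real.pi / 2),
        (2 * Real.sqrt (Real.cosh T ^ 2 - Real.sin u ^ 2)) ^ n := by
  -- A configuration is encoded by the set `A` of vertices where it agrees with the sign of `v`. The
  -- linear form becomes increasing in `A`, and the weight becomes `c` times a product over `A`,
  -- where `c` is the weight of the configuration with `A` empty.
  set s : Fin n → ℤˣ := fun i => if 0 < v i then 1 else -1 with hs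
  set ε : Fin n → ℝ := fun i => ((s i : ℤ) : ℝ) with hεdef
  have hε : ∀ i, ε i = 1 ∨ ε i = -1 := by
    intro i
    by_cases h : 0 < v i <;> simp [hεdef, hs, h]
  have hvε : ∀ i, v i * ε i = |v i| := by
    intro i
    by_cases h : 0 < v i
    · simp [hεdef, hs, h, abs_of_pos h]
    · simp [hεdef, hs, h, abs_of_nonpos (not_lt.1 h)]
  set P : Finset (Fin n) → Prop := fun A =>
    ∑ i, |v i| * (if i ∈ A then 1 else -1) ∈ Set.Ioo (x - 1) (x + 1) with hP
  set c : ℝ := ∏ i, Real.exp (-(T * ε i)) with hc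
  have hc0 : 0 < c := Finset.prod_pos fun i _ => Real.exp_pos _
  have hspin : ∀ (σ : Config n) i,
      spin σ i = ε i * (if i ∈ Finset.univ.filter (fun i => σ i = s i) then 1 else -1) := by
    intro σ i
    by_cases h : σ i = s i
    · simp [spin, hεdef, h]
    · have h' := Int.units_ne_iff_eq_neg.1 h
      simp only [Finset.mem_filter, Finset.mem_univ, true_and, h, if_false]
      simp [spin, hεdef, h']
  have hsum : ∑ σ : Config n, (if ∑ i, v i * spin σ i ∈ Set.Ioo (x - 1) (x + 1)
        then Real.exp (T * ∑ i, spin σ i) else 0) =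
      ∑ A ∈ (Finset.univ : Finset (Fin n)).powerset,
        c * (if P A then ∏ i ∈ A, Real.exp (2 * T * ε i) else 0) := by
    refine Finset.sum_nbij' (fun σ => Finset.univ.filter (fun i => σ i = s i))
      (fun A i => if i ∈ A then s i else - s i) ?_ ?_ ?_ ?_ ?_
    · intro σ _; simp
    · intro A _; simp
    · intro σ _
      funext i
      by_cases h : σ i = s i
      · simp [h]
      · simp [Int.units_ne_iff_eq_neg.1 h]
    · intro A _
      ext i
      by_cases h : i ∈ A <;> simp [h]
    · intro σ _
      have h1 : ∑ i, v i * spin σ i = ∑ i, |v i| *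
          (if i ∈ Finset.univ.filter (fun i => σ i = s i) then 1 else -1) := by
        refine Finset.sum_congr rfl fun i _ => ?_
        rw [hspin, ← mul_assoc, hvε]
      rw [h1]
      change (if P (Finset.univ.filter (fun i => σ i = s i)) then _ else _) = _
      split_ifs with h
      · have hprod : ∏ i ∈ Finset.univ.filter (fun i => σ i = s i), Real.exp (2 * T * ε i) =
            ∏ i, if i ∈ Finset.univ.filter (fun i => σ i = s i) then Real.exp (2 * T * ε i)
              else 1 := by
          rw [Finset.prod_ite_mem, Finset.univ_inter]
        rw [Finset.mul_sum, Real.exp_sum, hprod, hc, ← Finset.prod_mul_distrib]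
        refine Finset.prod_congr rfl fun i _ => ?_
        rw [hspin σ i]
        split_ifs
        · rw [← Real.exp_add]; congr 1; ring
        · rw [mul_one]; congr 1; ring
      · simp
  rw [hsum, ← Finset.mul_sum]
  -- One additional element raises the sum by `2 |v i| ≥ 2`, which two points of an open interval of
  -- length 2 cannot differ by.
  have hanti : ∀ A B, B ⊆ (Finset.univ : Finset (Fin n)) → P A → P B → A ⊆ B → A = B := by
    intro A B _ hA hB hAB
    by_contra hne
    obtain ⟨i, hiB, hiA⟩ := Finset.exists_of_ssubset (hAB.ssubset_of_ne hne)
    have h1 : (2 : ℝ) ≤ ∑ i, |v i| * (if i ∈ B then 1 else -1) -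
        ∑ i, |v i| * (if i ∈ A then 1 else -1) := by
      rw [← Finset.sum_sub_distrib]
      have h2 : |v i| * (if i ∈ B then 1 else -1) - |v i| * (if i ∈ A then 1 else -1) ≤
          ∑ i, (|v i| * (if i ∈ B then 1 else -1) - |v i| * (if i ∈ A then 1 else -1)) := by
        refine Finset.single_le_sum
          (f := fun i => |v i| * (if i ∈ B then 1 else -1) - |v i| * (if i ∈ A then 1 else -1))
          (fun j _ => ?_) (Finset.mem_univ i)
        have h3 := abs_nonneg (v j)
        by_cases hj : j ∈ A
        · simp [hj, hAB hj]
        · by_cases hj' : j ∈ B <;> simp [hj, hj']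
      simp only [hiB, hiA, if_true, if_false] at h2
      have := hv i
      linarith
    simp only [hP, Set.mem_Ioo] at hA hB
    linarith [hA.1, hB.2]
  have key := sum_antichain_le (r := fun i => Real.exp (2 * T * ε i)) (fun i => Real.exp_pos _)
    Finset.univ P hanti (M := c⁻¹ * (1 / Real.pi * ∫ u in (-(Real.pi / 2))..(Real.pi / 2),
        (2 * Real.sqrt (Real.cosh T ^ 2 - Real.sin u ^ 2)) ^ n)) (fun k => by
      rw [← div_eq_inv_mul, le_div_iff₀ hc0, mul_comm]
      exact levelWeight_le_integral T ε hε k)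
  have := mul_le_mul_of_nonneg_left key hc0.le
  rw [mul_inv_cancel_left₀ hc0.ne'] at this
  refine le_of_eq_of_le ?_ this
  congr!

end LittlewoodOfford

/-! ### Exact Fourier formulas for the alternating sum, the near-extremal choice. -/

section AlternatingSigns

lemma sum_config_prod {n : ℕ} {R : Type*} [CommSemiring R] (f : Fin n → ℤˣ → R) :
    ∑ σ : Config n, ∏ i, f i (σ i) = ∏ i, (f i 1 + f i (-1)) := by
  have h := Finset.prod_univ_sum (fun _ : Fin n => (Finset.univ : Finset ℤˣ)) f
  rw [Fintype.piFinset_univ] at h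
  rw [← h]
  refine Finset.prod_congr rfl fun i _ => ?_
  rw [UnitsInt.univ, Finset.sum_pair (by decide)]

lemma sum_exp_mul_sum_spin (n : ℕ) (T : ℝ) :
    ∑ σ : Config n, Real.exp (T * ∑ i, spin σ i) = (2 * Real.cosh T) ^ n := by
  have h := sum_config_prod (n := n) (fun _ s => Real.exp (T * ((s : ℤ) : ℝ)))
  simp only [Finset.prod_const, Finset.card_univ, Fintype.card_fin] at h
  rw [Real.cosh_eq, mul_div_cancel₀ _ (two_ne_zero' ℝ)]
  convert h using 2
  · rw [Finset.mul_sum, Real.exp_sum]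
    rfl
  · simp

/-- The alternating sum `∑ (-1)^i σ_i`. -/
def alternatingSum {n : ℕ} (σ : Config n) : ℤ := ∑ i : Fin n, (-1) ^ (i : ℕ) * (σ i : ℤ)

lemma alternatingSum_cast {n : ℕ} (σ : Config n) :
    ((alternatingSum σ : ℤ) : ℝ) = ∑ i : Fin n, (-1) ^ (i : ℕ) * spin σ i := by
  simp [alternatingSum, spin]

lemma even_alternatingSum_sub {n : ℕ} (σ : Config n) : Even (alternatingSum σ - n) := by
  have h : alternatingSum σ - n = ∑ i : Fin n, ((-1) ^ (i : ℕ) * (σ i : ℤ) - 1) := by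
    simp [alternatingSum]
  rw [h]
  refine Finset.even_sum _ fun i _ => ?_
  rcases neg_one_pow_eq_or ℤ (i : ℕ) with h1 | h1 <;>
    rcases Int.units_eq_one_or (σ i) with h2 | h2 <;> simp [h1, h2]

lemma prod_alternating_even {R : Type*} [CommMonoid R] (f : ℤ → R) (k : ℕ) :
    ∏ i : Fin (2 * k), f ((-1) ^ (i : ℕ)) = (f 1 * f (-1)) ^ k := by
  rw [Fin.prod_univ_eq_prod_range (fun i => f ((-1) ^ i))]
  induction k with
  | zero => simp
  | succ k ih =>
    rw [show 2 * (k + 1) = 2 * k + 1 + 1 by ring, Finset.prod_range_succ, Finset.prod_range_succ,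
      ih, pow_succ (f 1 * f (-1)), pow_succ (-1 : ℤ) (2 * k), pow_mul, mul_assoc]
    simp

lemma prod_alternating_odd {R : Type*} [CommMonoid R] (f : ℤ → R) (k : ℕ) :
    ∏ i : Fin (2 * k + 1), f ((-1) ^ (i : ℕ)) = (f 1 * f (-1)) ^ k * f 1 := by
  rw [Fin.prod_univ_castSucc]
  simp only [Fin.val_castSucc, Fin.val_last]
  rw [prod_alternating_even f k, pow_mul]
  simp

/-- The characteristic function of the alternating sum factorises over the independent spins. The
cosine is its real part. -/
lemma sum_exp_mul_cos (n : ℕ) (T u : ℝ) :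
    ∑ σ : Config n, Real.exp (T * ∑ i, spin σ i) * Real.cos (u * alternatingSum σ) =
      (∏ i : Fin n, (2 * Complex.cosh (T + ((-1) ^ (i : ℕ) : ℤ) * u * Complex.I))).re := by
  have h := sum_config_prod (n := n) (fun i s => Complex.exp
    ((T + ((-1) ^ (i : ℕ) : ℤ) * u * Complex.I) * (s : ℤ)))
  have h2 : ∀ i : Fin n, Complex.exp ((T + ((-1) ^ (i : ℕ) : ℤ) * u * Complex.I) *
        ((1 : ℤˣ) : ℤ)) + Complex.exp ((T + ((-1) ^ (i : ℕ) : ℤ) * u * Complex.I) *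
        ((-1 : ℤˣ) : ℤ)) = 2 * Complex.cosh (T + ((-1) ^ (i : ℕ) : ℤ) * u * Complex.I) := by
    intro i
    rw [Complex.cosh, mul_div_cancel₀ _ (two_ne_zero' ℂ)]
    simp
  simp_rw [h2] at h
  rw [← h, Complex.re_sum]
  refine Finset.sum_congr rfl fun σ _ => ?_
  rw [← Complex.exp_sum]
  have h3 : ∑ i : Fin n, (T + ((-1) ^ (i : ℕ) : ℤ) * u * Complex.I) * ((σ i : ℤ) : ℂ) =
      ((T * ∑ i, spin σ i : ℝ) : ℂ) + ((u * alternatingSum σ : ℝ) : ℂ) * Complex.I := by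
    rw [alternatingSum_cast]
    push_cast [spin]
    rw [Finset.mul_sum, Finset.mul_sum, Finset.sum_mul, ← Finset.sum_add_distrib]
    refine Finset.sum_congr rfl fun i _ => ?_
    ring
  rw [h3, Complex.exp_add, ← Complex.ofReal_exp, Complex.re_ofReal_mul,
    Complex.exp_ofReal_mul_I_re]

/-- Two neighbouring spins carry opposite phases, so their factors are complex conjugates and
multiply to the squared modulus of `norm_one_add_exp_mul`. This is why alternating signs lose
nothing against the triangle inequality used in the upper bound. -/
lemma two_cosh_mul_two_cosh (T u : ℝ) :
    2 * Complex.cosh (T + ((1 : ℤ) : ℂ) * u * Complex.I) *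
      (2 * Complex.cosh (T + ((-1 : ℤ) : ℂ) * u * Complex.I)) =
      ((4 * (Real.cosh T ^ 2 - Real.sin u ^ 2) : ℝ) : ℂ) := by
  push_cast
  rw [one_mul, neg_one_mul, neg_mul, Complex.cosh_add, Complex.cosh_add, Complex.cosh_neg,
    Complex.sinh_neg, Complex.cosh_mul_I, Complex.sinh_mul_I]
  have h1 := Complex.sin_sq_add_cos_sq (u : ℂ)
  have h2 := Complex.cosh_sq (T : ℂ)
  have h3 := Complex.I_sq
  linear_combination (-4 * Complex.sinh T ^ 2 * Complex.sin u ^ 2) * h3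
    + 4 * Complex.cosh T ^ 2 * h1 - 4 * Complex.sin u ^ 2 * h2

lemma sum_exp_mul_cos_even (k : ℕ) (T u : ℝ) :
    ∑ σ : Config (2 * k), Real.exp (T * ∑ i, spin σ i) * Real.cos (u * alternatingSum σ) =
      (4 * (Real.cosh T ^ 2 - Real.sin u ^ 2)) ^ k := by
  rw [sum_exp_mul_cos, prod_alternating_even
    (fun m : ℤ => 2 * Complex.cosh (T + (m : ℂ) * u * Complex.I)) k, two_cosh_mul_two_cosh,
    ← Complex.ofReal_pow, Complex.ofReal_re]

lemma sum_exp_mul_cos_odd (k : ℕ) (T u : ℝ) :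
    ∑ σ : Config (2 * k + 1), Real.exp (T * ∑ i, spin σ i) * Real.cos (u * alternatingSum σ) =
      (4 * (Real.cosh T ^ 2 - Real.sin u ^ 2)) ^ k * (2 * Real.cosh T * Real.cos u) := by
  rw [sum_exp_mul_cos, prod_alternating_odd
    (fun m : ℤ => 2 * Complex.cosh (T + (m : ℂ) * u * Complex.I)) k, two_cosh_mul_two_cosh,
    ← Complex.ofReal_pow, Complex.re_ofReal_mul]
  congr 1
  rw [Int.cast_one, one_mul, Complex.cosh_add, Complex.cosh_mul_I, Complex.sinh_mul_I,
    ← Complex.ofReal_cosh, ← Complex.ofReal_sinh, ← Complex.ofReal_cos, ← Complex.ofReal_sin]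
  simp [Complex.cos_ofReal_re]
  ring

lemma integral_cos_even_mul (j : ℤ) :
    ∫ u in (-(Real.pi / 2))..(Real.pi / 2), Real.cos (u * (2 * j)) =
      if j = 0 then Real.pi else 0 := by
  split_ifs with hj
  · subst hj
    simp
  · have hc : (2 * j : ℝ) ≠ 0 := by simp [hj]
    rw [intervalIntegral.integral_comp_mul_right (fun x => Real.cos x) hc, integral_cos,
      show Real.pi / 2 * (2 * j) = j * Real.pi by ring,
      show -(Real.pi / 2) * (2 * j) = (-j : ℤ) * Real.pi by push_cast; ring,
      Real.sin_int_mul_pi, Real.sin_int_mul_pi]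
    simp

/-- The weight of `{∑ (-1)^i σ_i = 0}` for an even number of spins in a field. -/
lemma sum_alternatingSum_eq_zero (k : ℕ) (T : ℝ) :
    ∑ σ : Config (2 * k), (if alternatingSum σ = 0 then Real.exp (T * ∑ i, spin σ i) else 0) =
      1 / Real.pi * ∫ u in (-(Real.pi / 2))..(Real.pi / 2),
        (4 * (Real.cosh T ^ 2 - Real.sin u ^ 2)) ^ k := by
  have hpi := Real.pi_pos
  simp_rw [← sum_exp_mul_cos_even]
  rw [intervalIntegral.integral_finsetSum fun σ _ => by
    apply Continuous.intervalIntegrable; fun_prop, Finset.mul_sum]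
  refine Finset.sum_congr rfl fun σ _ => ?_
  rw [intervalIntegral.integral_const_mul]
  have h1 := even_alternatingSum_sub σ
  obtain ⟨j, hj⟩ : ∃ j : ℤ, alternatingSum σ = 2 * j := by
    obtain ⟨j, hj⟩ := h1
    exact ⟨j + k, by push_cast at hj; omega⟩
  have h2 := integral_cos_even_mul j
  rw [hj]
  push_cast
  rw [h2]
  by_cases h : j = 0
  · simp [h]; field_simp
  · simp [h]

/-- The weight of `{∑ (-1)^i σ_i = ±1}` for an odd number of spins in a field. -/
lemma sum_alternatingSum_eq_one (k : ℕ) (T : ℝ) :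
    ∑ σ : Config (2 * k + 1),
        (if alternatingSum σ = 1 then Real.exp (T * ∑ i, spin σ i) else 0) +
      ∑ σ : Config (2 * k + 1),
        (if alternatingSum σ = -1 then Real.exp (T * ∑ i, spin σ i) else 0) =
      2 / Real.pi * ∫ u in (-(Real.pi / 2))..(Real.pi / 2),
        (4 * (Real.cosh T ^ 2 - Real.sin u ^ 2)) ^ k * (2 * Real.cosh T * Real.cos u) *
          Real.cos u := by
  have hpi := Real.pi_pos
  simp_rw [← sum_exp_mul_cos_odd, Finset.sum_mul]
  rw [intervalIntegral.integral_finsetSum fun σ _ => by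
    apply Continuous.intervalIntegrable; fun_prop, Finset.mul_sum, ← Finset.sum_add_distrib]
  refine Finset.sum_congr rfl fun σ _ => ?_
  have h1 := even_alternatingSum_sub σ
  obtain ⟨j, hj⟩ : ∃ j : ℤ, alternatingSum σ = 2 * j + 1 := by
    obtain ⟨j, hj⟩ := h1
    exact ⟨j + k, by push_cast at hj; omega⟩
  -- For odd `n` the alternating sum is odd. Multiplying by `cos u` shifts it by `±1` to even
  -- frequencies, so orthogonality on an interval of length `π` detects the values `1` and `-1`
  -- together.
  have h3 : ∀ u : ℝ, Real.exp (T * ∑ i, spin σ i) * Real.cos (u * alternatingSum σ) * Real.cos u =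
      Real.exp (T * ∑ i, spin σ i) / 2 * (Real.cos (u * (2 * j)) +
        Real.cos (u * (2 * (j + 1 : ℤ)))) := by
    intro u
    rw [hj, show u * (2 * j) = u * ((2 * j + 1 : ℤ) : ℝ) - u by push_cast; ring,
      show u * (2 * (j + 1 : ℤ)) = u * ((2 * j + 1 : ℤ) : ℝ) + u by push_cast; ring,
      Real.cos_sub, Real.cos_add]
    ring
  simp_rw [h3]
  rw [intervalIntegral.integral_const_mul, intervalIntegral.integral_add
    (by apply Continuous.intervalIntegrable; fun_prop)
    (by apply Continuous.intervalIntegrable; fun_prop),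
    integral_cos_even_mul, integral_cos_even_mul, hj]
  by_cases h : j = 0
  · simp [h]; field_simp
  · by_cases h' : j = -1
    · simp [h']; field_simp
    · have h4 : j + 1 ≠ 0 := by omega
      have h5 : 2 * j + 1 ≠ 1 := by omega
      have h6 : 2 * j + 1 ≠ -1 := by omega
      simp [h, h4, h6]

end AlternatingSigns

/-! ### Comparison of trigonometric integrals with Gaussian ones, with explicit error order. -/

section GaussianComparison

open MeasureTheory

lemma integral_pow_mul_exp_scale (m : ℕ) (c : ℝ) {a : ℝ} (ha : 0 < a) :
    ∫ u : ℝ, u ^ m * Real.exp (-(c * a) * u ^ 2) =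
      (Real.sqrt a)⁻¹ ^ (m + 1) * ∫ u : ℝ, u ^ m * Real.exp (-c * u ^ 2) := by
  have hs := Real.sqrt_pos.2 ha
  have h1 := Measure.integral_comp_mul_left (fun u : ℝ => u ^ m * Real.exp (-c * u ^ 2))
    (Real.sqrt a)
  rw [abs_of_pos (inv_pos.2 hs), smul_eq_mul] at h1
  have h2 : ∀ u : ℝ, (Real.sqrt a * u) ^ m * Real.exp (-c * (Real.sqrt a * u) ^ 2) =
      Real.sqrt a ^ m * (u ^ m * Real.exp (-(c * a) * u ^ 2)) := by
    intro u
    rw [mul_pow, mul_pow _ u 2, Real.sq_sqrt ha.le]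
    ring_nf
  simp_rw [h2] at h1
  rw [integral_const_mul] at h1
  rw [pow_succ, mul_assoc, ← h1, ← mul_assoc, ← mul_pow, inv_mul_cancel₀ hs.ne', one_pow, one_mul]

lemma mul_inv_sqrt_sq {a : ℝ} (ha : 0 < a) : a * (Real.sqrt a)⁻¹ ^ 2 = 1 := by
  rw [inv_pow, Real.sq_sqrt ha.le, mul_inv_cancel₀ ha.ne']

lemma integrable_pow_mul_exp_neg (m : ℕ) {c : ℝ} (hc : 0 < c) :
    Integrable fun u : ℝ => u ^ m * Real.exp (-c * u ^ 2) := by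
  have := integrable_rpow_mul_exp_neg_mul_sq hc (s := m) (by linarith [m.cast_nonneg (α := ℝ)])
  simpa using this

lemma sq_sub_sin_sq_le (u : ℝ) : u ^ 2 - Real.sin u ^ 2 ≤ u ^ 4 / 3 := by
  wlog hu : 0 ≤ u generalizing u
  · have := this (-u) (by linarith)
    rw [Real.sin_neg] at this
    nlinarith
  have h1 := Real.sin_ge_sub_cube hu
  have h2 := Real.sin_le hu
  have h3 : -u ≤ Real.sin u := by
    have := neg_le_of_abs_le (Real.abs_sin_le_abs (x := u))
    rwa [abs_of_nonneg hu] at this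
  nlinarith [mul_nonneg (sub_nonneg.2 h2) (by linarith : 0 ≤ u + Real.sin u),
    mul_nonneg hu (sub_nonneg.2 h1), pow_nonneg hu 3,
    mul_nonneg (pow_nonneg hu 3) (sub_nonneg.2 h2),
    mul_nonneg (by linarith : 0 ≤ u + Real.sin u) (sub_nonneg.2 h1)]

lemma sin_sq_le_sq (u : ℝ) : Real.sin u ^ 2 ≤ u ^ 2 :=
  sq_le_sq.2 Real.abs_sin_le_abs

/-- The constant in Jordan's inequality `(4/π²) u² ≤ sin² u`. -/
noncomputable def jordanConst : ℝ := (2 / Real.pi) ^ 2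

lemma jordanConst_pos : 0 < jordanConst := by
  have := Real.pi_pos
  unfold jordanConst
  positivity

lemma jordanConst_le_one : jordanConst ≤ 1 := by
  have h := Real.two_le_pi
  unfold jordanConst
  exact pow_le_one₀ (by positivity) (by rw [div_le_one Real.pi_pos]; exact h)

lemma jordanConst_mul_sq_le {u : ℝ} (hu : |u| ≤ Real.pi / 2) :
    jordanConst * u ^ 2 ≤ Real.sin u ^ 2 := by
  have h1 := Real.mul_le_sin (abs_nonneg u) hu
  have h2 : Real.sin |u| ^ 2 = Real.sin u ^ 2 := by
    rcases abs_choice u with h | h <;> rw [h]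
    rw [Real.sin_neg, neg_sq]
  have hpi := Real.pi_pos
  rw [← h2, ← sq_abs u, jordanConst, ← mul_pow]
  exact pow_le_pow_left₀ (by positivity) h1 2

lemma exp_neg_mul_sin_sq_le {a u : ℝ} (ha : 0 ≤ a) (hu : |u| ≤ Real.pi / 2) :
    Real.exp (-a * Real.sin u ^ 2) ≤ Real.exp (-(jordanConst * a) * u ^ 2) :=
  Real.exp_le_exp.2 (by nlinarith [mul_le_mul_of_nonneg_left (jordanConst_mul_sq_le hu) ha])

lemma interval_eq_integral_indicator (f : ℝ → ℝ) :
    ∫ u in (-(Real.pi / 2))..(Real.pi / 2), f u =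
      ∫ u, (Set.Ioc (-(Real.pi / 2)) (Real.pi / 2)).indicator f u := by
  rw [intervalIntegral.integral_of_le (by linarith [Real.pi_pos]),
    integral_indicator measurableSet_Ioc]

lemma integrable_indicator_Ioc {f : ℝ → ℝ} (hf : Continuous f) (a b : ℝ) :
    Integrable ((Set.Ioc a b).indicator f) := by
  rw [integrable_indicator_iff measurableSet_Ioc]
  exact hf.continuousOn.integrableOn_Icc.mono_set Set.Ioc_subset_Icc_self

/-- Gaussian upper bound for `∫ exp (-a sin² u) du` with an error of relative order `1 / a`. -/
lemma exists_integral_exp_sin_sq_le : ∃ C : ℝ, 0 ≤ C ∧ ∀ a : ℝ, 0 < a →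
    ∫ u in (-(Real.pi / 2))..(Real.pi / 2), Real.exp (-a * Real.sin u ^ 2) ≤
      Real.sqrt Real.pi * (Real.sqrt a)⁻¹ + C * (Real.sqrt a)⁻¹ ^ 3 := by
  set M := ∫ u : ℝ, u ^ 4 * Real.exp (-jordanConst * u ^ 2) with hM
  have hM0 : 0 ≤ M := integral_nonneg fun u => by positivity
  refine ⟨1 / 3 * M, by positivity, fun a ha => ?_⟩
  have hca := mul_pos jordanConst_pos ha
  have hsa := Real.sqrt_pos.2 ha
  rw [interval_eq_integral_indicator]
  have hint : Integrable fun u : ℝ => Real.exp (-a * u ^ 2) +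
      a / 3 * (u ^ 4 * Real.exp (-(jordanConst * a) * u ^ 2)) :=
    (integrable_exp_neg_mul_sq ha).add ((integrable_pow_mul_exp_neg 4 hca).const_mul _)
  calc _ ≤ ∫ u : ℝ, (Real.exp (-a * u ^ 2) +
      a / 3 * (u ^ 4 * Real.exp (-(jordanConst * a) * u ^ 2))) := by
        refine integral_mono (integrable_indicator_Ioc (by fun_prop) _ _) hint fun u => ?_
        by_cases hu : u ∈ Set.Ioc (-(Real.pi / 2)) (Real.pi / 2)
        · rw [Set.indicator_of_mem hu]
          have hu' : |u| ≤ Real.pi / 2 := abs_le.2 ⟨hu.1.le, hu.2⟩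
          have h1 := exp_neg_mul_sin_sq_le ha.le hu'
          -- Replacing `sin² u` by `u²` costs a factor at least `1 - a (u² - sin² u)`, hence an
          -- error `a u⁴ / 3` times the integrand. Jordan's inequality dominates that integrand by a
          -- Gaussian, and scaling makes the error of order `a^{-3/2}`.
          have h2 := Real.add_one_le_exp (-a * (u ^ 2 - Real.sin u ^ 2))
          have h3 : Real.exp (-a * u ^ 2) = Real.exp (-a * Real.sin u ^ 2) *
              Real.exp (-a * (u ^ 2 - Real.sin u ^ 2)) := by
            rw [← Real.exp_add]; congr 1; ring
          have h4 := Real.exp_pos (-a * Real.sin u ^ 2)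
          have h5 := mul_le_mul_of_nonneg_left h2 h4.le
          rw [← h3] at h5
          have h6 := mul_le_mul_of_nonneg_left (sq_sub_sin_sq_le u) (mul_nonneg ha.le h4.le)
          have h7 := mul_le_mul_of_nonneg_left h1 (show 0 ≤ a * (u ^ 4 / 3) by positivity)
          simp only
          nlinarith
        · rw [Set.indicator_of_notMem hu]
          positivity
    _ = _ := by
        rw [integral_add (integrable_exp_neg_mul_sq ha)
          ((integrable_pow_mul_exp_neg 4 hca).const_mul _), integral_const_mul,
          integral_pow_mul_exp_scale 4 _ ha, integral_gaussian, ← hM, Real.sqrt_div Real.pi_pos.le,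
          div_eq_mul_inv (Real.sqrt Real.pi)]
        linear_combination (M / 3 * (Real.sqrt a)⁻¹ ^ 3) * mul_inv_sqrt_sq ha

/-- Gaussian lower bound for `∫ (1 - s sin² u)^k cos² u du`. -/
lemma exists_le_integral_one_sub_sin_sq : ∃ C : ℝ, 0 ≤ C ∧ ∀ (k : ℕ) (s : ℝ), 1 ≤ k → 0 < s →
    s ≤ 1 → Real.sqrt Real.pi * (Real.sqrt (k * s))⁻¹ - C * (Real.sqrt (k * s))⁻¹ ^ 3 ≤
      ∫ u in (-(Real.pi / 2))..(Real.pi / 2),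
        (1 - s * Real.sin u ^ 2) ^ k * Real.cos u ^ 2 := by
  set M := ∫ u : ℝ, u ^ 4 * Real.exp (-jordanConst * u ^ 2) with hM
  set M' := ∫ u : ℝ, u ^ 2 * Real.exp (-jordanConst * u ^ 2) with hM'
  have hM0 : 0 ≤ M := integral_nonneg fun u => by positivity
  have hM0' : 0 ≤ M' := integral_nonneg fun u => by positivity
  refine ⟨M + M', by positivity, fun k s hk hs hs1 => ?_⟩
  have hk0 : (0 : ℝ) < k := by exact_mod_cast hk
  set a : ℝ := k * s with ha'
  have ha : 0 < a := mul_pos hk0 hs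
  have hca := mul_pos jordanConst_pos ha
  have hsa := Real.sqrt_pos.2 ha
  rw [interval_eq_integral_indicator]
  have hi0 := integrable_exp_neg_mul_sq ha
  have hi4 := (integrable_pow_mul_exp_neg 4 hca).const_mul a
  have hi2 := integrable_pow_mul_exp_neg 2 hca
  calc _ = ∫ u : ℝ, (Real.exp (-a * u ^ 2) -
      a * (u ^ 4 * Real.exp (-(jordanConst * a) * u ^ 2)) -
        u ^ 2 * Real.exp (-(jordanConst * a) * u ^ 2)) := by
        have hi04 : Integrable fun u : ℝ => Real.exp (-a * u ^ 2) -
            a * (u ^ 4 * Real.exp (-(jordanConst * a) * u ^ 2)) := hi0.sub hi4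
        rw [integral_sub hi04 hi2, integral_sub hi0 hi4, integral_const_mul,
          integral_pow_mul_exp_scale 4 _ ha, integral_pow_mul_exp_scale 2 _ ha,
          integral_gaussian, ← hM, ← hM', Real.sqrt_div Real.pi_pos.le,
          div_eq_mul_inv (Real.sqrt Real.pi)]
        linear_combination (M * (Real.sqrt a)⁻¹ ^ 3) * mul_inv_sqrt_sq ha
    _ ≤ _ := by
        refine integral_mono ((hi0.sub hi4).sub hi2)
          (integrable_indicator_Ioc (by fun_prop) _ _) fun u => ?_
        simp only
        have hE := Real.exp_pos (-(jordanConst * a) * u ^ 2)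
        by_cases hu : u ∈ Set.Ioc (-(Real.pi / 2)) (Real.pi / 2)
        · rw [Set.indicator_of_mem hu]
          have hu' : |u| ≤ Real.pi / 2 := abs_le.2 ⟨hu.1.le, hu.2⟩
          have h1 := exp_neg_mul_sin_sq_le ha.le hu'
          set x := s * Real.sin u ^ 2 with hx
          have hsin := sin_sq_le_sq u
          have hsin1 := Real.sin_sq_le_one u
          have hx0 : 0 ≤ x := by positivity
          have hx1 : x ≤ 1 := by nlinarith [sq_nonneg (Real.sin u)]
          have hxu : x ≤ s * u ^ 2 := mul_le_mul_of_nonneg_left hsin hs.le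
          have hkx : Real.exp (-a * Real.sin u ^ 2) = Real.exp (-x) ^ k := by
            rw [← Real.exp_nat_mul]; congr 1; rw [ha', hx]; ring
          -- Since `(1 - x) exp x ≥ 1 - x²`, Bernoulli's inequality bounds its `k`-th power below by
          -- `1 - k x²`.
          have h2 : (1 - k * x ^ 2) * Real.exp (-x) ^ k ≤ (1 - x) ^ k := by
            have h3 := one_add_mul_sub_le_pow (n := k) (a := (1 - x) * Real.exp x)
              (by nlinarith [mul_nonneg (sub_nonneg.2 hx1) (Real.exp_pos x).le])
            have h4 : 1 - x ^ 2 ≤ (1 - x) * Real.exp x := by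
              nlinarith [mul_le_mul_of_nonneg_left (Real.add_one_le_exp x) (sub_nonneg.2 hx1)]
            have h5 : 1 - k * x ^ 2 ≤ ((1 - x) * Real.exp x) ^ k := by
              nlinarith
            calc _ ≤ ((1 - x) * Real.exp x) ^ k * Real.exp (-x) ^ k :=
                  mul_le_mul_of_nonneg_right h5 (by positivity)
              _ = (1 - x) ^ k := by
                  rw [← mul_pow, mul_assoc, ← Real.exp_add]; simp
          have h6 : (1 - x) ^ k ≤ Real.exp (-x) ^ k :=
            pow_le_pow_left₀ (by linarith) (Real.one_sub_le_exp_neg x) k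
          have h7 : Real.exp (-a * u ^ 2) ≤ Real.exp (-x) ^ k := by
            rw [← hkx]
            exact Real.exp_le_exp.2 (by nlinarith)
          rw [hkx] at h1
          have h8 : k * x ^ 2 ≤ a * u ^ 4 := by
            have h9 : x ^ 2 ≤ (s * u ^ 2) ^ 2 := pow_le_pow_left₀ hx0 hxu 2
            have h10 : s ^ 2 * u ^ 4 ≤ s * u ^ 4 :=
              mul_le_mul_of_nonneg_right (by nlinarith) (by positivity)
            calc k * x ^ 2 ≤ k * (s * u ^ 4) :=
                  mul_le_mul_of_nonneg_left (by nlinarith) hk0.le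
              _ = a * u ^ 4 := by rw [ha']; ring
          have h11 : k * x ^ 2 * Real.exp (-x) ^ k ≤
              a * u ^ 4 * Real.exp (-(jordanConst * a) * u ^ 2) :=
            mul_le_mul h8 h1 (by positivity) (by positivity)
          -- Writing `cos² = 1 - sin²`, the second part is of lower order and is absorbed in the
          -- `u²` moment.
          have h12 : Real.sin u ^ 2 * (1 - x) ^ k ≤
              u ^ 2 * Real.exp (-(jordanConst * a) * u ^ 2) :=
            mul_le_mul hsin (h6.trans h1) (pow_nonneg (by linarith) k) (by positivity)
          rw [Real.cos_sq']
          nlinarith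
        · rw [Set.indicator_of_notMem hu]
          -- Outside the interval the indicator vanishes, so the minorant must be nonpositive there.
          -- As `u² ≥ 1`, its subtracted `u²` term already outweighs the Gaussian.
          have h1 : 1 ≤ u ^ 2 := by
            have hpi := Real.two_le_pi
            by_contra hlt
            have := abs_lt.1 ((sq_lt_one_iff_abs_lt_one u).1 (not_le.1 hlt))
            exact hu ⟨by linarith, by linarith⟩
          have h2 : Real.exp (-a * u ^ 2) ≤ Real.exp (-(jordanConst * a) * u ^ 2) :=
            Real.exp_le_exp.2 (by
              have := mul_le_mul_of_nonneg_right jordanConst_le_one (mul_nonneg ha.le (sq_nonneg u))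
              linarith)
          have h3 : 0 ≤ a * (u ^ 4 * Real.exp (-(jordanConst * a) * u ^ 2)) := by positivity
          nlinarith

end GaussianComparison

/-! ### Matching upper and lower bounds for the concentration in a fixed field. -/

section FieldBounds

open MeasureTheory

lemma sqrt_two_div_pi : Real.sqrt (2 / Real.pi) = 1 / Real.pi * (Real.sqrt Real.pi * Real.sqrt 2) := by
  have hpi := Real.pi_pos
  have h := Real.sqrt_pos.2 hpi
  rw [Real.sqrt_div zero_le_two]
  have h2 := Real.sq_sqrt hpi.le
  field_simp
  rw [h2]

lemma inv_sqrt_mul_inv_cosh_sq {m : ℝ} (hm : 0 ≤ m) (T : ℝ) :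
    (Real.sqrt (m * (Real.cosh T ^ 2)⁻¹))⁻¹ = Real.cosh T * (Real.sqrt m)⁻¹ := by
  rw [Real.sqrt_mul hm, Real.sqrt_inv, Real.sqrt_sq (Real.cosh_pos T).le, mul_inv, inv_inv,
    mul_comm]

/-- The field-wise upper bound on the concentration of `∑ v_i ε_i`. -/
lemma exists_sum_event_exp_le : ∃ C : ℝ, 0 ≤ C ∧ ∀ (n : ℕ), 1 ≤ n → ∀ (T x : ℝ) (v : Fin n → ℝ),
    (∀ i, 1 ≤ |v i|) → ∀ [∀ σ : Config n,
      Decidable (∑ i, v i * spin σ i ∈ Set.Ioo (x - 1) (x + 1))],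
    ∑ σ : Config n, (if ∑ i, v i * spin σ i ∈ Set.Ioo (x - 1) (x + 1)
        then Real.exp (T * ∑ i, spin σ i) else 0) ≤
      (2 * Real.cosh T) ^ n * (Real.sqrt (2 / Real.pi) * (Real.sqrt n)⁻¹ * Real.cosh T +
        C * (Real.sqrt n)⁻¹ ^ 3 * Real.cosh T ^ 3) := by
  obtain ⟨C, hC0, hC⟩ := exists_integral_exp_sin_sq_le
  have hpi := Real.pi_pos
  refine ⟨1 / Real.pi * (C * Real.sqrt 2 ^ 3), by positivity, fun n hn T x v hv _ => ?_⟩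
  have hn0 : (0 : ℝ) < n := by exact_mod_cast hn
  have hc := Real.cosh_pos T
  set c := Real.cosh T with hcdef
  have h1 := sum_event_exp_le T x v hv
  have h2 := hC (n / 2 * (c ^ 2)⁻¹) (by positivity)
  have hinv : (Real.sqrt (n / 2 * (c ^ 2)⁻¹))⁻¹ = Real.sqrt 2 * c * (Real.sqrt n)⁻¹ := by
    rw [inv_sqrt_mul_inv_cosh_sq (by positivity), Real.sqrt_div hn0.le, inv_div]
    ring
  rw [hinv] at h2
  have h3 : ∫ u in (-(Real.pi / 2))..(Real.pi / 2),
      (2 * Real.sqrt (c ^ 2 - Real.sin u ^ 2)) ^ n ≤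
      (2 * c) ^ n * ∫ u in (-(Real.pi / 2))..(Real.pi / 2),
        Real.exp (-(n / 2 * (c ^ 2)⁻¹) * Real.sin u ^ 2) := by
    rw [← intervalIntegral.integral_const_mul]
    refine intervalIntegral.integral_mono_on (by linarith)
      (by apply Continuous.intervalIntegrable; fun_prop)
      (by apply Continuous.intervalIntegrable; fun_prop) fun u _ => ?_
    -- This is `√(1 - y) ≤ exp (-y/2)` with `y = sin² u / cosh² T`, so the exponent `a` of the
    -- Gaussian comparison is `n / (2 cosh² T)`.
    have h4 : Real.sqrt (c ^ 2 - Real.sin u ^ 2) ≤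
        c * Real.exp (-((c ^ 2)⁻¹ * Real.sin u ^ 2 / 2)) := by
      rw [Real.sqrt_le_left (by positivity), mul_pow, ← Real.exp_nat_mul]
      have h5 := Real.one_sub_le_exp_neg ((c ^ 2)⁻¹ * Real.sin u ^ 2)
      have h6 := mul_le_mul_of_nonneg_left h5 (sq_nonneg c)
      have h7 : ((2 : ℕ) : ℝ) * -((c ^ 2)⁻¹ * Real.sin u ^ 2 / 2) =
          -((c ^ 2)⁻¹ * Real.sin u ^ 2) := by push_cast; ring
      rw [h7]
      calc c ^ 2 - Real.sin u ^ 2 = c ^ 2 * (1 - (c ^ 2)⁻¹ * Real.sin u ^ 2) := by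
            field_simp
        _ ≤ _ := h6
    calc (2 * Real.sqrt (c ^ 2 - Real.sin u ^ 2)) ^ n ≤
          (2 * (c * Real.exp (-((c ^ 2)⁻¹ * Real.sin u ^ 2 / 2)))) ^ n :=
          pow_le_pow_left₀ (by positivity) (mul_le_mul_of_nonneg_left h4 zero_le_two) n
      _ = _ := by
          rw [← mul_assoc, mul_pow, ← Real.exp_nat_mul]
          congr 2
          ring
  have h4 := h3.trans (mul_le_mul_of_nonneg_left h2 (by positivity : 0 ≤ (2 * c) ^ n))
  have h5 := mul_le_mul_of_nonneg_left h4 (by positivity : 0 ≤ 1 / Real.pi)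
  rw [sqrt_two_div_pi]
  refine le_trans (le_of_eq ?_) (h1.trans (h5.trans (le_of_eq ?_)))
  · congr!
  · ring

/-- The factor `cos² u` comes from odd `n`. The same bound serves even `n`, where the integrand
without it is larger. -/
lemma exists_le_integral_cosh_sq_sub_sin_sq : ∃ C : ℝ, 0 ≤ C ∧ ∀ (k : ℕ), 1 ≤ k → ∀ T : ℝ,
    (2 * Real.cosh T) ^ (2 * k) * (1 / Real.pi * (Real.sqrt Real.pi *
      (Real.cosh T * (Real.sqrt k)⁻¹)) - C * (Real.cosh T * (Real.sqrt k)⁻¹) ^ 3) ≤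
      1 / Real.pi * ∫ u in (-(Real.pi / 2))..(Real.pi / 2),
        (4 * (Real.cosh T ^ 2 - Real.sin u ^ 2)) ^ k * Real.cos u ^ 2 := by
  obtain ⟨C, hC0, hC⟩ := exists_le_integral_one_sub_sin_sq
  have hpi := Real.pi_pos
  refine ⟨1 / Real.pi * C, by positivity, fun k hk T => ?_⟩
  have hc := Real.cosh_pos T
  have h1 := hC k (Real.cosh T ^ 2)⁻¹ hk (by positivity)
    (inv_le_one_of_one_le₀ (one_le_pow₀ (Real.one_le_cosh T)))
  rw [inv_sqrt_mul_inv_cosh_sq (Nat.cast_nonneg k)] at h1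
  have h2 := mul_le_mul_of_nonneg_left h1
    (by positivity : 0 ≤ 1 / Real.pi * (2 * Real.cosh T) ^ (2 * k))
  refine le_trans (le_of_eq ?_) (h2.trans (le_of_eq ?_))
  · ring
  · rw [mul_assoc, ← intervalIntegral.integral_const_mul]
    congr 2
    funext u
    rw [← mul_assoc, pow_mul, ← mul_pow]
    congr 2
    field_simp
    ring

lemma sqrt_two_mul_inv_sqrt (k : ℕ) :
    Real.sqrt 2 * (Real.sqrt ((2 * k : ℕ) : ℝ))⁻¹ = (Real.sqrt k)⁻¹ := by
  have h := Real.sqrt_pos.2 (zero_lt_two' ℝ)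
  push_cast
  rw [Real.sqrt_mul zero_le_two, mul_inv, ← mul_assoc, mul_inv_cancel₀ h.ne', one_mul]

lemma exists_le_sum_alternatingSum_eq_zero : ∃ C : ℝ, 0 ≤ C ∧ ∀ (k : ℕ), 1 ≤ k → ∀ T : ℝ,
    (2 * Real.cosh T) ^ (2 * k) * (Real.sqrt (2 / Real.pi) *
      (Real.sqrt ((2 * k : ℕ) : ℝ))⁻¹ * Real.cosh T -
        C * (Real.sqrt ((2 * k : ℕ) : ℝ))⁻¹ ^ 3 * Real.cosh T ^ 3) ≤
      ∑ σ : Config (2 * k), (if alternatingSum σ = 0 then Real.exp (T * ∑ i, spin σ i) else 0) := by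
  obtain ⟨C, hC0, hC⟩ := exists_le_integral_cosh_sq_sub_sin_sq
  have hpi := Real.pi_pos
  refine ⟨C * Real.sqrt 2 ^ 3, by positivity, fun k hk T => ?_⟩
  rw [sum_alternatingSum_eq_zero, sqrt_two_div_pi]
  have h1 := hC k hk T
  rw [← sqrt_two_mul_inv_sqrt] at h1
  refine le_trans (le_of_eq ?_) (h1.trans (mul_le_mul_of_nonneg_left ?_ (by positivity)))
  · ring
  · refine intervalIntegral.integral_mono_on (by linarith)
      (by apply Continuous.intervalIntegrable; fun_prop)
      (by apply Continuous.intervalIntegrable; fun_prop) fun u _ => ?_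
    exact mul_le_of_le_one_right (pow_nonneg
      (mul_nonneg zero_le_four (cosh_sq_sub_sin_sq_nonneg T u)) k) (Real.cos_sq_le_one u)

lemma exists_le_sum_alternatingSum_eq_one : ∃ C : ℝ, 0 ≤ C ∧ ∀ (k : ℕ), 1 ≤ k → ∀ T : ℝ,
    (2 * Real.cosh T) ^ (2 * k + 1) * (2 * (Real.sqrt (2 / Real.pi) *
      (Real.sqrt ((2 * k + 1 : ℕ) : ℝ))⁻¹ * Real.cosh T -
        C * (Real.sqrt ((2 * k + 1 : ℕ) : ℝ))⁻¹ ^ 3 * Real.cosh T ^ 3)) ≤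
      ∑ σ : Config (2 * k + 1),
        (if alternatingSum σ = 1 then Real.exp (T * ∑ i, spin σ i) else 0) +
      ∑ σ : Config (2 * k + 1),
        (if alternatingSum σ = -1 then Real.exp (T * ∑ i, spin σ i) else 0) := by
  obtain ⟨C, hC0, hC⟩ := exists_le_integral_cosh_sq_sub_sin_sq
  have hpi := Real.pi_pos
  refine ⟨C * Real.sqrt 3 ^ 3, by positivity, fun k hk T => ?_⟩
  rw [sum_alternatingSum_eq_one, sqrt_two_div_pi]
  have hk0 : (0 : ℝ) < k := by exact_mod_cast hk
  have hk1 : (1 : ℝ) ≤ k := by exact_mod_cast hk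
  have h1 := hC k hk T
  have hc := Real.cosh_pos T
  set c := Real.cosh T with hcdef
  set r := (Real.sqrt ((2 * k + 1 : ℕ) : ℝ))⁻¹ with hr
  set ρ := (Real.sqrt (k : ℝ))⁻¹ with hρ
  have hr0 : 0 ≤ r := by positivity
  have hρ0 : 0 ≤ ρ := by positivity
  -- With `n = 2k + 1` the integral naturally gives `k^{-1/2}`. From `2k ≤ n` the main term can only
  -- grow when rewritten through `n`, and `n ≤ 3k` keeps the error of order `n^{-3/2}`.
  have h2 : Real.sqrt 2 * r ≤ ρ := by
    rw [hρ, ← sqrt_two_mul_inv_sqrt, hr]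
    gcongr
    linarith
  have h3 : ρ ≤ Real.sqrt 3 * r := by
    rw [hρ, hr, ← div_eq_mul_inv, inv_le_comm₀ (by positivity) (by positivity), inv_div,
      div_le_iff₀ (by positivity), ← Real.sqrt_mul hk0.le]
    apply Real.sqrt_le_sqrt
    push_cast
    linarith
  have h4 : ∫ u in (-(Real.pi / 2))..(Real.pi / 2), (4 * (c ^ 2 - Real.sin u ^ 2)) ^ k *
      (2 * c * Real.cos u) * Real.cos u = 2 * c * ∫ u in (-(Real.pi / 2))..(Real.pi / 2),
        (4 * (c ^ 2 - Real.sin u ^ 2)) ^ k * Real.cos u ^ 2 := by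
    rw [← intervalIntegral.integral_const_mul]
    congr 1
    funext u
    ring
  rw [h4]
  have h5 : 1 / Real.pi * (Real.sqrt Real.pi * Real.sqrt 2) * r * c -
      C * Real.sqrt 3 ^ 3 * r ^ 3 * c ^ 3 ≤
      1 / Real.pi * (Real.sqrt Real.pi * (c * ρ)) - C * (c * ρ) ^ 3 := by
    have h6 : 1 / Real.pi * (Real.sqrt Real.pi * Real.sqrt 2) * r * c ≤
        1 / Real.pi * (Real.sqrt Real.pi * (c * ρ)) := by
      calc _ = 1 / Real.pi * (Real.sqrt Real.pi * (c * (Real.sqrt 2 * r))) := by ring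
        _ ≤ _ := by gcongr
    have h7 : C * (c * ρ) ^ 3 ≤ C * Real.sqrt 3 ^ 3 * r ^ 3 * c ^ 3 := by
      calc _ ≤ C * (c * (Real.sqrt 3 * r)) ^ 3 := by gcongr
        _ = _ := by ring
    linarith
  have h8 := mul_le_mul_of_nonneg_left h5 (by positivity : 0 ≤ 2 * (2 * c) ^ (2 * k + 1))
  have h9 := mul_le_mul_of_nonneg_left h1 (by positivity : 0 ≤ 4 * c)
  refine le_trans (le_of_eq ?_) (h8.trans (le_trans (le_of_eq ?_) (h9.trans (le_of_eq ?_))))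
  · ring
  · rw [pow_succ]; ring
  · ring

end FieldBounds

/-! ### The law of the random field and its Stein identity. -/

section FieldMeasure

open MeasureTheory ProbabilityTheory

lemma integrable_cosh_pow_gaussianReal (m : ℝ) (v : NNReal) (k : ℕ) :
    Integrable (fun T => Real.cosh T ^ k) (gaussianReal m v) := by
  have h := (integrable_exp_mul_gaussianReal (μ := m) (v := v) k).add
    (integrable_exp_mul_gaussianReal (μ := m) (v := v) (-k))
  refine h.mono' (by fun_prop) (ae_of_all _ fun T => ?_)
  rw [Real.norm_eq_abs, abs_of_nonneg (pow_nonneg (Real.cosh_pos T).le k)]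
  have h1 : Real.cosh T ≤ Real.exp |T| := by
    rw [← Real.cosh_abs, Real.cosh_eq]
    have := Real.exp_le_exp.2 (neg_le_self (abs_nonneg T))
    linarith
  calc Real.cosh T ^ k ≤ Real.exp |T| ^ k := pow_le_pow_left₀ (Real.cosh_pos T).le h1 k
    _ = Real.exp (k * |T|) := by rw [← Real.exp_nat_mul]
    _ ≤ _ := by
      simp only [Pi.add_apply]
      rcases abs_choice T with h | h <;> rw [h]
      · linarith [Real.exp_pos (-k * T)]
      · rw [mul_neg, ← neg_mul]; linarith [Real.exp_pos (k * T)]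

/-- Growth at most a power of `cosh` is the class of test functions for Stein's identity. It is
stable under multiplication by `cosh^n` and by linear functions. -/
lemma integrable_gaussianReal_of_le_cosh_pow (m : ℝ) (v : NNReal) {g : ℝ → ℝ} (hg : Measurable g)
    {C : ℝ} {k : ℕ} (hb : ∀ T, |g T| ≤ C * Real.cosh T ^ k) : Integrable g (gaussianReal m v) :=
  ((integrable_cosh_pow_gaussianReal m v k).const_mul C).mono' hg.aestronglyMeasurable
    (ae_of_all _ hb)

lemma integrable_gaussianPDFReal_mul {m : ℝ} {v : NNReal} (hv : v ≠ 0) {g : ℝ → ℝ}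
    (hg : Integrable g (gaussianReal m v)) :
    Integrable (fun T => gaussianPDFReal m v T * g T) := by
  rw [gaussianReal_of_var_ne_zero m hv, integrable_withDensity_iff_integrable_smul'
    (measurable_gaussianPDF m v) (ae_of_all _ fun _ => by simp [gaussianPDF])] at hg
  simpa [toReal_gaussianPDF] using hg

lemma abs_le_cosh (T : ℝ) : |T| ≤ Real.cosh T := by
  rw [← Real.cosh_abs]
  exact (Real.self_le_sinh_iff.2 (abs_nonneg T)).trans (Real.sinh_lt_cosh _).le

lemma abs_sub_le_cosh (T m : ℝ) : |T - m| ≤ (1 + |m|) * Real.cosh T := by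
  have h1 := abs_sub T m
  have h2 := abs_le_cosh T
  have h3 := mul_le_mul_of_nonneg_left (Real.one_le_cosh T) (abs_nonneg m)
  linarith

/-- Stein's identity for Gaussian measures, including degenerate ones. -/
lemma integral_sub_mean_mul_gaussianReal (m : ℝ) (v : NNReal) {F F' : ℝ → ℝ}
    (hF : ∀ T, HasDerivAt F (F' T) T) (hF' : Measurable F') {C : ℝ} {k : ℕ}
    (hb : ∀ T, |F T| ≤ C * Real.cosh T ^ k) (hb' : ∀ T, |F' T| ≤ C * Real.cosh T ^ k) :
    ∫ T, (T - m) * F T ∂(gaussianReal m v) = v * ∫ T, F' T ∂(gaussianReal m v) := by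
  -- Zero variance means a Dirac mass at `m`, and both sides vanish. This covers `β = 0`.
  by_cases hv : v = 0
  · subst hv
    rw [gaussianReal_zero_var, integral_dirac]
    simp
  have hFm : Measurable F :=
    (continuous_iff_continuousAt.2 fun T => (hF T).continuousAt).measurable
  have hv0 : (0 : ℝ) < v := NNReal.coe_pos.2 (pos_iff_ne_zero.2 hv)
  have hi0 := integrable_gaussianPDFReal_mul hv (integrable_gaussianReal_of_le_cosh_pow m v hFm hb)
  have hi1 := integrable_gaussianPDFReal_mul hv
    (integrable_gaussianReal_of_le_cosh_pow m v hF' hb')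
  have hi2 := integrable_gaussianPDFReal_mul hv
    (integrable_gaussianReal_of_le_cosh_pow m v (g := fun T => (T - m) * F T)
      (C := (1 + |m|) * C) (k := k + 1) (by fun_prop) fun T => by
        rw [abs_mul]
        calc _ ≤ ((1 + |m|) * Real.cosh T) * (C * Real.cosh T ^ k) :=
              mul_le_mul (abs_sub_le_cosh T m) (hb T) (abs_nonneg _)
                (mul_nonneg (by positivity) (Real.cosh_pos T).le)
          _ = _ := by ring)
  -- Integration by parts: the derivative of density times `F` has integral zero, and the
  -- logarithmic derivative of the density is `-(T - m)/v`.
  have hd : ∀ T, HasDerivAt (fun T => gaussianPDFReal m v T * F T)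
      (gaussianPDFReal m v T * F' T - (v : ℝ)⁻¹ * (gaussianPDFReal m v T * ((T - m) * F T))) T := by
    intro T
    have h1 : HasDerivAt (fun T : ℝ => -(T - m) ^ 2 / (2 * v)) (-(2 * (T - m)) / (2 * v)) T := by
      have := ((((hasDerivAt_id T).sub_const m).pow 2).neg).div_const (2 * (v : ℝ))
      simpa using this
    have h2 : HasDerivAt (gaussianPDFReal m v)
        (gaussianPDFReal m v T * (-(2 * (T - m)) / (2 * v))) T := by
      have := (h1.exp).const_mul (Real.sqrt (2 * Real.pi * v))⁻¹
      rw [gaussianPDFReal_def]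
      convert! this using 1
      ring
    convert! h2.mul (hF T) using 1
    field_simp
    ring
  have hz := integral_eq_zero_of_hasDerivAt_of_integrable hd (hi1.sub (hi2.const_mul _)) hi0
  rw [integral_sub hi1 (hi2.const_mul _), integral_const_mul] at hz
  rw [integral_gaussianReal_eq_integral_smul hv, integral_gaussianReal_eq_integral_smul hv]
  simp only [smul_eq_mul]
  have := congrArg (fun x => (v : ℝ) * x) hz
  simp only [mul_sub, mul_zero, mul_inv_cancel_left₀ hv0.ne'] at this
  linarith

/-- The law of the random field of the Hubbard-Stratonovich representation: given the field `T`,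
the spins are independent with weights proportional to `exp (± T)`. -/
noncomputable def fieldMeasure (b h : ℝ) (n : ℕ) : Measure ℝ :=
  (gaussianReal h (b / n).toNNReal).tilted (fun T => n * Real.log (Real.cosh T))

lemma exp_mul_log_cosh (n : ℕ) (T : ℝ) :
    Real.exp (n * Real.log (Real.cosh T)) = Real.cosh T ^ n := by
  rw [Real.exp_nat_mul, Real.exp_log (Real.cosh_pos T)]

variable (b h : ℝ) (n : ℕ)

lemma integrable_exp_mul_log_cosh (m : ℝ) (v : NNReal) :
    Integrable (fun T => Real.exp (n * Real.log (Real.cosh T))) (gaussianReal m v) := by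
  simp_rw [exp_mul_log_cosh]
  exact integrable_cosh_pow_gaussianReal m v n

instance : IsProbabilityMeasure (fieldMeasure b h n) :=
  isProbabilityMeasure_tilted (integrable_exp_mul_log_cosh n _ _)

lemma integral_fieldMeasure (g : ℝ → ℝ) :
    ∫ T, g T ∂(fieldMeasure b h n) =
      (∫ T, Real.cosh T ^ n * g T ∂(gaussianReal h (b / n).toNNReal)) /
        ∫ T, Real.cosh T ^ n ∂(gaussianReal h (b / n).toNNReal) := by
  rw [fieldMeasure, integral_tilted]
  simp_rw [exp_mul_log_cosh, smul_eq_mul, div_mul_eq_mul_div]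
  rw [integral_div]

variable {b h n}

lemma integrable_fieldMeasure {g : ℝ → ℝ} (hg : Measurable g) {C : ℝ} {k : ℕ}
    (hb : ∀ T, |g T| ≤ C * Real.cosh T ^ k) : Integrable g (fieldMeasure b h n) := by
  rw [fieldMeasure, integrable_tilted_iff (integrable_exp_mul_log_cosh n _ _)]
  simp_rw [exp_mul_log_cosh, smul_eq_mul]
  refine integrable_gaussianReal_of_le_cosh_pow _ _ (by fun_prop) (C := C) (k := n + k) fun T => ?_
  rw [abs_mul, abs_of_nonneg (pow_nonneg (Real.cosh_pos T).le n), pow_add]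
  calc _ ≤ Real.cosh T ^ n * (C * Real.cosh T ^ k) :=
        mul_le_mul_of_nonneg_left (hb T) (pow_nonneg (Real.cosh_pos T).le n)
    _ = _ := by ring

lemma integrable_cosh_pow_fieldMeasure (k : ℕ) :
    Integrable (fun T => Real.cosh T ^ k) (fieldMeasure b h n) :=
  integrable_fieldMeasure (C := 1) (k := k) (by fun_prop) fun T => by
    rw [one_mul, abs_of_nonneg (pow_nonneg (Real.cosh_pos T).le k)]

lemma abs_sinh_le_cosh (T : ℝ) : |Real.sinh T| ≤ Real.cosh T := by
  rw [Real.abs_sinh, ← Real.cosh_abs]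
  exact (Real.sinh_lt_cosh _).le

/-- Stein's identity for the field measure. -/
lemma integral_stein (hb : 0 ≤ b) (hn : n ≠ 0) {ψ ψ' : ℝ → ℝ}
    (hψ : ∀ T, HasDerivAt ψ (ψ' T) T) (hψ' : Measurable ψ') {C : ℝ} {k : ℕ}
    (hC : ∀ T, |ψ T| ≤ C * Real.cosh T ^ k) (hC' : ∀ T, |ψ' T| ≤ C * Real.cosh T ^ k) :
    ∫ T, ψ T * (T - h - b * Real.tanh T) ∂(fieldMeasure b h n) =
      b / n * ∫ T, ψ' T ∂(fieldMeasure b h n) := by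
  have hn0 : (0 : ℝ) < n := by exact_mod_cast Nat.pos_of_ne_zero hn
  have hv : (((b / n).toNNReal : NNReal) : ℝ) = b / n := Real.coe_toNNReal _ (by positivity)
  have hC0 : 0 ≤ C := by
    have := (abs_nonneg _).trans (hC 0)
    simpa using this
  have hψm : Measurable ψ :=
    (continuous_iff_continuousAt.2 fun T => (hψ T).continuousAt).measurable
  have hpow : ∀ T, HasDerivAt (fun T => Real.cosh T ^ n)
      (n * Real.cosh T ^ (n - 1) * Real.sinh T) T := fun T => (Real.hasDerivAt_cosh T).pow n
  have hm1 : ∀ T, |ψ T * Real.cosh T ^ n| ≤ (C * (n + 1)) * Real.cosh T ^ (k + n) := by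
    intro T
    have hc := pow_pos (Real.cosh_pos T) n
    have hc2 := pow_pos (Real.cosh_pos T) (k + n)
    rw [abs_mul, abs_of_pos hc]
    calc _ ≤ (C * Real.cosh T ^ k) * Real.cosh T ^ n := mul_le_mul_of_nonneg_right (hC T) hc.le
      _ = C * 1 * Real.cosh T ^ (k + n) := by ring
      _ ≤ _ := by gcongr; linarith
  have hm2 : ∀ T, |ψ T * (n * Real.cosh T ^ (n - 1) * Real.sinh T)| ≤
      (C * n) * Real.cosh T ^ (k + n) := by
    intro T
    have hc := pow_pos (Real.cosh_pos T) (n - 1)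
    have hc3 := pow_pos (Real.cosh_pos T) k
    rw [abs_mul, abs_mul, abs_mul, abs_of_pos hc, abs_of_pos hn0]
    calc _ ≤ (C * Real.cosh T ^ k) * (n * Real.cosh T ^ (n - 1) * Real.cosh T) := by
          gcongr
          · exact hC T
          · exact abs_sinh_le_cosh T
      _ = (C * n) * (Real.cosh T ^ k * Real.cosh T ^ (n - 1 + 1)) := by ring
      _ = _ := by rw [Nat.sub_add_cancel (Nat.pos_of_ne_zero hn), ← pow_add]
  have hm3 : ∀ T, |ψ' T * Real.cosh T ^ n| ≤ C * Real.cosh T ^ (k + n) := by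
    intro T
    have hc := pow_pos (Real.cosh_pos T) n
    rw [abs_mul, abs_of_pos hc, pow_add, ← mul_assoc]
    exact mul_le_mul_of_nonneg_right (hC' T) hc.le
  -- The Gaussian identity is applied to `ψ cosh^n`. Differentiating `cosh^n` yields `n tanh T
  -- cosh^n T`, and the variance `b/n` turns it into the term `b tanh T` of the drift.
  have hs := integral_sub_mean_mul_gaussianReal h (b / n).toNNReal
    (F := fun T => ψ T * Real.cosh T ^ n)
    (fun T => (hψ T).mul (hpow T)) (C := C * (n + 1)) (k := k + n)
    ((hψ'.mul (by fun_prop)).add (hψm.mul (by fun_prop))) hm1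
    (fun T => (abs_add_le _ _).trans ((add_le_add (hm3 T) (hm2 T)).trans
      (le_of_eq (by ring))))
  have hi3 := integrable_gaussianReal_of_le_cosh_pow h (b / n).toNNReal
    (g := fun T => ψ' T * Real.cosh T ^ n) (hψ'.mul (by fun_prop)) hm3
  have hi2 := integrable_gaussianReal_of_le_cosh_pow h (b / n).toNNReal
    (g := fun T => ψ T * (n * Real.cosh T ^ (n - 1) * Real.sinh T)) (hψm.mul (by fun_prop)) hm2
  have hi1 := integrable_gaussianReal_of_le_cosh_pow h (b / n).toNNReal
    (g := fun T => (T - h) * (ψ T * Real.cosh T ^ n)) (C := (1 + |h|) * (C * (n + 1)))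
    (k := k + n + 1) (by fun_prop) fun T => by
      rw [abs_mul]
      calc _ ≤ ((1 + |h|) * Real.cosh T) * ((C * (n + 1)) * Real.cosh T ^ (k + n)) :=
            mul_le_mul (abs_sub_le_cosh T h) (hm1 T) (abs_nonneg _)
              (mul_nonneg (by positivity) (Real.cosh_pos T).le)
        _ = _ := by ring
  rw [hv, integral_add hi3 hi2] at hs
  rw [integral_fieldMeasure, integral_fieldMeasure, ← mul_div_assoc]
  congr 1
  have h1 : ∀ T, Real.cosh T ^ n * (ψ T * (T - h - b * Real.tanh T)) =
      (T - h) * (ψ T * Real.cosh T ^ n) -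
        b / n * (ψ T * (n * Real.cosh T ^ (n - 1) * Real.sinh T)) := by
    intro T
    have hc := Real.cosh_pos T
    rw [Real.tanh_eq_sinh_div_cosh, ← Nat.sub_add_cancel (Nat.pos_of_ne_zero hn), pow_succ]
    simp only [Nat.add_sub_cancel]
    field_simp
  simp_rw [h1]
  rw [integral_sub hi1 (hi2.const_mul _), integral_const_mul, hs]
  simp_rw [mul_comm (Real.cosh _ ^ n)]
  ring

end FieldMeasure

/-! ### Mixing over the field: `Q_n` in terms of moments of `cosh T`. -/

section QBounds

open MeasureTheory ProbabilityTheory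

variable (d : ℕ) {β : ℝ} (h : ℝ) (n : ℕ)

/-- The moment generating function of a Gaussian with mean `h` and variance `2dβ/n`, evaluated at
the total spin, produces exactly the quadratic and linear terms of the energy. -/
lemma weight_eq_integral (hβ : 0 ≤ β) (σ : Config n) :
    weight d β h n σ =
      ∫ T, Real.exp (T * ∑ i, spin σ i) ∂(gaussianReal h (2 * d * β / n).toNNReal) := by
  have h1 := congrFun (mgf_fun_id_gaussianReal (μ := h) (v := (2 * d * β / n).toNNReal))
    (∑ i, spin σ i)
  rw [mgf, Real.coe_toNNReal _ (by positivity)] at h1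
  simp_rw [mul_comm _ (∑ i, spin σ i)]
  rw [h1, weight]
  congr 1
  ring

lemma integrable_exp_mul_sum_spin (m : ℝ) (v : NNReal) (σ : Config n) :
    Integrable (fun T => Real.exp (T * ∑ i, spin σ i)) (gaussianReal m v) := by
  simp_rw [mul_comm _ (∑ i, spin σ i)]
  exact integrable_exp_mul_gaussianReal _

lemma partitionFunction_eq (hβ : 0 ≤ β) :
    partitionFunction d β h n =
      2 ^ n * ∫ T, Real.cosh T ^ n ∂(gaussianReal h (2 * d * β / n).toNNReal) := by
  unfold partitionFunction
  simp_rw [weight_eq_integral d h n hβ]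
  rw [← integral_finsetSum _ fun σ _ => integrable_exp_mul_sum_spin n _ _ σ]
  simp_rw [sum_exp_mul_sum_spin, mul_pow]
  rw [integral_const_mul]

/-- Hubbard-Stratonovich: the Curie-Weiss model is a mixture of independent spins in a field. -/
lemma prob_eq_integral (hβ : 0 ≤ β) (A : Set (Config n)) [DecidablePred (· ∈ A)] :
    prob d β h n A = ∫ T, (∑ σ : Config n, if σ ∈ A then Real.exp (T * ∑ i, spin σ i) else 0) /
      (2 * Real.cosh T) ^ n ∂(fieldMeasure (2 * d * β) h n) := by
  rw [integral_fieldMeasure, prob]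
  have h1 : ∀ T : ℝ, Real.cosh T ^ n * ((∑ σ : Config n, if σ ∈ A then
      Real.exp (T * ∑ i, spin σ i) else 0) / (2 * Real.cosh T) ^ n) =
      ((2 : ℝ) ^ n)⁻¹ * ∑ σ : Config n, if σ ∈ A then Real.exp (T * ∑ i, spin σ i) else 0 := by
    intro T
    have hc := Real.cosh_pos T
    rw [mul_pow]
    field_simp
  simp_rw [h1]
  rw [integral_const_mul, integral_finsetSum, Finset.mul_sum, Finset.sum_div]
  · refine Finset.sum_congr rfl fun σ _ => ?_
    by_cases hσ : σ ∈ A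
    · simp only [Set.indicator_of_mem hσ, hσ, if_true]
      rw [mass, partitionFunction_eq d h n hβ, weight_eq_integral d h n hβ]
      rw [← div_div, div_eq_inv_mul _ ((2 : ℝ) ^ n)]
    · simp [hσ]
  · intro σ _
    by_cases hσ : σ ∈ A
    · simpa [hσ] using integrable_exp_mul_sum_spin n _ _ σ
    · simp [hσ]

lemma sum_ite_div_nonneg_le (T : ℝ) (A : Set (Config n)) [DecidablePred (· ∈ A)] :
    |(∑ σ : Config n, if σ ∈ A then Real.exp (T * ∑ i, spin σ i) else 0) /
      (2 * Real.cosh T) ^ n| ≤ 1 * Real.cosh T ^ 0 := by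
  have hc := Real.cosh_pos T
  have h0 : 0 ≤ ∑ σ : Config n, if σ ∈ A then Real.exp (T * ∑ i, spin σ i) else 0 :=
    Finset.sum_nonneg fun σ _ => by split_ifs <;> positivity
  rw [abs_of_nonneg (by positivity), pow_zero, mul_one, div_le_one (by positivity),
    ← sum_exp_mul_sum_spin]
  refine Finset.sum_le_sum fun σ _ => ?_
  split_ifs
  · exact le_rfl
  · positivity

lemma integrable_sum_ite_div (b : ℝ) (A : Set (Config n)) [DecidablePred (· ∈ A)] :
    Integrable (fun T => (∑ σ : Config n, if σ ∈ A then Real.exp (T * ∑ i, spin σ i) else 0) /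
      (2 * Real.cosh T) ^ n) (fieldMeasure b h n) := by
  refine integrable_fieldMeasure (Measurable.div (Finset.measurable_sum _ fun σ _ => ?_)
    (by fun_prop)) (sum_ite_div_nonneg_le n · A)
  split_ifs <;> fun_prop

lemma prob_le_one (hβ : 0 ≤ β) (A : Set (Config n)) : prob d β h n A ≤ 1 := by
  classical
  rw [prob_eq_integral d h n hβ]
  calc _ ≤ ∫ _, (1 : ℝ) ∂(fieldMeasure (2 * d * β) h n) :=
        integral_mono (integrable_sum_ite_div h n _ A) (integrable_const _) fun T => by
          simpa using (le_abs_self _).trans (sum_ite_div_nonneg_le n T A)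
    _ = 1 := by simp

lemma prob_le_Q (hβ : 0 ≤ β) (x : ℝ) (v : Fin n → ℝ) (hv : ∀ i, 1 ≤ |v i|) :
    prob d β h n {σ | ∑ i, v i * spin σ i ∈ Set.Ioo (x - 1) (x + 1)} ≤ Q d β h n := by
  refine le_csSup ⟨1, ?_⟩ ⟨x, v, hv, rfl⟩
  rintro p ⟨x, v, -, rfl⟩
  exact prob_le_one d h n hβ _

/-- The first two terms of the expansion of the concentration in the field `T`. -/
lemma integrable_expansion (b a c : ℝ) :
    Integrable (fun T => a * Real.cosh T + c * Real.cosh T ^ 3) (fieldMeasure b h n) := by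
  have h1 := integrable_cosh_pow_fieldMeasure (b := b) (h := h) (n := n) 1
  simp only [pow_one] at h1
  exact (h1.const_mul a).add ((integrable_cosh_pow_fieldMeasure 3).const_mul c)

lemma integral_expansion (b a c : ℝ) :
    ∫ T, (a * Real.cosh T + c * Real.cosh T ^ 3) ∂(fieldMeasure b h n) =
      a * (∫ T, Real.cosh T ∂(fieldMeasure b h n)) +
        c * ∫ T, Real.cosh T ^ 3 ∂(fieldMeasure b h n) := by
  have h1 := integrable_cosh_pow_fieldMeasure (b := b) (h := h) (n := n) 1
  simp only [pow_one] at h1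
  rw [integral_add (h1.const_mul a) ((integrable_cosh_pow_fieldMeasure 3).const_mul c),
    integral_const_mul, integral_const_mul]

lemma setOf_alternating_subset (x : ℤ) :
    {σ : Config n | ∑ i : Fin n, (-1 : ℝ) ^ (i : ℕ) * spin σ i ∈
      Set.Ioo ((x : ℝ) - 1) (x + 1)} = {σ | alternatingSum σ = x} := by
  ext σ
  simp only [Set.mem_ofPred_eq, Set.mem_Ioo, ← alternatingSum_cast]
  constructor
  · rintro ⟨h1, h2⟩
    have h3 : x - 1 < alternatingSum σ := by exact_mod_cast h1
    have h4 : alternatingSum σ < x + 1 := by exact_mod_cast h2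
    omega
  · intro h1
    rw [h1]
    constructor <;> linarith

lemma prob_alternatingSum_le_Q (hβ : 0 ≤ β) (x : ℤ) :
    ∫ T, (∑ σ : Config n, if alternatingSum σ = x then Real.exp (T * ∑ i, spin σ i) else 0) /
      (2 * Real.cosh T) ^ n ∂(fieldMeasure (2 * d * β) h n) ≤ Q d β h n := by
  have h1 := prob_le_Q d h n hβ x (fun i => (-1) ^ (i : ℕ)) fun i => by simp
  rw [setOf_alternating_subset, prob_eq_integral d h n hβ] at h1
  convert! h1

/-- Two-sided bounds for `Q_n` in terms of moments of the random field. -/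
theorem exists_abs_Q_sub_le : ∃ C : ℝ, 0 ≤ C ∧ ∀ (d : ℕ) (β h : ℝ) (n : ℕ), 0 ≤ β → 2 ≤ n →
    |Q d β h n - Real.sqrt (2 / Real.pi) * (Real.sqrt n)⁻¹ *
      ∫ T, Real.cosh T ∂(fieldMeasure (2 * d * β) h n)| ≤
      C * (Real.sqrt n)⁻¹ ^ 3 * ∫ T, Real.cosh T ^ 3 ∂(fieldMeasure (2 * d * β) h n) := by
  obtain ⟨C₁, h10, h1⟩ := exists_sum_event_exp_le
  obtain ⟨C₂, h20, h2⟩ := exists_le_sum_alternatingSum_eq_zero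
  obtain ⟨C₃, h30, h3⟩ := exists_le_sum_alternatingSum_eq_one
  refine ⟨C₁ + C₂ + C₃, by positivity, fun d β h n hβ hn => ?_⟩
  set I := ∫ T, Real.cosh T ∂(fieldMeasure (2 * d * β) h n)
  set J := ∫ T, Real.cosh T ^ 3 ∂(fieldMeasure (2 * d * β) h n) with hJ
  have hJ0 : 0 ≤ J := integral_nonneg fun T => pow_nonneg (Real.cosh_pos T).le 3
  set r := (Real.sqrt n)⁻¹ with hr
  have hr0 : 0 ≤ r := by positivity
  have hrJ : 0 ≤ r ^ 3 * J := by positivity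
  set K := Real.sqrt (2 / Real.pi) with hK
  have hup : Q d β h n ≤ K * r * I + C₁ * r ^ 3 * J := by
    refine csSup_le ⟨_, 0, fun _ => 1, by simp, rfl⟩ ?_
    rintro p ⟨x, v, hv, rfl⟩
    classical
    rw [prob_eq_integral d h n hβ, ← integral_expansion]
    refine integral_mono (integrable_sum_ite_div h n _ _) (integrable_expansion h n _ _ _)
      fun T => ?_
    have hc := Real.cosh_pos T
    simp only
    rw [div_le_iff₀ (by positivity)]
    have := h1 n (by omega) T x v hv
    rw [mul_comm]
    exact this
  have hlow : K * r * I - (C₂ + C₃) * r ^ 3 * J ≤ Q d β h n := by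
    obtain ⟨k, hk | hk⟩ := Nat.even_or_odd' n
    · have h4 := prob_alternatingSum_le_Q d h n hβ 0
      refine le_trans ?_ h4
      have h5 : K * r * I - (C₂ + C₃) * r ^ 3 * J ≤ K * r * I + (-C₂ * r ^ 3) * J := by
        nlinarith
      refine h5.trans ?_
      rw [← integral_expansion]
      refine integral_mono (integrable_expansion h n _ _ _)
        (integrable_sum_ite_div h n _ {σ | alternatingSum σ = 0}) fun T => ?_
      have hc := Real.cosh_pos T
      simp only
      rw [le_div_iff₀ (by positivity)]
      subst hk
      refine le_trans (le_of_eq ?_) (h2 k (by omega) T)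
      ring
    · have h4 := prob_alternatingSum_le_Q d h n hβ 1
      have h4' := prob_alternatingSum_le_Q d h n hβ (-1)
      have h5 : K * r * I - (C₂ + C₃) * r ^ 3 * J ≤ K * r * I + (-C₃ * r ^ 3) * J := by
        nlinarith
      -- For odd `n` only the combined mass of the values `1` and `-1` is known. Each of them is at
      -- most `Q_n`, so half of the sum is.
      have h6 : 2 * (K * r * I + (-C₃ * r ^ 3) * J) ≤ Q d β h n + Q d β h n := by
        refine le_trans ?_ (add_le_add h4 h4')
        have hint : ∀ x : ℤ, Integrable (fun T => (∑ σ : Config n,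
            if alternatingSum σ = x then Real.exp (T * ∑ i, spin σ i) else 0) /
              (2 * Real.cosh T) ^ n) (fieldMeasure (2 * d * β) h n) := fun x =>
          integrable_sum_ite_div h n _ {σ | alternatingSum σ = x}
        rw [← integral_expansion, ← integral_const_mul, ← integral_add (hint 1) (hint (-1))]
        refine integral_mono ((integrable_expansion h n _ _ _).const_mul 2)
          ((hint 1).add (hint (-1))) fun T => ?_
        have hc := Real.cosh_pos T
        simp only
        rw [← add_div, le_div_iff₀ (by positivity)]
        subst hk
        refine le_trans (le_of_eq ?_) (h3 k (by omega) T)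
        ring
      linarith
  rw [abs_le]
  constructor <;> nlinarith [mul_nonneg h10 hrJ, mul_nonneg h20 hrJ, mul_nonneg h30 hrJ]

end QBounds

/-! ### Tangent and Taylor inequalities for hyperbolic functions. -/

section HyperbolicInequalities

lemma cosh_tangent_le (x y : ℝ) : Real.cosh x + Real.sinh x * (y - x) ≤ Real.cosh y := by
  have h1 := mul_le_mul_of_nonneg_left (Real.add_one_le_exp (y - x)) (Real.exp_pos x).le
  have h2 := mul_le_mul_of_nonneg_left (Real.add_one_le_exp (-(y - x))) (Real.exp_pos (-x)).le
  rw [← Real.exp_add] at h1 h2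
  rw [show x + (y - x) = y by ring] at h1
  rw [show -x + -(y - x) = -y by ring] at h2
  rw [Real.cosh_eq, Real.cosh_eq, Real.sinh_eq]
  linarith

lemma sinh_sub_mul_sub_le (x y : ℝ) :
    (Real.sinh x - Real.sinh y) * (x - y) ≤ (Real.cosh x + Real.cosh y) * (x - y) ^ 2 := by
  wlog hxy : y ≤ x generalizing x y
  · have := this y x (le_of_not_ge hxy)
    linarith
  have h1 := mul_le_mul_of_nonneg_left (Real.add_one_le_exp (y - x)) (Real.exp_pos x).le
  have h2 := mul_le_mul_of_nonneg_left (Real.add_one_le_exp (y - x)) (Real.exp_pos (-y)).le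
  rw [← Real.exp_add] at h1 h2
  rw [show x + (y - x) = y by ring] at h1
  rw [show -y + (y - x) = -x by ring] at h2
  have h3 : Real.sinh x - Real.sinh y ≤ (Real.cosh x + Real.cosh y) * (x - y) := by
    rw [Real.cosh_eq, Real.cosh_eq, Real.sinh_eq, Real.sinh_eq]
    nlinarith [mul_nonneg (Real.exp_pos (-x)).le (sub_nonneg.2 hxy),
      mul_nonneg (Real.exp_pos y).le (sub_nonneg.2 hxy)]
  calc _ ≤ (Real.cosh x + Real.cosh y) * (x - y) * (x - y) :=
        mul_le_mul_of_nonneg_right h3 (sub_nonneg.2 hxy)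
    _ = _ := by ring

lemma hasDerivAt_tanh (x : ℝ) : HasDerivAt Real.tanh (1 / Real.cosh x ^ 2) x := by
  have hc := Real.cosh_pos x
  have h := (Real.hasDerivAt_sinh x).div (Real.hasDerivAt_cosh x) hc.ne'
  have h1 : Real.tanh = fun x => Real.sinh x / Real.cosh x := by
    funext y; exact Real.tanh_eq_sinh_div_cosh y
  rw [h1]
  convert! h using 1
  rw [← Real.cosh_sq_sub_sinh_sq x]
  ring

lemma sinh_le_self_mul_cosh {x : ℝ} (hx : 0 ≤ x) : Real.sinh x ≤ x * Real.cosh x := by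
  have h := cosh_tangent_le x 0
  have h2 := Real.one_le_cosh x
  have h3 : Real.sinh x = ∫ y in (0 : ℝ)..x, Real.cosh y := by
    rw [intervalIntegral.integral_eq_sub_of_hasDerivAt (fun y _ => Real.hasDerivAt_sinh y)
      (Real.continuous_cosh.intervalIntegrable _ _)]
    simp
  rw [h3]
  calc _ ≤ ∫ _ in (0 : ℝ)..x, Real.cosh x := by
        refine intervalIntegral.integral_mono_on hx (Real.continuous_cosh.intervalIntegrable _ _)
          (by simp) fun y hy => ?_
        rw [Real.cosh_le_cosh, abs_of_nonneg hy.1, abs_of_nonneg hx]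
        exact hy.2
    _ = _ := by simp

/-- On the positive half-line `tanh` lies below its tangents. -/
lemma tanh_le_tangent {x y : ℝ} (hx : 0 ≤ x) (hy : 0 ≤ y) :
    Real.tanh y ≤ Real.tanh x + (y - x) / Real.cosh x ^ 2 := by
  have hcx := Real.cosh_pos x
  have hcy := Real.cosh_pos y
  -- The tangent inequality with denominators cleared, through `tanh y - tanh x = sinh (y - x) /
  -- (cosh y cosh x)`.
  have key : Real.sinh (y - x) * Real.cosh x ≤ (y - x) * Real.cosh y := by
    rcases le_total x y with hxy | hxy
    · have h1 := sinh_le_self_mul_cosh (sub_nonneg.2 hxy)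
      have h2 : Real.cosh (y - x) * Real.cosh x ≤ Real.cosh y := by
        have h3 : Real.cosh y = Real.cosh (y - x) * Real.cosh x + Real.sinh (y - x) * Real.sinh x := by
          rw [← Real.cosh_add, sub_add_cancel]
        have h4 := mul_nonneg (Real.sinh_nonneg_iff.2 (sub_nonneg.2 hxy)) (Real.sinh_nonneg_iff.2 hx)
        linarith
      calc _ ≤ (y - x) * Real.cosh (y - x) * Real.cosh x := mul_le_mul_of_nonneg_right h1 hcx.le
        _ = (y - x) * (Real.cosh (y - x) * Real.cosh x) := by ring
        _ ≤ _ := mul_le_mul_of_nonneg_left h2 (sub_nonneg.2 hxy)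
    · have h1 := Real.self_le_sinh_iff.2 (sub_nonneg.2 hxy)
      have h2 : Real.cosh y ≤ Real.cosh x := by
        rwa [Real.cosh_le_cosh, abs_of_nonneg hy, abs_of_nonneg hx]
      have h3 : Real.sinh (y - x) = -Real.sinh (x - y) := by rw [← Real.sinh_neg]; congr 1; ring
      rw [h3]
      have := mul_le_mul h1 h2 hcy.le (Real.sinh_nonneg_iff.2 (sub_nonneg.2 hxy))
      linarith
  have h5 : Real.tanh y - Real.tanh x = Real.sinh (y - x) / (Real.cosh y * Real.cosh x) := by
    rw [Real.tanh_eq_sinh_div_cosh, Real.tanh_eq_sinh_div_cosh, Real.sinh_sub]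
    field_simp
  rw [← sub_le_iff_le_add', h5, div_le_div_iff₀ (by positivity) (by positivity)]
  nlinarith [mul_le_mul_of_nonneg_right key hcx.le]

lemma tanh_nonneg {x : ℝ} (hx : 0 ≤ x) : 0 ≤ Real.tanh x := by
  rw [Real.tanh_eq_sinh_div_cosh]
  exact div_nonneg (Real.sinh_nonneg_iff.2 hx) (Real.cosh_pos x).le

lemma one_div_cosh_sq (x : ℝ) : 1 / Real.cosh x ^ 2 = 1 - Real.tanh x ^ 2 := by
  have hc := Real.cosh_pos x
  rw [Real.tanh_eq_sinh_div_cosh]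
  field_simp
  rw [Real.cosh_sq]
  ring

lemma abs_tanh_sub_le (x y : ℝ) : |Real.tanh y - Real.tanh x| ≤ |y - x| := by
  have h := Convex.norm_image_sub_le_of_norm_hasDerivWithin_le (f := Real.tanh) (s := Set.univ)
    (C := 1) (x := x) (y := y) (fun z _ => (hasDerivAt_tanh z).hasDerivWithinAt) (fun z _ => by
      rw [one_div_cosh_sq, Real.norm_eq_abs, abs_le]
      have := Real.tanh_sq_lt_one z
      constructor <;> nlinarith [sq_nonneg (Real.tanh z)]) convex_univ trivial trivial
  simpa using h

/-- Second order Taylor bound for `tanh`. -/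
lemma tangent_sub_le_tanh (x y : ℝ) :
    Real.tanh x + (y - x) / Real.cosh x ^ 2 - 2 * (y - x) ^ 2 ≤ Real.tanh y := by
  have h := Convex.norm_image_sub_le_of_norm_hasDerivWithin_le
    (f := fun z => Real.tanh z - z * (1 / Real.cosh x ^ 2)) (s := Set.uIcc x y)
    (f' := fun z => 1 / Real.cosh z ^ 2 - 1 / Real.cosh x ^ 2)
    (C := 2 * |y - x|) (x := x) (y := y)
    (fun z _ => by
      have := (hasDerivAt_tanh z).sub ((hasDerivAt_id z).mul_const (1 / Real.cosh x ^ 2))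
      rw [one_mul] at this
      exact this.hasDerivWithinAt) (fun z hz => by
      rw [one_div_cosh_sq, one_div_cosh_sq, Real.norm_eq_abs]
      have h1 : 1 - Real.tanh z ^ 2 - (1 - Real.tanh x ^ 2) =
          -((Real.tanh z - Real.tanh x) * (Real.tanh z + Real.tanh x)) := by ring
      rw [h1, abs_neg, abs_mul]
      have h2 := abs_tanh_sub_le x z
      have h3 : |z - x| ≤ |y - x| := Set.abs_sub_left_of_mem_uIcc hz
      have h4 : |Real.tanh z + Real.tanh x| ≤ 2 := by
        have := abs_add_le (Real.tanh z) (Real.tanh x)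
        have := Real.abs_tanh_lt_one z
        have := Real.abs_tanh_lt_one x
        linarith
      calc _ ≤ |y - x| * 2 := mul_le_mul (h2.trans h3) h4 (abs_nonneg _) (abs_nonneg _)
        _ = _ := by ring) (convex_uIcc x y) Set.left_mem_uIcc Set.right_mem_uIcc
  rw [Real.norm_eq_abs, Real.norm_eq_abs, mul_assoc, abs_mul_abs_self] at h
  have h1 := (abs_le.1 h).1
  have h2 : (y - x) / Real.cosh x ^ 2 = (y - x) * (1 / Real.cosh x ^ 2) := by ring
  rw [h2]
  nlinarith

end HyperbolicInequalities

/-! ### Moment bounds from Stein's identity and the upper bound for `E cosh T`. -/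

section Moments

open MeasureTheory

lemma integrable_cosh_fieldMeasure {b h : ℝ} {n : ℕ} :
    Integrable Real.cosh (fieldMeasure b h n) := by
  simpa using integrable_cosh_pow_fieldMeasure (b := b) (h := h) (n := n) 1

lemma measurable_tanh : Measurable Real.tanh :=
  (continuous_iff_continuousAt.2 fun x => (hasDerivAt_tanh x).continuousAt).measurable

lemma abs_stein_drift_le {b : ℝ} (hb : 0 ≤ b) (h T : ℝ) :
    |T - h - b * Real.tanh T| ≤ (1 + |h| + b) * Real.cosh T := by
  have h1 := abs_sub_le_cosh T h
  have h2 : |b * Real.tanh T| ≤ b * Real.cosh T := by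
    rw [abs_mul, abs_of_nonneg hb]
    exact mul_le_mul_of_nonneg_left ((Real.abs_tanh_lt_one T).le.trans (Real.one_le_cosh T)) hb
  have h3 := abs_sub (T - h) (b * Real.tanh T)
  linarith

lemma integrable_mul_drift {b : ℝ} (hb : 0 ≤ b) {h : ℝ} {n : ℕ} {ψ : ℝ → ℝ} (hψ : Measurable ψ)
    {C : ℝ} {k : ℕ} (hC : ∀ T, |ψ T| ≤ C * Real.cosh T ^ k) :
    Integrable (fun T => ψ T * (T - h - b * Real.tanh T)) (fieldMeasure b h n) := by
  have := measurable_tanh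
  refine integrable_fieldMeasure (by fun_prop) (C := C * (1 + |h| + b)) (k := k + 1) fun T => ?_
  rw [abs_mul]
  calc _ ≤ (C * Real.cosh T ^ k) * ((1 + |h| + b) * Real.cosh T) :=
        mul_le_mul (hC T) (abs_stein_drift_le hb h T) (abs_nonneg _)
          ((abs_nonneg _).trans (hC T))
    _ = _ := by ring

lemma cosh_le_two_mul_abs_sinh {T : ℝ} (hT : 1 ≤ |T|) : Real.cosh T ≤ 2 * |Real.sinh T| := by
  rw [← Real.cosh_abs, Real.abs_sinh]
  have h1 := Real.cosh_sub_sinh |T|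
  have h2 : Real.exp (-|T|) ≤ 1 := Real.exp_le_one_iff.2 (by linarith)
  have h3 := Real.self_le_sinh_iff.2 (abs_nonneg T)
  linarith

lemma le_sinh_mul_drift {b : ℝ} (hb : 0 ≤ b) (h T : ℝ) :
    |Real.sinh T| * (|T| - |h| - b) ≤ Real.sinh T * (T - h - b * Real.tanh T) := by
  have h1 : Real.sinh T * T = |Real.sinh T| * |T| := by
    rw [← abs_mul, abs_of_nonneg]
    rcases le_total 0 T with hT | hT
    · exact mul_nonneg (Real.sinh_nonneg_iff.2 hT) hT
    · exact mul_nonneg_of_nonpos_of_nonpos (Real.sinh_nonpos_iff.2 hT) hT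
  have h2 : Real.sinh T * h ≤ |Real.sinh T| * |h| := by rw [← abs_mul]; exact le_abs_self _
  have h3 : Real.sinh T * Real.tanh T ≤ |Real.sinh T| * 1 := by
    refine (le_abs_self _).trans ?_
    rw [abs_mul]
    exact mul_le_mul_of_nonneg_left (Real.abs_tanh_lt_one T).le (abs_nonneg _)
  nlinarith [mul_le_mul_of_nonneg_left h3 hb]

/-- Uniform boundedness of exponential moments of the random field. -/
lemma exists_integral_cosh_cube_le {b : ℝ} (hb : 0 ≤ b) (h : ℝ) :
    ∃ C : ℝ, 0 ≤ C ∧ ∀ᶠ n : ℕ in atTop,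
      ∫ T, Real.cosh T ^ 3 ∂(fieldMeasure b h n) ≤ C := by
  -- Beyond `R` the drift has size at least 2, which compensates the factor in `cosh ≤ 2 |sinh|`.
  -- There `cosh³` is below `sinh cosh²` times the drift, and inside `[-R, R]` the constant `C₀`
  -- suffices.
  set R : ℝ := |h| + b + 2 with hR
  have hR2 : 2 ≤ R := by have := abs_nonneg h; linarith
  set C₀ : ℝ := (1 + R) * Real.cosh R ^ 3 with hC₀
  have hcR := Real.cosh_pos R
  have hC₀0 : 0 ≤ C₀ := by positivity
  refine ⟨2 * C₀, by positivity, ?_⟩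
  filter_upwards [eventually_ge_atTop 1, eventually_ge_atTop ⌈6 * b⌉₊] with n hn1 hn
  have hn0 : (0 : ℝ) < n := by exact_mod_cast hn1
  have h6 : 6 * b ≤ n := (Nat.le_ceil _).trans (by exact_mod_cast hn)
  have hs : ∀ T, |Real.sinh T * Real.cosh T ^ 2| ≤ 3 * Real.cosh T ^ 3 := by
    intro T
    have hc := Real.cosh_pos T
    rw [abs_mul, abs_of_pos (pow_pos hc 2)]
    nlinarith [mul_le_mul_of_nonneg_right (abs_sinh_le_cosh T) (pow_pos hc 2).le, pow_pos hc 3]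
  have hs' : ∀ T, Real.cosh T * Real.cosh T ^ 2 + Real.sinh T * (2 * Real.cosh T * Real.sinh T) ≤
      3 * Real.cosh T ^ 3 := by
    intro T
    have hc := Real.cosh_pos T
    have h1 := Real.cosh_sq T
    nlinarith
  have hs0 : ∀ T, 0 ≤ Real.cosh T * Real.cosh T ^ 2 +
      Real.sinh T * (2 * Real.cosh T * Real.sinh T) := by
    intro T
    have hc := Real.cosh_pos T
    have : 0 ≤ 2 * Real.cosh T * (Real.sinh T * Real.sinh T) :=
      mul_nonneg (by positivity) (mul_self_nonneg _)
    nlinarith [pow_pos hc 3]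
  have hst := integral_stein (b := b) (h := h) (n := n) hb (by omega)
    (ψ := fun T => Real.sinh T * Real.cosh T ^ 2)
    (ψ' := fun T => Real.cosh T * Real.cosh T ^ 2 + Real.sinh T * (2 * Real.cosh T * Real.sinh T))
    (fun T => by
      have := (Real.hasDerivAt_sinh T).mul ((Real.hasDerivAt_cosh T).pow 2)
      convert! this using 1
      simp) (by fun_prop) hs
    (fun T => by rw [abs_of_nonneg (hs0 T)]; exact hs' T)
  have hint := integrable_mul_drift (b := b) hb (h := h) (n := n)
    (ψ := fun T => Real.sinh T * Real.cosh T ^ 2) (by fun_prop) hs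
  have hint3 := integrable_cosh_pow_fieldMeasure (b := b) (h := h) (n := n) 3
  have hpt : ∀ T, Real.cosh T ^ 3 ≤
      Real.sinh T * Real.cosh T ^ 2 * (T - h - b * Real.tanh T) + C₀ := by
    intro T
    have hc := Real.cosh_pos T
    have h1 := mul_le_mul_of_nonneg_right (le_sinh_mul_drift hb h T) (pow_pos hc 2).le
    rcases le_total R |T| with hT | hT
    · have h2 := cosh_le_two_mul_abs_sinh (T := T) (by linarith)
      have h3 : Real.cosh T ≤ |Real.sinh T| * (|T| - |h| - b) := by
        nlinarith [abs_nonneg (Real.sinh T)]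
      nlinarith [mul_le_mul_of_nonneg_right h3 (pow_pos hc 2).le]
    · have h2 : Real.cosh T ≤ Real.cosh R := by
        rw [Real.cosh_le_cosh, abs_of_nonneg (show 0 ≤ R by linarith)]; exact hT
      have h3 : -(R * Real.cosh T) ≤ |Real.sinh T| * (|T| - |h| - b) := by
        have h4 := abs_sinh_le_cosh T
        have h5 : -R ≤ |T| - |h| - b := by have := abs_nonneg T; linarith
        have h6 := mul_le_mul_of_nonneg_left h5 (abs_nonneg (Real.sinh T))
        nlinarith
      have h4 : Real.cosh T ^ 3 ≤ Real.cosh R ^ 3 := pow_le_pow_left₀ hc.le h2 3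
      have h5 := mul_le_mul_of_nonneg_right h3 (pow_pos hc 2).le
      have h7 := mul_le_mul_of_nonneg_left h4 (show 0 ≤ 1 + R by linarith)
      nlinarith
  have h1 := integral_mono hint3 (hint.add (integrable_const C₀)) hpt
  simp only [Pi.add_apply] at h1
  rw [integral_add hint (integrable_const C₀), hst, integral_const] at h1
  have h2 : ∫ T, (Real.cosh T * Real.cosh T ^ 2 + Real.sinh T * (2 * Real.cosh T * Real.sinh T))
      ∂(fieldMeasure b h n) ≤ 3 * ∫ T, Real.cosh T ^ 3 ∂(fieldMeasure b h n) := by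
    rw [← integral_const_mul]
    refine integral_mono (integrable_fieldMeasure (C := 3) (k := 3) (by fun_prop) fun T => by
      rw [abs_of_nonneg (hs0 T)]; exact hs' T) (hint3.const_mul 3) hs'
  -- For `n ≥ 6b` the right side of Stein's identity is at most half of the moment being estimated,
  -- and this moment is already known to be finite, so it can be absorbed.
  have h3 : b / n * (3 * ∫ T, Real.cosh T ^ 3 ∂(fieldMeasure b h n)) ≤
      1 / 2 * ∫ T, Real.cosh T ^ 3 ∂(fieldMeasure b h n) := by
    have hJ : 0 ≤ ∫ T, Real.cosh T ^ 3 ∂(fieldMeasure b h n) :=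
      integral_nonneg fun T => pow_nonneg (Real.cosh_pos T).le 3
    rw [← mul_assoc]
    refine mul_le_mul_of_nonneg_right ?_ hJ
    rw [div_mul_eq_mul_div, div_le_div_iff₀ hn0 two_pos]
    linarith
  have h4 := mul_le_mul_of_nonneg_left h2 (show 0 ≤ b / n by positivity)
  simp at h1
  linarith

lemma integral_cosh_le_cube {b h : ℝ} {n : ℕ} :
    ∫ T, Real.cosh T ∂(fieldMeasure b h n) ≤ ∫ T, Real.cosh T ^ 3 ∂(fieldMeasure b h n) :=
  integral_mono integrable_cosh_fieldMeasure (integrable_cosh_pow_fieldMeasure 3)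
    fun T => le_self_pow₀ (Real.one_le_cosh T) (by norm_num)

/-- Reflection changes the expression only through the external field. Estimates can thus be proved
on the positive half-line and transferred at the price of a term in `h sinh T`. -/
lemma sinh_mul_drift_of_neg {b h T : ℝ} :
    Real.sinh (-T) * (-T - h - b * Real.tanh (-T)) =
      Real.sinh T * (T - h - b * Real.tanh T) + 2 * h * Real.sinh T := by
  rw [Real.sinh_neg, Real.tanh_neg]
  ring

variable {b h t : ℝ}

/-- The mean-field equation says that `t` is a zero of the drift, and `1 - b / cosh² t` is the slope
there. Concavity of `tanh` on the half-line puts the drift above its tangent. -/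
lemma drift_ge (hb : 0 ≤ b) (ht : 0 ≤ t) (heq : b * Real.tanh t = t - h) {x : ℝ} (hx : 0 ≤ x) :
    (1 - b / Real.cosh t ^ 2) * (x - t) ≤ x - h - b * Real.tanh x := by
  have h1 := mul_le_mul_of_nonneg_left (tanh_le_tangent ht hx) hb
  rw [mul_add, heq] at h1
  have h2 : b * ((x - t) / Real.cosh t ^ 2) = b / Real.cosh t ^ 2 * (x - t) := by ring
  linarith

lemma drift_le (hb : 0 ≤ b) (heq : b * Real.tanh t = t - h) (x : ℝ) :
    x - h - b * Real.tanh x ≤ (1 - b / Real.cosh t ^ 2) * (x - t) + 2 * b * (x - t) ^ 2 := by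
  have h1 := mul_le_mul_of_nonneg_left (tangent_sub_le_tanh t x) hb
  rw [mul_sub, mul_add, heq] at h1
  have h2 : b * ((x - t) / Real.cosh t ^ 2) = b / Real.cosh t ^ 2 * (x - t) := by ring
  linarith

/-- For positive arguments combine `drift_ge` with the convexity bound `cosh x - cosh t ≤ sinh x (x
- t)`. For negative ones the reflection term is favourable because `h ≥ 0`. Under the field law the
right side has mean of order `1/n`, which yields the upper bound for `E cosh T`. -/
lemma mul_cosh_sub_le_sinh_mul_drift (hb : 0 ≤ b) (hh : 0 ≤ h) (ht : 0 ≤ t)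
    (heq : b * Real.tanh t = t - h) (hl : 0 ≤ 1 - b / Real.cosh t ^ 2) (T : ℝ) :
    (1 - b / Real.cosh t ^ 2) * (Real.cosh T - Real.cosh t) ≤
      Real.sinh T * (T - h - b * Real.tanh T) := by
  have key : ∀ x : ℝ, 0 ≤ x → (1 - b / Real.cosh t ^ 2) * (Real.cosh x - Real.cosh t) ≤
      Real.sinh x * (x - h - b * Real.tanh x) := by
    intro x hx
    have h1 := mul_le_mul_of_nonneg_left (drift_ge hb ht heq hx) (Real.sinh_nonneg_iff.2 hx)
    have h2 := cosh_tangent_le x t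
    have h3 := mul_le_mul_of_nonneg_left
      (show Real.cosh x - Real.cosh t ≤ Real.sinh x * (x - t) by linarith) hl
    linarith
  rcases le_total 0 T with hT | hT
  · exact key T hT
  · have h1 := key (-T) (by linarith)
    have h2 := sinh_mul_drift_of_neg (b := b) (h := h) (T := -T)
    rw [neg_neg] at h2
    rw [h2, Real.cosh_neg] at *
    have h3 := mul_nonneg hh (Real.sinh_nonneg_iff.2 (show 0 ≤ -T by linarith))
    linarith

lemma abs_sinh_le_one_mul_cosh_pow (T : ℝ) : |Real.sinh T| ≤ 1 * Real.cosh T ^ 1 := by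
  simpa using abs_sinh_le_cosh T

lemma integral_sinh_mul_drift (hb : 0 ≤ b) {n : ℕ} (hn : n ≠ 0) :
    ∫ T, Real.sinh T * (T - h - b * Real.tanh T) ∂(fieldMeasure b h n) =
      b / n * ∫ T, Real.cosh T ∂(fieldMeasure b h n) :=
  integral_stein hb hn Real.hasDerivAt_sinh (by fun_prop) abs_sinh_le_one_mul_cosh_pow
    fun T => by rw [abs_of_pos (Real.cosh_pos T)]; simp

/-- The upper bound `E cosh T ≤ cosh t + O(1/n)`. -/
lemma exists_integral_cosh_le (hb : 0 ≤ b) (hh : 0 ≤ h) (ht : 0 ≤ t)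
    (heq : b * Real.tanh t = t - h) (hl : 0 < 1 - b / Real.cosh t ^ 2) :
    ∃ C : ℝ, 0 ≤ C ∧ ∀ᶠ n : ℕ in atTop,
      ∫ T, Real.cosh T ∂(fieldMeasure b h n) ≤ Real.cosh t + C / n := by
  obtain ⟨C, hC0, hC⟩ := exists_integral_cosh_cube_le hb h
  set l := 1 - b / Real.cosh t ^ 2 with hldef
  refine ⟨b * C / l, by positivity, ?_⟩
  filter_upwards [hC, eventually_ge_atTop 1] with n hn hn1
  have hn0 : (0 : ℝ) < n := by exact_mod_cast hn1
  have h1 := integral_mono ((integrable_cosh_fieldMeasure.sub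
    (integrable_const (Real.cosh t))).const_mul l)
    (integrable_mul_drift hb (by fun_prop) abs_sinh_le_one_mul_cosh_pow)
    (mul_cosh_sub_le_sinh_mul_drift (b := b) (h := h) hb hh ht heq hl.le)
    (μ := fieldMeasure b h n)
  rw [integral_sinh_mul_drift hb (by omega), integral_const_mul] at h1
  simp only [Pi.sub_apply] at h1
  rw [integral_sub integrable_cosh_fieldMeasure (integrable_const _), integral_const] at h1
  have h2 := mul_le_mul_of_nonneg_left ((integral_cosh_le_cube (b := b) (h := h) (n := n)).trans hn)
    (show 0 ≤ b / n by positivity)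
  simp at h1
  have h3 : l * (∫ T, Real.cosh T ∂(fieldMeasure b h n) - Real.cosh t) ≤ b / n * C := by linarith
  have h4 : ∫ T, Real.cosh T ∂(fieldMeasure b h n) - Real.cosh t ≤ b / n * C / l := by
    rw [le_div_iff₀ hl]; linarith
  have h5 : b / n * C / l = b * C / l / n := by ring
  linarith

end Moments

/-! ### The potential of the field and a Laplace estimate for rare regions. -/

section Laplace

open MeasureTheory ProbabilityTheory

/-- The large deviation potential of the random field. -/
noncomputable def potential (b h T : ℝ) : ℝ := Real.log (Real.cosh T) - (T - h) ^ 2 / (2 * b)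

variable {b h t : ℝ} {n : ℕ}

lemma hasDerivAt_potential (hb : 0 < b) (T : ℝ) :
    HasDerivAt (potential b h) (-(T - h - b * Real.tanh T) / b) T := by
  have hc := Real.cosh_pos T
  have h1 := (Real.hasDerivAt_cosh T).log hc.ne'
  have h2 := (((hasDerivAt_id T).sub_const h).pow 2).div_const (2 * b)
  convert! h1.sub h2 using 1
  rw [Real.tanh_eq_sinh_div_cosh]
  simp
  field_simp

lemma continuous_potential (hb : 0 < b) : Continuous (potential b h) :=
  continuous_iff_continuousAt.2 fun T => (hasDerivAt_potential hb T).continuousAt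

lemma cosh_pow_mul_gaussianPDFReal (hb : 0 < b) (hn : n ≠ 0) (T : ℝ) :
    gaussianPDFReal h (b / n).toNNReal T * Real.cosh T ^ n =
      (Real.sqrt (2 * Real.pi * (b / n)))⁻¹ * Real.exp (n * potential b h T) := by
  have hn0 : (0 : ℝ) < n := by exact_mod_cast Nat.pos_of_ne_zero hn
  rw [gaussianPDFReal, Real.coe_toNNReal _ (by positivity), mul_assoc, ← exp_mul_log_cosh,
    ← Real.exp_add]
  congr 2
  rw [potential]
  field_simp
  ring

lemma toNNReal_div_ne_zero (hb : 0 < b) (hn : n ≠ 0) : (b / n).toNNReal ≠ 0 := by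
  have hn0 : (0 : ℝ) < n := by exact_mod_cast Nat.pos_of_ne_zero hn
  exact (Real.toNNReal_pos.2 (by positivity)).ne'

lemma inv_sqrt_two_pi_mul_pos (hb : 0 < b) (hn : n ≠ 0) :
    0 < (Real.sqrt (2 * Real.pi * (b / n)))⁻¹ := by
  have hn0 : (0 : ℝ) < n := by exact_mod_cast Nat.pos_of_ne_zero hn
  have := Real.pi_pos
  positivity

lemma integrable_exp_potential (hb : 0 < b) (hn : n ≠ 0) :
    Integrable fun T => Real.exp (n * potential b h T) := by
  have h1 := integrable_gaussianPDFReal_mul (toNNReal_div_ne_zero hb hn)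
    (integrable_cosh_pow_gaussianReal h _ n)
  simp_rw [cosh_pow_mul_gaussianPDFReal hb hn] at h1
  have h2 := h1.const_mul (Real.sqrt (2 * Real.pi * (b / n)))
  have h3 := inv_sqrt_two_pi_mul_pos hb hn
  simpa [mul_inv_cancel_left₀ (inv_pos.1 h3).ne'] using h2

lemma integral_exp_potential_pos (hb : 0 < b) (hn : n ≠ 0) :
    0 < ∫ T, Real.exp (n * potential b h T) :=
  integral_exp_pos (integrable_exp_potential hb hn)

lemma integral_fieldMeasure_eq_div (hb : 0 < b) (hn : n ≠ 0) (g : ℝ → ℝ) :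
    ∫ T, g T ∂(fieldMeasure b h n) =
      (∫ T, Real.exp (n * potential b h T) * g T) / ∫ T, Real.exp (n * potential b h T) := by
  have hv := toNNReal_div_ne_zero hb hn
  rw [integral_fieldMeasure, integral_gaussianReal_eq_integral_smul hv,
    integral_gaussianReal_eq_integral_smul hv]
  simp_rw [smul_eq_mul, ← mul_assoc, cosh_pow_mul_gaussianPDFReal hb hn,
    mul_assoc (Real.sqrt (2 * Real.pi * (b / n)))⁻¹]
  rw [integral_const_mul, integral_const_mul,
    mul_div_mul_left _ _ (inv_sqrt_two_pi_mul_pos hb hn).ne']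

/-- Compact sets on which the potential is below its maximum have small probability. -/
lemma exists_integral_indicator_le (hb : 0 < b) {B : Set ℝ} (hB : IsCompact B)
    (hlt : ∀ T ∈ B, potential b h T < potential b h t) :
    ∃ C : ℝ, 0 ≤ C ∧ ∀ n : ℕ, n ≠ 0 →
      ∫ T, B.indicator (fun _ => (1 : ℝ)) T ∂(fieldMeasure b h n) ≤ C / n := by
  rcases B.eq_empty_or_nonempty with rfl | hne
  · exact ⟨0, le_rfl, fun n _ => by simp⟩
  have hcont := continuous_potential (h := h) hb
  obtain ⟨T₀, hT₀, hmax⟩ := hB.exists_isMaxOn hne hcont.continuousOn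
  set M := potential b h t with hM
  -- Half of the gap between the value at `t` and the maximum over `B`. The potential stays above `M
  -- - ε` on a neighbourhood of `t` and below `M - 2ε` on `B`, so the probability of `B` is `O(exp
  -- (-nε))`; only `O(1/n)` is kept.
  set ε := (M - potential b h T₀) / 2 with hε
  have hε0 : 0 < ε := by have := hlt T₀ hT₀; simp only [hε]; linarith
  obtain ⟨η, hη, hball⟩ := Metric.continuousAt_iff.1 (hcont.continuousAt (x := t)) ε hε0
  set V := volume.real B with hV
  have hV0 : 0 ≤ V := measureReal_nonneg
  refine ⟨V / (2 * η * ε), by positivity, fun n hn => ?_⟩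
  have hn0 : (0 : ℝ) < n := by exact_mod_cast Nat.pos_of_ne_zero hn
  have hint := integrable_exp_potential (h := h) hb hn
  have hZ := integral_exp_potential_pos (h := h) hb hn
  rw [integral_fieldMeasure_eq_div hb hn, div_le_iff₀ hZ]
  have hnum : ∫ T, Real.exp (n * potential b h T) * B.indicator (fun _ => (1 : ℝ)) T ≤
      V * Real.exp (n * (M - 2 * ε)) := by
    have h1 : ∀ T, Real.exp (n * potential b h T) * B.indicator (fun _ => (1 : ℝ)) T ≤
        B.indicator (fun _ => Real.exp (n * (M - 2 * ε))) T := by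
      intro T
      by_cases hT : T ∈ B
      · rw [Set.indicator_of_mem hT, Set.indicator_of_mem hT, mul_one, Real.exp_le_exp]
        have := hmax hT
        simp only [Set.mem_ofPred_eq] at this
        refine mul_le_mul_of_nonneg_left ?_ hn0.le
        linarith
      · simp [hT]
    have hfin := hB.measure_lt_top (μ := volume)
    calc _ ≤ ∫ T, B.indicator (fun _ => Real.exp (n * (M - 2 * ε))) T := by
          refine integral_mono_of_nonneg (ae_of_all _ fun T => mul_nonneg (Real.exp_pos _).le
            (Set.indicator_nonneg (fun _ _ => zero_le_one) T)) ?_ (ae_of_all _ h1)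
          rw [integrable_indicator_iff hB.measurableSet]
          exact integrableOn_const hfin.ne
      _ = _ := by
          rw [integral_indicator hB.measurableSet, setIntegral_const, smul_eq_mul]
  have hden : 2 * η * Real.exp (n * (M - ε)) ≤ ∫ T, Real.exp (n * potential b h T) := by
    calc 2 * η * Real.exp (n * (M - ε)) =
        ∫ _ in Set.Ioo (t - η) (t + η), Real.exp (n * (M - ε)) := by
          rw [setIntegral_const, smul_eq_mul, Measure.real, Real.volume_Ioo,
            ENNReal.toReal_ofReal (by linarith)]
          ring
      _ ≤ ∫ T in Set.Ioo (t - η) (t + η), Real.exp (n * potential b h T) := by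
          refine setIntegral_mono_on (integrableOn_const (by simp)) hint.integrableOn
            measurableSet_Ioo fun T hT => ?_
          have h1 := hball (x := T) (by rw [Real.dist_eq, abs_lt]; constructor <;> linarith [hT.1, hT.2])
          rw [Real.dist_eq, abs_lt] at h1
          exact Real.exp_le_exp.2 (mul_le_mul_of_nonneg_left (by linarith [h1.1]) hn0.le)
      _ ≤ _ := setIntegral_le_integral hint (ae_of_all _ fun T => (Real.exp_pos _).le)
  have hexp : Real.exp (n * (M - 2 * ε)) ≤ Real.exp (n * (M - ε)) / (n * ε) := by
    rw [le_div_iff₀ (by positivity), show n * (M - ε) = n * (M - 2 * ε) + n * ε by ring,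
      Real.exp_add]
    exact mul_le_mul_of_nonneg_left (by linarith [Real.add_one_le_exp (n * ε)]) (Real.exp_pos _).le
  calc _ ≤ V * Real.exp (n * (M - 2 * ε)) := hnum
    _ ≤ V * (Real.exp (n * (M - ε)) / (n * ε)) := mul_le_mul_of_nonneg_left hexp hV0
    _ = V / (2 * η * ε) / n * (2 * η * Real.exp (n * (M - ε))) := by field_simp
    _ ≤ _ := mul_le_mul_of_nonneg_left hden (by positivity)


/-- Because `tanh x / x` strictly decreases, `t` times the drift at `x` is less than `h (x - t) ≤
0`. Hence the potential increases on `[0, t]`. -/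
lemma drift_neg (hb : 0 < b) (hh : 0 ≤ h) (ht : 0 < t) (heq : b * Real.tanh t = t - h)
    {x : ℝ} (hx : 0 < x) (hxt : x < t) : x - h - b * Real.tanh x < 0 := by
  have hc := Real.cosh_pos x
  have h1 := mul_le_mul_of_nonneg_left (tanh_le_tangent hx.le ht.le) hx.le
  have h2 : x / Real.cosh x ^ 2 < Real.tanh x := by
    rw [Real.tanh_eq_sinh_div_cosh, div_lt_div_iff₀ (by positivity) hc]
    have h3 := Real.self_lt_sinh_iff.2 hx
    have h4 := Real.one_le_cosh x
    nlinarith [mul_pos hc (sub_pos.2 h3), mul_nonneg (sub_nonneg.2 h4) (mul_pos hc (hx.trans h3)).le]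
  have h3 : x * Real.tanh t < t * Real.tanh x := by
    have h4 : x * ((t - x) / Real.cosh x ^ 2) = (t - x) * (x / Real.cosh x ^ 2) := by ring
    have h5 := mul_lt_mul_of_pos_left h2 (sub_pos.2 hxt)
    nlinarith
  have h4 := mul_lt_mul_of_pos_left h3 hb
  have h5 : t * (x - h - b * Real.tanh x) < 0 := by nlinarith
  exact neg_of_mul_neg_right h5 ht.le

lemma potential_lt_of_lt (hb : 0 < b) (hh : 0 ≤ h) (ht : 0 < t) (heq : b * Real.tanh t = t - h)
    {x : ℝ} (hx : 0 ≤ x) (hxt : x < t) :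
    potential b h x < potential b h t := by
  refine strictMonoOn_of_deriv_pos (convex_Icc 0 t) (continuous_potential hb).continuousOn
    (fun y hy => ?_) ⟨hx, hxt.le⟩ ⟨ht.le, le_rfl⟩ hxt
  rw [interior_Icc] at hy
  rw [(hasDerivAt_potential hb y).deriv]
  exact div_pos (neg_pos.2 (drift_neg hb hh ht heq hy.1 hy.2)) hb

lemma potential_le_of_ge (hb : 0 < b) (ht : 0 < t) (heq : b * Real.tanh t = t - h)
    (hl : 0 < 1 - b / Real.cosh t ^ 2) {x : ℝ} (hxt : t ≤ x) : potential b h x ≤ potential b h t := by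
  refine antitoneOn_of_deriv_nonpos (convex_Ici t) (continuous_potential hb).continuousOn
    (fun y _ => (hasDerivAt_potential hb y).differentiableAt.differentiableWithinAt)
    (fun y hy => ?_) Set.self_mem_Ici hxt hxt
  rw [interior_Ici] at hy
  rw [(hasDerivAt_potential hb y).deriv]
  have h1 := drift_ge hb.le ht.le heq (ht.le.trans hy.le)
  have h2 := mul_pos hl (sub_pos.2 hy)
  exact (div_neg_of_neg_of_pos (by linarith) hb).le

lemma potential_neg (b h x : ℝ) : potential b h (-x) = potential b h x - 4 * (h * x) / (2 * b) := by
  rw [potential, potential, Real.cosh_neg]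
  ring

end Laplace

/-! ### The lower bound for `E cosh T` away from criticality. -/

section LowerBound

open MeasureTheory ProbabilityTheory

variable {b h t : ℝ} {n : ℕ}

/-- A converse to `mul_cosh_sub_le_sinh_mul_drift`: linearising both drift and `cosh` at `t` leaves
a quadratic remainder. For negative `T` the reflection term now has the unfavourable sign and must
be carried along. -/
lemma sinh_mul_drift_le (hb : 0 ≤ b) (hh : 0 ≤ h)
    (heq : b * Real.tanh t = t - h) (hl : 0 ≤ 1 - b / Real.cosh t ^ 2) (T : ℝ) :
    Real.sinh T * (T - h - b * Real.tanh T) ≤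
      (1 - b / Real.cosh t ^ 2) * (Real.cosh T - Real.cosh t) +
        (2 * (1 - b / Real.cosh t ^ 2) * Real.cosh t + 2 * b) * (Real.cosh T * (|T| - t) ^ 2) +
        2 * (h * max (-Real.sinh T) 0) := by
  set l := 1 - b / Real.cosh t ^ 2 with hldef
  have hct := Real.one_le_cosh t
  have key : ∀ x : ℝ, 0 ≤ x → Real.sinh x * (x - h - b * Real.tanh x) ≤
      l * (Real.cosh x - Real.cosh t) +
        (2 * l * Real.cosh t + 2 * b) * (Real.cosh x * (x - t) ^ 2) := by
    intro x hx
    have hcx := Real.one_le_cosh x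
    have hsx := Real.sinh_nonneg_iff.2 hx
    have h1 := mul_le_mul_of_nonneg_left (drift_le hb heq x) hsx
    have h2 := sinh_sub_mul_sub_le x t
    have h3 := cosh_tangent_le t x
    have h4 : Real.sinh x * (x - t) ^ 2 ≤ Real.cosh x * (x - t) ^ 2 :=
      mul_le_mul_of_nonneg_right (Real.sinh_lt_cosh x).le (sq_nonneg _)
    have h5 : (Real.cosh x + Real.cosh t) * (x - t) ^ 2 ≤
        2 * Real.cosh t * Real.cosh x * (x - t) ^ 2 := by
      refine mul_le_mul_of_nonneg_right ?_ (sq_nonneg _)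
      nlinarith [mul_nonneg (sub_nonneg.2 hcx) (sub_nonneg.2 hct)]
    have h6 : Real.sinh x * (x - t) ≤ Real.cosh x - Real.cosh t +
        2 * Real.cosh t * Real.cosh x * (x - t) ^ 2 := by linarith
    have h7 := mul_le_mul_of_nonneg_left h6 hl
    have h8 := mul_le_mul_of_nonneg_left h4 hb
    linarith
  rcases le_total 0 T with hT | hT
  · have h1 := key T hT
    have h2 := mul_nonneg hh (le_max_right (-Real.sinh T) 0)
    rw [abs_of_nonneg hT]
    linarith
  · have h1 := key (-T) (by linarith)
    have h2 := sinh_mul_drift_of_neg (b := b) (h := h) (T := -T)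
    rw [neg_neg] at h2
    have h3 : 0 ≤ -Real.sinh T := by
      rw [← Real.sinh_neg]; exact Real.sinh_nonneg_iff.2 (by linarith)
    rw [h2, abs_of_nonpos hT, max_eq_left h3]
    rw [Real.cosh_neg] at h1
    rw [Real.sinh_neg] at *
    linarith

/-- A Lyapunov-type bound away from the region where the potential is small. -/
lemma exists_lyapunov_half_line (hb : 0 ≤ b) (ht : 0 < t)
    (heq : b * Real.tanh t = t - h) (hl : 0 < 1 - b / Real.cosh t ^ 2) :
    ∃ c K δ : ℝ, 0 < c ∧ 0 ≤ K ∧ 0 < δ ∧ δ < t ∧ ∀ x : ℝ, 0 ≤ x →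
      c * (Real.cosh x * (x - t) ^ 2) ≤
        Real.sinh x * (Real.cosh x - Real.cosh t) * (x - h - b * Real.tanh x) +
          K * (Set.Iic δ).indicator (fun _ => (1 : ℝ)) x := by
  set l := 1 - b / Real.cosh t ^ 2 with hldef
  have hct := Real.cosh_pos t
  have hst := Real.sinh_pos_iff.2 ht
  -- Within distance `η` to the left of `t` the quadratic error of `drift_le` takes at most half of
  -- the slope `l`. The bound `t / 2` keeps `δ` positive.
  set η := min (t / 2) (l / (4 * (b + 1))) with hη
  have hη0 : 0 < η := lt_min (by linarith) (by positivity)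
  have hη1 : η ≤ t / 2 := min_le_left _ _
  have hη2 : 4 * b * η ≤ l := by
    have h1 : η ≤ l / (4 * (b + 1)) := min_le_right _ _
    rw [le_div_iff₀ (by positivity)] at h1
    linarith
  set δ := t - η with hδ
  have hδ0 : 0 < δ := by linarith
  have hsδ := Real.sinh_pos_iff.2 hδ0
  -- `c₁` is the constant obtained for `x ≥ t` and `c₂` the one on `(δ, t]`, where `cosh x - cosh t`
  -- and the drift are both nonpositive. On `[0, δ]` no sign is available, and `K` pays for
  -- everything.
  set c₁ := l * Real.sinh t * (Real.sinh t / Real.cosh t) with hc₁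
  set c₂ := l / 2 * Real.sinh δ ^ 2 / Real.cosh t with hc₂
  set c := min c₁ c₂ with hc
  have hc0 : 0 < c := lt_min (by positivity) (by positivity)
  set K := Real.sinh t * Real.cosh t * ((1 + |h| + b) * Real.cosh t) + c * (Real.cosh t * t ^ 2)
    with hK
  refine ⟨c, K, δ, hc0, by positivity, hδ0, by linarith, fun x hx => ?_⟩
  have hcx := Real.cosh_pos x
  have hsx := Real.sinh_nonneg_iff.2 hx
  rcases le_or_gt x δ with hxδ | hxδ
  · rw [Set.indicator_of_mem (show x ∈ Set.Iic δ from hxδ), mul_one]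
    have hxt : x ≤ t := by linarith
    have hcc : Real.cosh x ≤ Real.cosh t := by
      rwa [Real.cosh_le_cosh, abs_of_nonneg hx, abs_of_nonneg ht.le]
    have h1 : |Real.sinh x * (Real.cosh x - Real.cosh t) * (x - h - b * Real.tanh x)| ≤
        Real.sinh t * Real.cosh t * ((1 + |h| + b) * Real.cosh t) := by
      rw [abs_mul, abs_mul, abs_of_nonneg hsx]
      refine mul_le_mul (mul_le_mul (Real.sinh_le_sinh.2 hxt) ?_ (abs_nonneg _) hst.le)
        ((abs_stein_drift_le hb h x).trans (mul_le_mul_of_nonneg_left hcc (by positivity)))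
        (abs_nonneg _) (by positivity)
      rw [abs_le]
      constructor <;> linarith
    have h2 : c * (Real.cosh x * (x - t) ^ 2) ≤ c * (Real.cosh t * t ^ 2) := by
      refine mul_le_mul_of_nonneg_left (mul_le_mul hcc ?_ (sq_nonneg _) hct.le) hc0.le
      exact sq_le_sq' (by linarith) (by linarith)
    have h3 := (abs_le.1 h1).1
    linarith
  · rw [Set.indicator_of_notMem (show x ∉ Set.Iic δ from not_le.2 hxδ), mul_zero, add_zero]
    have hD : 0 ≤ Real.cosh x * (x - t) ^ 2 := by positivity
    rcases le_total t x with hxt | hxt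
    · have h1 := drift_ge hb ht.le heq hx
      have h2 := cosh_tangent_le t x
      have h3 : Real.sinh t / Real.cosh t * Real.cosh x ≤ Real.sinh x := by
        rw [div_mul_eq_mul_div, div_le_iff₀ hct]
        have h4 := Real.sinh_nonneg_iff.2 (sub_nonneg.2 hxt)
        rw [Real.sinh_sub] at h4
        linarith
      have hxt' := sub_nonneg.2 hxt
      calc c * (Real.cosh x * (x - t) ^ 2) ≤ c₁ * (Real.cosh x * (x - t) ^ 2) :=
            mul_le_mul_of_nonneg_right (min_le_left _ _) hD
        _ = (Real.sinh t / Real.cosh t * Real.cosh x) * (Real.sinh t * (x - t)) * (l * (x - t)) := by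
            rw [hc₁]; ring
        _ ≤ Real.sinh x * (Real.cosh x - Real.cosh t) * (x - h - b * Real.tanh x) := by
            refine mul_le_mul (mul_le_mul h3 (by linarith) (by positivity) hsx) h1 (by positivity) ?_
            exact mul_nonneg hsx (by nlinarith [mul_nonneg hst.le hxt'])
    · have h1 := drift_le hb heq x
      have hxt' := sub_nonneg.2 hxt
      have h2 : l / 2 * (t - x) ≤ -(x - h - b * Real.tanh x) := by
        have h3 : 2 * b * (t - x) * (t - x) ≤ l / 2 * (t - x) := by
          refine mul_le_mul_of_nonneg_right ?_ hxt'
          have : 2 * b * (t - x) ≤ 2 * b * η := mul_le_mul_of_nonneg_left (by linarith) (by positivity)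
          linarith
        nlinarith
      have h4 := cosh_tangent_le x t
      have h5 : Real.sinh δ ≤ Real.sinh x := Real.sinh_le_sinh.2 hxδ.le
      have hcc : Real.cosh x ≤ Real.cosh t := by
        rwa [Real.cosh_le_cosh, abs_of_nonneg hx, abs_of_nonneg ht.le]
      have h6 : Real.sinh δ * (t - x) ≤ Real.cosh t - Real.cosh x :=
        (mul_le_mul_of_nonneg_right h5 hxt').trans (by linarith)
      calc c * (Real.cosh x * (x - t) ^ 2) ≤ c₂ * (Real.cosh x * (x - t) ^ 2) :=
            mul_le_mul_of_nonneg_right (min_le_right _ _) hD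
        _ ≤ c₂ * (Real.cosh t * (x - t) ^ 2) := by gcongr
        _ = Real.sinh δ * (Real.sinh δ * (t - x)) * (l / 2 * (t - x)) := by
            rw [hc₂]; field_simp; ring
        _ ≤ Real.sinh x * (Real.cosh t - Real.cosh x) * (-(x - h - b * Real.tanh x)) := by
            refine mul_le_mul (mul_le_mul h5 h6 (by positivity) hsx) h2 (by positivity) ?_
            exact mul_nonneg hsx (by linarith)
        _ = _ := by ring

/-- The half-line bound is applied at `|T|`. For negative `T` reflection adds `2h (-sinh T)(cosh T -
cosh t)`, which dominates `h (-sinh T)` below `-(t + 1)`, since there `cosh T - cosh t ≥ sinh t`; on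
`[-(t + 1), 0]` it is bounded and charged to the second indicator. -/
lemma exists_lyapunov (hb : 0 ≤ b) (hh : 0 ≤ h) (ht : 0 < t)
    (heq : b * Real.tanh t = t - h) (hl : 0 < 1 - b / Real.cosh t ^ 2) :
    ∃ c K δ : ℝ, 0 < c ∧ 0 ≤ K ∧ 0 < δ ∧ δ < t ∧ ∀ T : ℝ,
      c * (Real.cosh T * (|T| - t) ^ 2 + h * max (-Real.sinh T) 0) ≤
        Real.sinh T * (Real.cosh T - Real.cosh t) * (T - h - b * Real.tanh T) +
          K * (Set.Icc (-δ) δ).indicator (fun _ => (1 : ℝ)) T +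
          K * (h * (Set.Icc (-(t + 1)) 0).indicator (fun _ => (1 : ℝ)) T) := by
  obtain ⟨c, K, δ, hc, hK, hδ, hδt, hx⟩ := exists_lyapunov_half_line hb ht heq hl
  have hst := Real.sinh_pos_iff.2 ht
  have hct := Real.cosh_pos t
  have hs1 := Real.sinh_pos_iff.2 (show 0 < t + 1 by linarith)
  set c' := min c (2 * Real.sinh t) with hc'
  have hc'0 : 0 < c' := lt_min hc (by positivity)
  set K' := K + 2 * (Real.sinh (t + 1) * Real.cosh t) + c' * Real.sinh (t + 1) with hK'
  have hKK' : K ≤ K' := by rw [hK']; have : 0 < c' * Real.sinh (t + 1) := by positivity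
                           have : 0 < Real.sinh (t + 1) * Real.cosh t := by positivity
                           linarith
  refine ⟨c', K', δ, hc'0, by positivity, hδ, hδt, fun T => ?_⟩
  have hind : (Set.Iic δ).indicator (fun _ => (1 : ℝ)) |T| =
      (Set.Icc (-δ) δ).indicator (fun _ => (1 : ℝ)) T := by
    by_cases hT : |T| ≤ δ
    · rw [Set.indicator_of_mem (show |T| ∈ Set.Iic δ from hT),
        Set.indicator_of_mem (show T ∈ Set.Icc (-δ) δ from abs_le.1 hT)]
    · rw [Set.indicator_of_notMem (show |T| ∉ Set.Iic δ from hT),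
        Set.indicator_of_notMem (show T ∉ Set.Icc (-δ) δ from fun h => hT (abs_le.2 h))]
  have h0 : 0 ≤ (Set.Icc (-δ) δ).indicator (fun _ => (1 : ℝ)) T :=
    Set.indicator_nonneg (fun _ _ => zero_le_one) T
  have h0' : 0 ≤ (Set.Icc (-(t + 1)) 0).indicator (fun _ => (1 : ℝ)) T :=
    Set.indicator_nonneg (fun _ _ => zero_le_one) T
  have hbase := hx |T| (abs_nonneg T)
  rw [hind, Real.cosh_abs] at hbase
  have h1 : c' * (Real.cosh T * (|T| - t) ^ 2) ≤ c * (Real.cosh T * (|T| - t) ^ 2) :=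
    mul_le_mul_of_nonneg_right (min_le_left _ _)
      (mul_nonneg (Real.cosh_pos T).le (sq_nonneg _))
  have h2 := mul_le_mul_of_nonneg_right hKK' h0
  rcases le_total 0 T with hT | hT
  · have h3 : max (-Real.sinh T) 0 = 0 :=
      max_eq_right (neg_nonpos.2 (Real.sinh_nonneg_iff.2 hT))
    have h4 : 0 ≤ K' * (h * (Set.Icc (-(t + 1)) 0).indicator (fun _ => (1 : ℝ)) T) := by
      have := hK.trans hKK'
      positivity
    rw [abs_of_nonneg hT] at *
    rw [h3]
    linarith
  · have hs : 0 ≤ -Real.sinh T := by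
      rw [← Real.sinh_neg]; exact Real.sinh_nonneg_iff.2 (by linarith)
    rw [max_eq_left hs]
    have h5 : c' * (h * -Real.sinh T) ≤
        2 * h * (-Real.sinh T * (Real.cosh T - Real.cosh t)) +
          (2 * (Real.sinh (t + 1) * Real.cosh t) + c' * Real.sinh (t + 1)) *
            (h * (Set.Icc (-(t + 1)) 0).indicator (fun _ => (1 : ℝ)) T) := by
      by_cases hTt : -(t + 1) ≤ T
      · rw [Set.indicator_of_mem (show T ∈ Set.Icc (-(t + 1)) 0 from ⟨hTt, hT⟩), mul_one]
        have h6 : -Real.sinh T ≤ Real.sinh (t + 1) := by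
          rw [← Real.sinh_neg]; exact Real.sinh_le_sinh.2 (by linarith)
        have h7 : -(Real.sinh (t + 1) * Real.cosh t) ≤
            -Real.sinh T * (Real.cosh T - Real.cosh t) := by
          have := Real.cosh_pos T
          nlinarith [mul_le_mul_of_nonneg_right h6 hct.le]
        have h8 := mul_le_mul_of_nonneg_left h7 hh
        have h9 := mul_le_mul_of_nonneg_left h6 (mul_nonneg hc'0.le hh)
        nlinarith
      · rw [Set.indicator_of_notMem (show T ∉ Set.Icc (-(t + 1)) 0 from fun h => hTt h.1)]
        rw [mul_zero, mul_zero, add_zero]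
        have h6 : Real.sinh t ≤ Real.cosh T - Real.cosh t := by
          have h7 := cosh_tangent_le t (-T)
          rw [Real.cosh_neg] at h7
          push Not at hTt
          nlinarith
        have h8 : c' * -Real.sinh T ≤ 2 * (-Real.sinh T * (Real.cosh T - Real.cosh t)) := by
          have h9 := mul_le_mul_of_nonneg_right (min_le_right c (2 * Real.sinh t)) hs
          have h10 := mul_le_mul_of_nonneg_left h6 hs
          linarith
        have := mul_le_mul_of_nonneg_left h8 hh
        linarith
    have h6 := sinh_mul_drift_of_neg (b := b) (h := h) (T := -T)
    rw [neg_neg, Real.sinh_neg] at h6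
    have h7 : Real.sinh T * (Real.cosh T - Real.cosh t) * (T - h - b * Real.tanh T) =
        -Real.sinh T * (Real.cosh T - Real.cosh t) * (-T - h - b * Real.tanh (-T)) +
          2 * h * (-Real.sinh T * (Real.cosh T - Real.cosh t)) := by
      linear_combination (Real.cosh T - Real.cosh t) * h6
    rw [abs_of_nonpos hT, Real.sinh_neg] at hbase
    rw [abs_of_nonpos hT] at h1 ⊢
    rw [h7]
    have h8 : K' * (h * (Set.Icc (-(t + 1)) 0).indicator (fun _ => (1 : ℝ)) T) =
        K * (h * (Set.Icc (-(t + 1)) 0).indicator (fun _ => (1 : ℝ)) T) +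
        (2 * (Real.sinh (t + 1) * Real.cosh t) + c' * Real.sinh (t + 1)) *
            (h * (Set.Icc (-(t + 1)) 0).indicator (fun _ => (1 : ℝ)) T) := by rw [hK']; ring
    have h9 : 0 ≤ K * (h * (Set.Icc (-(t + 1)) 0).indicator (fun _ => (1 : ℝ)) T) := by
      positivity
    rw [h8]
    linarith

lemma integral_fieldMeasure_zero (g : ℝ → ℝ) : ∫ T, g T ∂(fieldMeasure 0 h n) = g h := by
  have hc := Real.cosh_pos h
  rw [integral_fieldMeasure, zero_div, Real.toNNReal_zero, gaussianReal_zero_var, integral_dirac,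
    integral_dirac]
  field_simp

lemma integrable_indicator_one {s : Set ℝ} (hs : MeasurableSet s) :
    Integrable (s.indicator (fun _ => (1 : ℝ))) (fieldMeasure b h n) :=
  (integrable_const 1).indicator hs

/-- The lower bound `E cosh T ≥ cosh t - O(1/n)`. -/
lemma exists_le_integral_cosh (hb : 0 ≤ b) (hh : 0 ≤ h) (ht : 0 < t)
    (heq : b * Real.tanh t = t - h) (hl : 0 < 1 - b / Real.cosh t ^ 2) :
    ∃ C : ℝ, 0 ≤ C ∧ ∀ᶠ n : ℕ in atTop,
      Real.cosh t - C / n ≤ ∫ T, Real.cosh T ∂(fieldMeasure b h n) := by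
  -- For `b = 0` the field is the constant `h`; the potential, which divides by `b`, is of use only
  -- for `b > 0`.
  rcases hb.eq_or_lt with rfl | hb0
  · have : t = h := by linarith
    subst this
    exact ⟨0, le_rfl, Eventually.of_forall fun n => by simp [integral_fieldMeasure_zero]⟩
  obtain ⟨C₃, hC₃0, hC₃⟩ := exists_integral_cosh_cube_le hb h
  obtain ⟨c, K, δ, hc, hK, hδ, hδt, hly⟩ := exists_lyapunov hb hh ht heq hl
  have hΦ : ∀ x : ℝ, 0 ≤ x → potential b h x ≤ potential b h t := fun x hx => by
    rcases lt_or_ge x t with hxt | hxt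
    · exact (potential_lt_of_lt hb0 hh ht heq hx hxt).le
    · exact potential_le_of_ge hb0 ht heq hl hxt
  obtain ⟨C₁, hC₁0, hC₁⟩ := exists_integral_indicator_le (h := h) (t := t) hb0
    (isCompact_Icc (a := -δ) (b := δ)) fun T hT => by
      rcases le_total 0 T with h0 | h0
      · exact potential_lt_of_lt hb0 hh ht heq h0 (by linarith [hT.2])
      · have h1 := potential_lt_of_lt hb0 hh ht heq (x := -T) (by linarith) (by linarith [hT.1])
        have h2 := potential_neg b h (-T)
        rw [neg_neg] at h2
        have h3 : 0 ≤ 4 * (h * -T) / (2 * b) := by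
          have := mul_nonneg hh (neg_nonneg.2 h0)
          positivity
        linarith
  -- The factor `h` matters: for `h = 0` the points `t` and `-t` are equally likely and the interval
  -- is not rare, but the term vanishes. For `h > 0` the potential on it is strictly below its value
  -- at `t`.
  obtain ⟨C₂, hC₂0, hC₂⟩ : ∃ C : ℝ, 0 ≤ C ∧ ∀ n : ℕ, n ≠ 0 →
      h * ∫ T, (Set.Icc (-(t + 1)) 0).indicator (fun _ => (1 : ℝ)) T ∂(fieldMeasure b h n) ≤
        C / n := by
    rcases hh.eq_or_lt with h0 | h0
    · exact ⟨0, le_rfl, fun n _ => by rw [← h0]; simp⟩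
    obtain ⟨C, hC0, hC⟩ := exists_integral_indicator_le (h := h) (t := t) hb0
      (isCompact_Icc (a := -(t + 1)) (b := 0)) fun T hT => by
        rcases hT.2.eq_or_lt with h1 | h1
        · rw [h1]; exact potential_lt_of_lt hb0 hh ht heq le_rfl ht
        · have h2 := potential_neg b h (-T)
          rw [neg_neg] at h2
          have h3 : 0 < 4 * (h * -T) / (2 * b) := by
            have := mul_pos h0 (neg_pos.2 h1)
            positivity
          linarith [hΦ (-T) (by linarith)]
    exact ⟨h * C, by positivity, fun n hn => by
      rw [mul_div_assoc]; exact mul_le_mul_of_nonneg_left (hC n hn) hh⟩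
  set l := 1 - b / Real.cosh t ^ 2 with hldef
  set C' := (b * ((2 + Real.cosh t) * C₃) + K * C₁ + K * C₂) / c with hC'
  set C₄ := 2 * l * Real.cosh t + 2 * b with hC₄
  have hct := Real.cosh_pos t
  have hC₄0 : 0 ≤ C₄ := by positivity
  have hC'0 : 0 ≤ C' := by positivity
  refine ⟨(C₄ + 2) * C' / l, by positivity, ?_⟩
  filter_upwards [hC₃, eventually_ge_atTop 1] with n hn hn1
  have hn0 : (0 : ℝ) < n := by exact_mod_cast hn1
  have hne : n ≠ 0 := by omega
  set ν := fieldMeasure b h n with hν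
  have hψ : ∀ T, |Real.sinh T * (Real.cosh T - Real.cosh t)| ≤
      (2 + Real.cosh t) * Real.cosh T ^ 2 := by
    intro T
    have h1 := Real.one_le_cosh T
    rw [abs_mul]
    have h2 : |Real.cosh T - Real.cosh t| ≤ (2 + Real.cosh t) * Real.cosh T := by
      rw [abs_le]; constructor <;> nlinarith
    calc _ ≤ Real.cosh T * ((2 + Real.cosh t) * Real.cosh T) :=
          mul_le_mul (abs_sinh_le_cosh T) h2 (abs_nonneg _) (Real.cosh_pos T).le
      _ = _ := by ring
  have hψ' : ∀ T, |Real.cosh T * (Real.cosh T - Real.cosh t) + Real.sinh T * Real.sinh T| ≤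
      (2 + Real.cosh t) * Real.cosh T ^ 2 := by
    intro T
    have h1 := Real.one_le_cosh T
    have h2 := Real.cosh_sq T
    rw [abs_le]
    constructor <;> nlinarith [sq_nonneg (Real.sinh T), mul_nonneg hct.le (sub_nonneg.2 h1)]
  have hstein := integral_stein (b := b) (h := h) (n := n) hb hne
    (ψ := fun T => Real.sinh T * (Real.cosh T - Real.cosh t))
    (ψ' := fun T => Real.cosh T * (Real.cosh T - Real.cosh t) + Real.sinh T * Real.sinh T)
    (fun T => (Real.hasDerivAt_sinh T).mul ((Real.hasDerivAt_cosh T).sub_const _))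
    (by fun_prop) hψ hψ'
  have hψint := integrable_mul_drift (b := b) hb (h := h) (n := n)
    (ψ := fun T => Real.sinh T * (Real.cosh T - Real.cosh t)) (by fun_prop) hψ
  have hYint : Integrable (fun T => Real.cosh T * (|T| - t) ^ 2 + h * max (-Real.sinh T) 0) ν := by
    refine integrable_fieldMeasure (C := (1 + t) ^ 2 + h) (k := 3) (by fun_prop) fun T => ?_
    have hcT := Real.one_le_cosh T
    have h1 : |(|T| - t)| ≤ (1 + t) * Real.cosh T := by
      have := abs_le_cosh T
      have := abs_nonneg T
      rw [abs_le]; constructor <;> nlinarith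
    have h2 : max (-Real.sinh T) 0 ≤ Real.cosh T :=
      max_le ((neg_le_abs _).trans (abs_sinh_le_cosh T)) (by linarith)
    have h3 : (|T| - t) ^ 2 ≤ ((1 + t) * Real.cosh T) ^ 2 := by
      rw [← sq_abs]; exact pow_le_pow_left₀ (abs_nonneg _) h1 2
    have h4 := le_max_right (-Real.sinh T) 0
    rw [abs_of_nonneg (by positivity)]
    have h5 : Real.cosh T ≤ Real.cosh T ^ 3 := le_self_pow₀ hcT (by norm_num)
    calc _ ≤ Real.cosh T * ((1 + t) * Real.cosh T) ^ 2 + h * Real.cosh T ^ 3 := by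
          gcongr
          exact h2.trans h5
      _ = _ := by ring
  -- The remainder of `sinh_mul_drift_le` has mean `O(1/n)`: Stein's identity gives this for the
  -- Lyapunov term, and the Laplace estimate for the two indicators.
  have hY : c * ∫ T, (Real.cosh T * (|T| - t) ^ 2 + h * max (-Real.sinh T) 0) ∂ν ≤
      c * (C' / n) := by
    have hi1 := (integrable_indicator_one (b := b) (h := h) (n := n)
      (measurableSet_Icc (a := -δ) (b := δ))).const_mul K
    have hi2 := ((integrable_indicator_one (b := b) (h := h) (n := n)
      (measurableSet_Icc (a := -(t + 1)) (b := 0))).const_mul h).const_mul K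
    have hi12 : Integrable (fun T => Real.sinh T * (Real.cosh T - Real.cosh t) *
        (T - h - b * Real.tanh T) + K * (Set.Icc (-δ) δ).indicator (fun _ => (1 : ℝ)) T) ν :=
      hψint.add hi1
    have h1 := integral_mono (hYint.const_mul c) (hi12.add hi2) hly
    simp only [Pi.add_apply] at h1
    rw [integral_const_mul, integral_add hi12 hi2] at h1
    rw [integral_add hψint hi1, hstein, integral_const_mul, integral_const_mul,
      integral_const_mul] at h1
    have h2 : ∫ T, (Real.cosh T * (Real.cosh T - Real.cosh t) + Real.sinh T * Real.sinh T) ∂ν ≤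
        (2 + Real.cosh t) * C₃ := by
      calc _ ≤ ∫ T, (2 + Real.cosh t) * Real.cosh T ^ 3 ∂ν := by
            refine integral_mono (integrable_fieldMeasure (by fun_prop) hψ')
              ((integrable_cosh_pow_fieldMeasure 3).const_mul _) fun T => ?_
            refine (le_abs_self _).trans ((hψ' T).trans ?_)
            exact mul_le_mul_of_nonneg_left
              (pow_le_pow_right₀ (Real.one_le_cosh T) (by norm_num)) (by positivity)
        _ ≤ _ := by
            rw [integral_const_mul]
            exact mul_le_mul_of_nonneg_left hn (by positivity)
    have h3 := mul_le_mul_of_nonneg_left h2 (show 0 ≤ b / n by positivity)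
    have h4 := mul_le_mul_of_nonneg_left (hC₁ n hne) hK
    have h5 := mul_le_mul_of_nonneg_left (hC₂ n hne) hK
    have h6 : c * (C' / n) = b / n * ((2 + Real.cosh t) * C₃) + K * (C₁ / n) + K * (C₂ / n) := by
      rw [hC']; field_simp
    linarith
  have hY' := le_of_mul_le_mul_left hY hc
  -- The left side equals `(b/n) E cosh T ≥ 0`, so `l (cosh t - E cosh T)` is at most a multiple of
  -- the remainder.
  have h1 : ∫ T, Real.sinh T * (T - h - b * Real.tanh T) ∂ν ≤
      ∫ T, (l * (Real.cosh T - Real.cosh t) +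
        (C₄ + 2) * (Real.cosh T * (|T| - t) ^ 2 + h * max (-Real.sinh T) 0)) ∂ν := by
    refine integral_mono (integrable_mul_drift hb (by fun_prop) abs_sinh_le_one_mul_cosh_pow)
      (((integrable_cosh_fieldMeasure.sub (integrable_const _)).const_mul l).add
        (hYint.const_mul _)) fun T => ?_
    have h2 := sinh_mul_drift_le hb hh heq hl.le T
    have h3 : 0 ≤ Real.cosh T * (|T| - t) ^ 2 :=
      mul_nonneg (Real.cosh_pos T).le (sq_nonneg _)
    have h4 := mul_nonneg hC₄0 (mul_nonneg hh (le_max_right (-Real.sinh T) 0))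
    simp only
    linarith
  have hcosh : Integrable (fun T => l * (Real.cosh T - Real.cosh t)) ν :=
    (integrable_cosh_fieldMeasure.sub (integrable_const _)).const_mul l
  rw [integral_sinh_mul_drift hb hne, integral_add hcosh (hYint.const_mul _), integral_const_mul,
    integral_const_mul, integral_sub integrable_cosh_fieldMeasure (integrable_const _),
    integral_const] at h1
  have h2 : 0 ≤ b / n * ∫ T, Real.cosh T ∂ν :=
    mul_nonneg (by positivity) (integral_nonneg fun T => (Real.cosh_pos T).le)
  have h3 := mul_le_mul_of_nonneg_left hY' (show 0 ≤ C₄ + 2 by positivity)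
  simp at h1
  have h4 : l * (Real.cosh t - ∫ T, Real.cosh T ∂ν) ≤ (C₄ + 2) * (C' / n) := by linarith
  have h5 : Real.cosh t - ∫ T, Real.cosh T ∂ν ≤ (C₄ + 2) * (C' / n) / l := by
    rw [le_div_iff₀ hl]; linarith
  have h6 : (C₄ + 2) * (C' / n) / l = (C₄ + 2) * C' / l / n := by ring
  linarith

end LowerBound

/-! ### The critical case: quartic potential and scale `n^{-1/4}`. -/

section Critical

open MeasureTheory Topology

lemma tanh_sq_ge (y : ℝ) : y ^ 2 / (1 + y ^ 2) ≤ Real.tanh y ^ 2 := by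
  have h1 : y ^ 2 ≤ Real.sinh y ^ 2 := by
    rw [sq_le_sq, Real.abs_sinh]
    exact Real.self_le_sinh_iff.2 (abs_nonneg y)
  rw [Real.tanh_eq_sinh_div_cosh, div_pow, Real.cosh_sq, div_le_div_iff₀ (by positivity)
    (by positivity)]
  nlinarith

lemma tanh_le_self {y : ℝ} (hy : 0 ≤ y) : Real.tanh y ≤ y := by
  simpa using tanh_le_tangent (x := 0) le_rfl hy

lemma self_sub_cube_le_tanh {y : ℝ} (hy : 0 ≤ y) : y - y ^ 3 / 3 ≤ Real.tanh y := by
  have hd : ∀ x : ℝ, HasDerivAt (fun x => Real.tanh x - (x - x ^ 3 / 3))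
      (1 / Real.cosh x ^ 2 - (1 - x ^ 2)) x := fun x => by
    convert! (hasDerivAt_tanh x).sub ((hasDerivAt_id x).sub ((hasDerivAt_pow 3 x).div_const 3))
      using 1
    simp
  have hmono : MonotoneOn (fun x => Real.tanh x - (x - x ^ 3 / 3)) (Set.Ici 0) := by
    refine monotoneOn_of_deriv_nonneg (convex_Ici 0)
      (continuous_iff_continuousAt.2 fun x => (hd x).continuousAt).continuousOn
      (fun x _ => (hd x).differentiableAt.differentiableWithinAt) fun x hx => ?_
    rw [interior_Ici] at hx
    rw [(hd x).deriv, one_div_cosh_sq]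
    have h1 := pow_le_pow_left₀ (tanh_nonneg hx.le) (tanh_le_self hx.le) 2
    linarith
  have := hmono Set.self_mem_Ici hy hy
  simp at this
  linarith

/-- Integrate `tanh' = 1 - tanh²` against `tanh² ≥ x² / (1 + x²)`, which dominates the derivative of
the subtracted quotient. The denominator keeps the cubic correction valid for all `y ≥ 0`. -/
lemma tanh_le_self_sub {y : ℝ} (hy : 0 ≤ y) : Real.tanh y ≤ y - y ^ 3 / (3 * (1 + y ^ 2)) := by
  have hd : ∀ x : ℝ, HasDerivAt (fun x => x - x ^ 3 / (3 * (1 + x ^ 2)) - Real.tanh x)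
      (1 - (3 * x ^ 2 * (3 * (1 + x ^ 2)) - x ^ 3 * (3 * (2 * x))) / (3 * (1 + x ^ 2)) ^ 2 -
        1 / Real.cosh x ^ 2) x := fun x => by
    have h1 : HasDerivAt (fun x : ℝ => 3 * (1 + x ^ 2)) (3 * (2 * x)) x := by
      simpa using ((hasDerivAt_pow 2 x).const_add 1).const_mul 3
    convert! ((hasDerivAt_id x).sub ((hasDerivAt_pow 3 x).div h1 (by positivity))).sub
      (hasDerivAt_tanh x) using 1
  have hmono : MonotoneOn (fun x => x - x ^ 3 / (3 * (1 + x ^ 2)) - Real.tanh x) (Set.Ici 0) := by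
    refine monotoneOn_of_deriv_nonneg (convex_Ici 0)
      (continuous_iff_continuousAt.2 fun x => (hd x).continuousAt).continuousOn
      (fun x _ => (hd x).differentiableAt.differentiableWithinAt) fun x hx => ?_
    rw [(hd x).deriv, one_div_cosh_sq]
    have h1 := tanh_sq_ge x
    have h2 : (3 * x ^ 2 * (3 * (1 + x ^ 2)) - x ^ 3 * (3 * (2 * x))) / (3 * (1 + x ^ 2)) ^ 2 ≤
        x ^ 2 / (1 + x ^ 2) := by
      rw [div_le_div_iff₀ (by positivity) (by positivity)]
      have : 0 ≤ x ^ 4 * (1 + x ^ 2) := by positivity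
      nlinarith
    linarith
  have := hmono Set.self_mem_Ici hy hy
  simp at this
  linarith

/-- The potential is even with derivative `tanh y - y`, so both bounds come from integrating the
cubic estimates for `tanh`. They agree to leading order at 0. -/
lemma potential_critical_bounds (y : ℝ) :
    -(y ^ 4 / 12) ≤ potential 1 0 y ∧ potential 1 0 y ≤ -(y ^ 4 / (12 * (1 + y ^ 2))) := by
  wlog hy : 0 ≤ y generalizing y
  · have h1 := this (-y) (by linarith)
    rw [potential_neg, show (-y) ^ 4 = y ^ 4 by ring] at h1
    simpa using h1
  have hd : ∀ x : ℝ, HasDerivAt (potential 1 0) (-(x - Real.tanh x)) x := fun x => by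
    simpa using hasDerivAt_potential (b := 1) (h := 0) one_pos x
  have h0 : potential 1 0 0 = 0 := by simp [potential]
  constructor
  · have hd' : ∀ x : ℝ, HasDerivAt (fun x => potential 1 0 x + x ^ 4 / 12)
        (-(x - Real.tanh x) + x ^ 3 / 3) x := fun x => by
      convert! (hd x).add ((hasDerivAt_pow 4 x).div_const 12) using 1
      push_cast
      ring
    have hmono : MonotoneOn (fun x => potential 1 0 x + x ^ 4 / 12) (Set.Ici 0) := by
      refine monotoneOn_of_deriv_nonneg (convex_Ici 0)
        (continuous_iff_continuousAt.2 fun x => (hd' x).continuousAt).continuousOn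
        (fun x _ => (hd' x).differentiableAt.differentiableWithinAt) fun x hx => ?_
      rw [interior_Ici] at hx
      rw [(hd' x).deriv]
      linarith [self_sub_cube_le_tanh hx.le]
    have := hmono Set.self_mem_Ici hy hy
    simp [h0] at this
    linarith
  · have hd' : ∀ x : ℝ, HasDerivAt (fun x => potential 1 0 x + x ^ 4 / (12 * (1 + x ^ 2)))
        (-(x - Real.tanh x) + (4 * x ^ 3 * (12 * (1 + x ^ 2)) - x ^ 4 * (12 * (2 * x))) /
          (12 * (1 + x ^ 2)) ^ 2) x := fun x => by
      have h1 : HasDerivAt (fun x : ℝ => 12 * (1 + x ^ 2)) (12 * (2 * x)) x := by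
        simpa using ((hasDerivAt_pow 2 x).const_add 1).const_mul 12
      convert! (hd x).add ((hasDerivAt_pow 4 x).div h1 (by positivity)) using 1
    have hanti : AntitoneOn (fun x => potential 1 0 x + x ^ 4 / (12 * (1 + x ^ 2)))
        (Set.Ici 0) := by
      refine antitoneOn_of_deriv_nonpos (convex_Ici 0)
        (continuous_iff_continuousAt.2 fun x => (hd' x).continuousAt).continuousOn
        (fun x _ => (hd' x).differentiableAt.differentiableWithinAt) fun x hx => ?_
      rw [interior_Ici] at hx
      have hx0 : 0 ≤ x := hx.le
      rw [(hd' x).deriv]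
      have h2 : (4 * x ^ 3 * (12 * (1 + x ^ 2)) - x ^ 4 * (12 * (2 * x))) /
          (12 * (1 + x ^ 2)) ^ 2 ≤ x ^ 3 / (3 * (1 + x ^ 2)) := by
        rw [div_le_div_iff₀ (by positivity) (by positivity)]
        have : 0 ≤ x ^ 5 * (1 + x ^ 2) := by positivity
        nlinarith
      linarith [tanh_le_self_sub hx0]
    have := hanti Set.self_mem_Ici hy hy
    simp [h0] at this
    linarith

lemma cosh_sub_one_bounds (y : ℝ) :
    y ^ 2 / 2 ≤ Real.cosh y - 1 ∧ Real.cosh y - 1 ≤ y ^ 2 / 2 * Real.exp (y ^ 2 / 2) := by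
  constructor
  · have h1 : Real.cosh y = 1 + 2 * Real.sinh (y / 2) ^ 2 := by
      have := Real.cosh_two_mul (y / 2)
      rw [mul_div_cancel₀ y (two_ne_zero' ℝ), Real.cosh_sq] at this
      linarith
    have h2 : (y / 2) ^ 2 ≤ Real.sinh (y / 2) ^ 2 := by
      rw [sq_le_sq, Real.abs_sinh]
      exact Real.self_le_sinh_iff.2 (abs_nonneg _)
    rw [h1]
    linarith
  · have h1 := Real.cosh_le_exp_half_sq y
    have h2 := Real.add_one_le_exp (-(y ^ 2 / 2))
    have h3 := mul_le_mul_of_nonneg_left h2 (Real.exp_pos (y ^ 2 / 2)).le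
    rw [← Real.exp_add, add_neg_cancel, Real.exp_zero] at h3
    linarith

/-- The natural scale `n^{-1/4}` of the critical field. -/
noncomputable def criticalScale (n : ℕ) : ℝ := (Real.sqrt (Real.sqrt n))⁻¹

lemma criticalScale_sq (n : ℕ) : criticalScale n ^ 2 = (Real.sqrt n)⁻¹ := by
  rw [criticalScale, inv_pow, Real.sq_sqrt (Real.sqrt_nonneg _)]

lemma criticalScale_pow_four (n : ℕ) : criticalScale n ^ 4 = (n : ℝ)⁻¹ := by
  rw [show 4 = 2 * 2 by rfl, pow_mul, criticalScale_sq, inv_pow, Real.sq_sqrt (Nat.cast_nonneg _)]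

lemma tendsto_inv_sqrt_nat : Tendsto (fun n : ℕ => (Real.sqrt n)⁻¹) atTop (𝓝 0) :=
  tendsto_inv_atTop_zero.comp (Real.tendsto_sqrt_atTop.comp tendsto_natCast_atTop_atTop)

lemma integral_fieldMeasure_critical {n : ℕ} (hn : n ≠ 0) (g : ℝ → ℝ) :
    ∫ T, g T ∂(fieldMeasure 1 0 n) =
      (∫ x, Real.exp (n * potential 1 0 (criticalScale n * x)) * g (criticalScale n * x)) /
        ∫ x, Real.exp (n * potential 1 0 (criticalScale n * x)) := by
  have hn0 : (0 : ℝ) < n := by exact_mod_cast Nat.pos_of_ne_zero hn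
  have hq : 0 < criticalScale n := by unfold criticalScale; positivity
  rw [integral_fieldMeasure_eq_div one_pos hn,
    Measure.integral_comp_mul_left (fun T => Real.exp (n * potential 1 0 T) * g T),
    Measure.integral_comp_mul_left (fun T => Real.exp (n * potential 1 0 T)), smul_eq_mul,
    smul_eq_mul, mul_div_mul_left]
  exact (abs_pos.2 (inv_ne_zero hq.ne')).ne'

lemma mul_potential_critical_bounds {n : ℕ} (hn : n ≠ 0) (x : ℝ) :
    -(x ^ 4 / 12) ≤ n * potential 1 0 (criticalScale n * x) ∧
      n * potential 1 0 (criticalScale n * x) ≤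
        -(x ^ 4 / (12 * (1 + (Real.sqrt n)⁻¹ * x ^ 2))) := by
  have hn0 : (0 : ℝ) < n := by exact_mod_cast Nat.pos_of_ne_zero hn
  obtain ⟨h1, h2⟩ := potential_critical_bounds (criticalScale n * x)
  rw [mul_pow, mul_pow, criticalScale_pow_four, criticalScale_sq] at h2
  rw [mul_pow, criticalScale_pow_four] at h1
  have h3 := mul_le_mul_of_nonneg_left h1 hn0.le
  have h4 := mul_le_mul_of_nonneg_left h2 hn0.le
  refine ⟨le_trans (le_of_eq ?_) h3, h4.trans (le_of_eq ?_)⟩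
  · field_simp
  · rw [mul_neg, ← mul_div_assoc, mul_inv_cancel_left₀ hn0.ne']

lemma inv_sqrt_nat_le {n : ℕ} (hn : 16 ^ 2 ≤ n) : (Real.sqrt n)⁻¹ ≤ 1 / 16 := by
  rw [one_div, inv_le_inv₀ (Real.sqrt_pos.2 (by exact_mod_cast (by omega : 0 < n))) (by norm_num)]
  refine Real.le_sqrt_of_sq_le ?_
  exact_mod_cast hn

/-- A Gaussian majorant independent of `n`, for dominated convergence: the quartic bound is at least
`(x² - 1)/12`, as `x⁴ - 1 ≤ x⁴`. -/
lemma exp_mul_potential_critical_le {n : ℕ} (hn : 16 ^ 2 ≤ n) (x : ℝ) :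
    Real.exp (n * potential 1 0 (criticalScale n * x)) ≤
      Real.exp (1 / 12) * Real.exp (-(1 / 12) * x ^ 2) := by
  rw [← Real.exp_add, Real.exp_le_exp]
  refine (mul_potential_critical_bounds (by omega) x).2.trans ?_
  have h1 := inv_sqrt_nat_le hn
  have h2 : x ^ 4 / (12 * (1 + x ^ 2)) ≤ x ^ 4 / (12 * (1 + (Real.sqrt n)⁻¹ * x ^ 2)) := by
    gcongr
    nlinarith [sq_nonneg x]
  have h3 : (x ^ 2 - 1) / 12 ≤ x ^ 4 / (12 * (1 + x ^ 2)) := by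
    rw [div_le_div_iff₀ (by norm_num) (by positivity)]
    nlinarith
  linarith

lemma tendsto_exp_potential_critical (x : ℝ) :
    Tendsto (fun n : ℕ => Real.exp (n * potential 1 0 (criticalScale n * x))) atTop
      (𝓝 (Real.exp (-(1 / 12) * x ^ 4))) := by
  refine (Real.continuous_exp.tendsto _).comp ?_
  have h1 : Tendsto (fun n : ℕ => -(x ^ 4 / (12 * (1 + (Real.sqrt n)⁻¹ * x ^ 2)))) atTop
      (𝓝 (-(x ^ 4 / (12 * (1 + 0 * x ^ 2))))) := by
    refine (Tendsto.div tendsto_const_nhds ?_ (by norm_num)).neg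
    exact ((tendsto_inv_sqrt_nat.mul_const _).const_add _).const_mul _
  have h2 : -(x ^ 4 / (12 * (1 + 0 * x ^ 2))) = -(1 / 12) * x ^ 4 := by ring
  rw [h2] at h1
  refine tendsto_of_tendsto_of_tendsto_of_le_of_le' (g := fun _ => -(1 / 12) * x ^ 4)
    tendsto_const_nhds h1 ?_ ?_
  · filter_upwards [eventually_ne_atTop 0] with n hn
    have := (mul_potential_critical_bounds hn x).1
    linarith
  · filter_upwards [eventually_ne_atTop 0] with n hn
    exact (mul_potential_critical_bounds hn x).2

lemma sqrt_mul_cosh_sub_one_bounds {n : ℕ} (hn : n ≠ 0) (x : ℝ) :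
    x ^ 2 / 2 ≤ Real.sqrt n * (Real.cosh (criticalScale n * x) - 1) ∧
      Real.sqrt n * (Real.cosh (criticalScale n * x) - 1) ≤
        x ^ 2 / 2 * Real.exp ((Real.sqrt n)⁻¹ * x ^ 2 / 2) := by
  have hn0 : (0 : ℝ) < n := by exact_mod_cast Nat.pos_of_ne_zero hn
  have hs := Real.sqrt_pos.2 hn0
  obtain ⟨h1, h2⟩ := cosh_sub_one_bounds (criticalScale n * x)
  rw [mul_pow, criticalScale_sq] at h1 h2
  refine ⟨le_trans (le_of_eq ?_) (mul_le_mul_of_nonneg_left h1 hs.le),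
    (mul_le_mul_of_nonneg_left h2 hs.le).trans (le_of_eq ?_)⟩
  · field_simp
  · field_simp

lemma tendsto_sqrt_mul_cosh_sub_one (x : ℝ) :
    Tendsto (fun n : ℕ => Real.sqrt n * (Real.cosh (criticalScale n * x) - 1)) atTop
      (𝓝 (x ^ 2 / 2)) := by
  have h1 : Tendsto (fun n : ℕ => x ^ 2 / 2 * Real.exp ((Real.sqrt n)⁻¹ * x ^ 2 / 2)) atTop
      (𝓝 (x ^ 2 / 2 * Real.exp (0 * x ^ 2 / 2))) :=
    ((Real.continuous_exp.tendsto _).comp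
      ((tendsto_inv_sqrt_nat.mul_const _).div_const _)).const_mul _
  rw [zero_mul, zero_div, Real.exp_zero, mul_one] at h1
  refine tendsto_of_tendsto_of_tendsto_of_le_of_le' (g := fun _ => x ^ 2 / 2)
    tendsto_const_nhds h1 ?_ ?_
  · filter_upwards [eventually_ne_atTop 0] with n hn
    exact (sqrt_mul_cosh_sub_one_bounds hn x).1
  · filter_upwards [eventually_ne_atTop 0] with n hn
    exact (sqrt_mul_cosh_sub_one_bounds hn x).2

lemma tendsto_integral_exp_potential_critical :
    Tendsto (fun n : ℕ => ∫ x, Real.exp (n * potential 1 0 (criticalScale n * x))) atTop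
      (𝓝 (∫ x, Real.exp (-(1 / 12) * x ^ 4))) := by
  have hcont := continuous_potential (b := 1) (h := 0) one_pos
  refine tendsto_integral_filter_of_dominated_convergence
    (fun x => Real.exp (1 / 12) * Real.exp (-(1 / 12) * x ^ 2))
    (Eventually.of_forall fun n => by
      exact (Continuous.aestronglyMeasurable (by fun_prop))) ?_
    ((integrable_exp_neg_mul_sq (by norm_num)).const_mul _)
    (ae_of_all _ tendsto_exp_potential_critical)
  filter_upwards [eventually_ge_atTop (16 ^ 2)] with n hn
  refine ae_of_all _ fun x => ?_
  rw [Real.norm_eq_abs, Real.abs_exp]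
  exact exp_mul_potential_critical_le hn x

lemma tendsto_integral_exp_potential_mul_critical :
    Tendsto (fun n : ℕ => ∫ x, Real.exp (n * potential 1 0 (criticalScale n * x)) *
      (Real.sqrt n * (Real.cosh (criticalScale n * x) - 1))) atTop
      (𝓝 (∫ x, Real.exp (-(1 / 12) * x ^ 4) * (x ^ 2 / 2))) := by
  have hcont := continuous_potential (b := 1) (h := 0) one_pos
  refine tendsto_integral_filter_of_dominated_convergence
    -- For `n ≥ 16²` the factor `√n (cosh - 1)` grows at most like `x² exp (x²/32) / 2`, and `1/12 -
    -- 1/32 = 5/96` of Gaussian decay remains.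
    (fun x => Real.exp (1 / 12) / 2 * (x ^ 2 * Real.exp (-(5 / 96) * x ^ 2)))
    (Eventually.of_forall fun n => by
      exact (Continuous.aestronglyMeasurable (by fun_prop))) ?_
    ((integrable_pow_mul_exp_neg 2 (by norm_num)).const_mul _)
    (ae_of_all _ fun x => (tendsto_exp_potential_critical x).mul (tendsto_sqrt_mul_cosh_sub_one x))
  filter_upwards [eventually_ge_atTop (16 ^ 2)] with n hn
  refine ae_of_all _ fun x => ?_
  obtain ⟨h1, h2⟩ := sqrt_mul_cosh_sub_one_bounds (n := n) (by omega) x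
  have h0 : 0 ≤ Real.sqrt n * (Real.cosh (criticalScale n * x) - 1) := le_trans (by positivity) h1
  rw [Real.norm_eq_abs, abs_of_nonneg (mul_nonneg (Real.exp_pos _).le h0)]
  have h3 : Real.sqrt n * (Real.cosh (criticalScale n * x) - 1) ≤
      x ^ 2 / 2 * Real.exp (1 / 32 * x ^ 2) := by
    refine h2.trans (mul_le_mul_of_nonneg_left (Real.exp_le_exp.2 ?_) (by positivity))
    nlinarith [mul_le_mul_of_nonneg_right (inv_sqrt_nat_le hn) (sq_nonneg x)]
  calc _ ≤ Real.exp (1 / 12) * Real.exp (-(1 / 12) * x ^ 2) *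
        (x ^ 2 / 2 * Real.exp (1 / 32 * x ^ 2)) :=
        mul_le_mul (exp_mul_potential_critical_le hn x) h3 h0 (by positivity)
    _ = Real.exp (1 / 12) / 2 * (x ^ 2 *
        (Real.exp (-(1 / 12) * x ^ 2) * Real.exp (1 / 32 * x ^ 2))) := by ring
    _ = _ := by rw [← Real.exp_add]; congr 4; ring

lemma integral_exp_neg_pow_four :
    ∫ x : ℝ, Real.exp (-(1 / 12) * x ^ 4) =
      2 * ((1 / 12 : ℝ) ^ (-(1 / 4) : ℝ) * (1 / 4) * Real.Gamma (1 / 4)) := by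
  have h1 := integral_rpow_mul_exp_neg_mul_rpow (p := 4) (q := 0) (b := 1 / 12) (by norm_num)
    (by norm_num) (by norm_num)
  have h2 := integral_comp_abs (f := fun x : ℝ => Real.exp (-(1 / 12) * x ^ 4))
  have h3 : ∀ x : ℝ, |x| ^ 4 = x ^ 4 := fun x => by
    rw [show 4 = 2 * 2 by rfl, pow_mul, sq_abs, pow_mul]
  simp_rw [h3] at h2
  rw [h2]
  congr 1
  simp only [Real.rpow_zero, one_mul, zero_add] at h1
  rw [neg_div] at h1
  rw [← h1]
  refine setIntegral_congr_fun measurableSet_Ioi fun x _ => ?_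
  norm_cast

lemma integral_exp_neg_pow_four_mul_sq :
    ∫ x : ℝ, Real.exp (-(1 / 12) * x ^ 4) * (x ^ 2 / 2) =
      (1 / 12 : ℝ) ^ (-(3 / 4) : ℝ) * (1 / 4) * Real.Gamma (3 / 4) := by
  have h1 := integral_rpow_mul_exp_neg_mul_rpow (p := 4) (q := 2) (b := 1 / 12) (by norm_num)
    (by norm_num) (by norm_num)
  have h2 := integral_comp_abs (f := fun x : ℝ => Real.exp (-(1 / 12) * x ^ 4) * (x ^ 2 / 2))
  have h3 : ∀ x : ℝ, |x| ^ 4 = x ^ 4 := fun x => by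
    rw [show 4 = 2 * 2 by rfl, pow_mul, sq_abs, pow_mul]
  simp_rw [h3, sq_abs] at h2
  rw [neg_div] at h1
  rw [h2, show (3 / 4 : ℝ) = (2 + 1) / 4 by norm_num, ← h1, ← integral_const_mul]
  refine setIntegral_congr_fun measurableSet_Ioi fun x _ => ?_
  norm_cast
  ring

/-- The quotient of integrals reduces to `√3 Γ(3/4) / Γ(1/4)`, and the reflection formula at `1/4`
eliminates `Γ(3/4)`. -/
lemma critical_constant :
    Real.sqrt (2 / Real.pi) * ((∫ x : ℝ, Real.exp (-(1 / 12) * x ^ 4) * (x ^ 2 / 2)) /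
      ∫ x : ℝ, Real.exp (-(1 / 12) * x ^ 4)) =
      2 * Real.sqrt 3 * Real.sqrt Real.pi / Real.Gamma (1 / 4) ^ 2 := by
  have hpi := Real.pi_pos
  have hG := Real.Gamma_pos_of_pos (show (0 : ℝ) < 1 / 4 by norm_num)
  have h1 := Real.Gamma_mul_Gamma_one_sub (1 / 4)
  rw [show Real.pi * (1 / 4) = Real.pi / 4 by ring, Real.sin_pi_div_four,
    show (1 : ℝ) - 1 / 4 = 3 / 4 by norm_num] at h1
  have h2 : (1 / 12 : ℝ) ^ (-(3 / 4) : ℝ) =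
      (1 / 12 : ℝ) ^ (-(1 / 4) : ℝ) * (2 * Real.sqrt 3) := by
    rw [show (-(3 / 4) : ℝ) = -(1 / 4) + -(1 / 2) by norm_num, Real.rpow_add (by norm_num),
      Real.rpow_neg (by norm_num) (1 / 2), ← Real.sqrt_eq_rpow]
    congr 1
    rw [← Real.sqrt_inv, show (1 / 12 : ℝ)⁻¹ = 2 ^ 2 * 3 by norm_num,
      Real.sqrt_mul (by norm_num), Real.sqrt_sq (by norm_num)]
  have h3 : 0 < (1 / 12 : ℝ) ^ (-(1 / 4) : ℝ) := by positivity
  have h4 : Real.Gamma (3 / 4) = Real.pi * Real.sqrt 2 / Real.Gamma (1 / 4) := by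
    rw [eq_div_iff hG.ne', mul_comm, h1, div_div_eq_mul_div, div_eq_iff
      (Real.sqrt_pos.2 two_pos).ne', mul_assoc, Real.mul_self_sqrt zero_le_two]
  rw [integral_exp_neg_pow_four, integral_exp_neg_pow_four_mul_sq, h2, h4,
    Real.sqrt_div zero_le_two]
  have h5 := Real.sqrt_pos.2 hpi
  have h6 := Real.mul_self_sqrt hpi.le
  have h7 := Real.mul_self_sqrt (zero_le_two (α := ℝ))
  field_simp
  nlinarith

/-- At criticality `E cosh T - 1` is of order `n^{-1/2}`. -/
lemma tendsto_sqrt_mul_integral_cosh_sub_one :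
    Tendsto (fun n : ℕ => Real.sqrt n * (∫ T, Real.cosh T ∂(fieldMeasure 1 0 n) - 1)) atTop
      (𝓝 ((∫ x : ℝ, Real.exp (-(1 / 12) * x ^ 4) * (x ^ 2 / 2)) /
        ∫ x : ℝ, Real.exp (-(1 / 12) * x ^ 4))) := by
  have hden : (∫ x : ℝ, Real.exp (-(1 / 12) * x ^ 4)) ≠ 0 := by
    have hG := Real.Gamma_pos_of_pos (show (0 : ℝ) < 1 / 4 by norm_num)
    rw [integral_exp_neg_pow_four]
    positivity
  refine (tendsto_integral_exp_potential_mul_critical.div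
    tendsto_integral_exp_potential_critical hden).congr' ?_
  filter_upwards [eventually_ne_atTop 0] with n hn
  rw [Pi.div_apply, ← integral_fieldMeasure_critical hn (fun T => Real.sqrt n * (Real.cosh T - 1)),
    integral_const_mul, integral_sub integrable_cosh_fieldMeasure (integrable_const _)]
  simp

end Critical

/-! ### Solutions of the mean-field equation and assembly of the expansions. -/

section MainTheorem

open MeasureTheory Topology

lemma continuous_tanh : Continuous Real.tanh :=
  continuous_iff_continuousAt.2 fun x => (hasDerivAt_tanh x).continuousAt

lemma div_criticalBeta (d : ℕ) (β : ℝ) : β / criticalBeta d = 2 * d * β := by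
  rw [criticalBeta, div_div_eq_mul_div, div_one, mul_comm]

lemma mem_meanFieldSolutions {d : ℕ} {β h z : ℝ} :
    z ∈ meanFieldSolutions d β h ↔ Real.tanh (2 * d * β * z + |h|) = z := by
  rw [meanFieldSolutions, Set.mem_ofPred_eq, div_criticalBeta]

/-- Intermediate value theorem on `[z₀, 1]`, using `tanh < 1` at the right end. It gives existence
from `z₀ = 0` and, above criticality, a positive solution from a small `z₀`. -/
lemma exists_meanFieldSolution_ge {d : ℕ} {β h z₀ : ℝ} (hz₀ : z₀ ≤ 1)
    (hle : z₀ ≤ Real.tanh (2 * d * β * z₀ + |h|)) :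
    ∃ z ∈ meanFieldSolutions d β h, z₀ ≤ z := by
  have hcont : ContinuousOn (fun z => Real.tanh (2 * d * β * z + |h|) - z) (Set.Icc z₀ 1) := by
    have := continuous_tanh
    fun_prop
  obtain ⟨z, hz, hz0⟩ := intermediate_value_Icc' hz₀ hcont
    (show (0 : ℝ) ∈ _ from ⟨by linarith [Real.tanh_lt_one (2 * d * β * 1 + |h|)], by linarith⟩)
  exact ⟨z, mem_meanFieldSolutions.2 (sub_eq_zero.1 hz0), hz.1⟩

lemma exists_isGreatest_meanFieldSolutions (d : ℕ) (β h : ℝ) :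
    ∃ z, IsGreatest (meanFieldSolutions d β h) z ∧ 0 ≤ z := by
  obtain ⟨z₁, hz₁, h0⟩ := exists_meanFieldSolution_ge (d := d) (β := β) (h := h) (z₀ := 0)
    zero_le_one (by rw [mul_zero, zero_add]; exact tanh_nonneg (abs_nonneg h))
  have hcompact : IsCompact (meanFieldSolutions d β h) := by
    refine Metric.isCompact_of_isClosed_isBounded ?_
      ((Metric.isBounded_Icc (-1) 1).subset fun z hz => ?_)
    · have := continuous_tanh
      exact isClosed_eq (by fun_prop) continuous_id
    · rw [mem_meanFieldSolutions] at hz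
      rw [← hz]
      exact ⟨(Real.neg_one_lt_tanh _).le, (Real.tanh_lt_one _).le⟩
  obtain ⟨z, hz⟩ := hcompact.exists_isGreatest ⟨z₁, hz₁⟩
  exact ⟨z, hz, h0.trans (hz.2 hz₁)⟩

/-- The mean-field equation and `t < sinh t` give `b sinh t ≤ t cosh t < sinh t cosh t`, hence `b <
cosh t ≤ cosh² t`. Any positive root is thus automatically nondegenerate. -/
lemma curvature_pos {b h t : ℝ} (hh : 0 ≤ h) (ht : 0 < t)
    (heq : b * Real.tanh t = t - h) : 0 < 1 - b / Real.cosh t ^ 2 := by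
  have hc := Real.cosh_pos t
  have h1 := Real.self_lt_sinh_iff.2 ht
  have h2 := Real.one_le_cosh t
  rw [Real.tanh_eq_sinh_div_cosh, mul_div_assoc', div_eq_iff hc.ne'] at heq
  have h3 : b * Real.sinh t ≤ t * Real.cosh t := by nlinarith [mul_nonneg hh hc.le]
  rw [sub_pos, div_lt_one (by positivity)]
  have h4 : b < Real.cosh t := by
    by_contra hle
    push Not at hle
    nlinarith [mul_le_mul_of_nonneg_right hle (ht.trans h1).le, mul_lt_mul_of_pos_left h1 hc]
  nlinarith

lemma exists_abs_integral_cosh_sub_le {b h t : ℝ} (hb : 0 ≤ b) (hh : 0 ≤ h) (ht : 0 ≤ t)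
    (heq : b * Real.tanh t = t - h) (hl : 0 < 1 - b / Real.cosh t ^ 2) :
    ∃ C : ℝ, 0 ≤ C ∧ ∀ᶠ n : ℕ in atTop,
      |∫ T, Real.cosh T ∂(fieldMeasure b h n) - Real.cosh t| ≤ C / n := by
  obtain ⟨C₁, h10, h1⟩ := exists_integral_cosh_le hb hh ht heq hl
  obtain ⟨C₂, h20, h2⟩ : ∃ C : ℝ, 0 ≤ C ∧ ∀ᶠ n : ℕ in atTop,
      Real.cosh t - C / n ≤ ∫ T, Real.cosh T ∂(fieldMeasure b h n) := by
    -- At `t = 0` the lower bound is just `cosh ≥ 1`; no Laplace estimate is needed.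
    rcases ht.eq_or_lt with rfl | ht0
    · refine ⟨0, le_rfl, Eventually.of_forall fun n => ?_⟩
      have := integral_mono (integrable_const 1) (integrable_cosh_fieldMeasure
        (b := b) (h := h) (n := n)) Real.one_le_cosh
      simpa using this
    · exact exists_le_integral_cosh hb hh ht0 heq hl
  refine ⟨C₁ + C₂, by positivity, ?_⟩
  filter_upwards [h1, h2] with n hn1 hn2
  rw [add_div, abs_le]
  have h3 : 0 ≤ C₁ / n := by positivity
  have h4 : 0 ≤ C₂ / n := by positivity
  constructor <;> linarith

/-- The global flip `σ ↦ -σ` exchanges `h` with `-h`, and its effect on the event is absorbed in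
`v`. Since `|v i|` is unchanged, `Q_n` depends on `h` only through `|h|`. -/
lemma prob_neg (d : ℕ) (β h : ℝ) (n : ℕ) (x : ℝ) (v : Fin n → ℝ) :
    prob d β (-h) n {σ | ∑ i, v i * spin σ i ∈ Set.Ioo (x - 1) (x + 1)} =
      prob d β h n {σ | ∑ i, (-v i) * spin σ i ∈ Set.Ioo (x - 1) (x + 1)} := by
  have hspin : ∀ (σ : Config n) i, spin (-σ) i = -spin σ i := fun σ i => by simp [spin]
  have hw : ∀ σ : Config n, weight d β (-h) n (-σ) = weight d β h n σ := fun σ => by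
    simp [weight, hspin]
  have hZ : partitionFunction d β (-h) n = partitionFunction d β h n := by
    unfold partitionFunction
    rw [← Equiv.sum_comp (Equiv.neg (Config n))]
    exact Finset.sum_congr rfl fun σ _ => hw σ
  unfold prob
  rw [← Equiv.sum_comp (Equiv.neg (Config n))]
  refine Finset.sum_congr rfl fun σ _ => ?_
  simp only [Equiv.neg_apply, Set.indicator, Set.mem_ofPred_eq, hspin, mass, hw, hZ, mul_neg,
    neg_mul]

lemma Q_neg_le (d : ℕ) {β : ℝ} (hβ : 0 ≤ β) (h : ℝ) (n : ℕ) : Q d β (-h) n ≤ Q d β h n := by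
  refine csSup_le ⟨_, 0, fun _ => 1, by simp, rfl⟩ ?_
  rintro p ⟨x, v, hv, rfl⟩
  rw [prob_neg]
  exact prob_le_Q d h n hβ x _ fun i => by rw [abs_neg]; exact hv i

lemma Q_abs (d : ℕ) {β : ℝ} (hβ : 0 ≤ β) (h : ℝ) (n : ℕ) : Q d β |h| n = Q d β h n := by
  rcases abs_choice h with h' | h' <;> rw [h']
  refine le_antisymm (Q_neg_le d hβ h n) ?_
  simpa using Q_neg_le d hβ (-h) n

lemma rpow_neg_half (n : ℕ) : (n : ℝ) ^ (-(1 / 2) : ℝ) = (Real.sqrt n)⁻¹ := by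
  rw [Real.rpow_neg (Nat.cast_nonneg n), ← Real.sqrt_eq_rpow]

lemma rpow_neg_three_half (n : ℕ) : (n : ℝ) ^ (-(3 / 2) : ℝ) = (Real.sqrt n)⁻¹ ^ 3 := by
  rw [← rpow_neg_half, ← Real.rpow_natCast, ← Real.rpow_mul (Nat.cast_nonneg n)]
  norm_num

lemma inv_natCast_eq (n : ℕ) : (n : ℝ)⁻¹ = (Real.sqrt n)⁻¹ ^ 2 := by
  rw [inv_pow, Real.sq_sqrt (Nat.cast_nonneg n)]

/-- The expansion of `Q_n` at a nondegenerate maximum of the potential. -/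
lemma Q_sub_isBigO {d : ℕ} {β h t : ℝ} (hβ : 0 ≤ β) (ht : 0 ≤ t)
    (heq : 2 * d * β * Real.tanh t = t - |h|) (hl : 0 < 1 - 2 * d * β / Real.cosh t ^ 2) :
    (fun n : ℕ => Q d β h n - Real.sqrt (2 / Real.pi) * Real.cosh t * (n : ℝ) ^ (-(1 / 2) : ℝ))
      =O[atTop] (fun n : ℕ => (n : ℝ) ^ (-(3 / 2) : ℝ)) := by
  have hb : 0 ≤ 2 * d * β := by positivity
  obtain ⟨C, hC0, hC⟩ := exists_abs_Q_sub_le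
  obtain ⟨C₁, h10, h1⟩ := exists_abs_integral_cosh_sub_le hb (abs_nonneg h) ht heq hl
  obtain ⟨C₃, h30, h3⟩ := exists_integral_cosh_cube_le hb |h|
  refine IsBigO.of_bound (C * C₃ + Real.sqrt (2 / Real.pi) * C₁) ?_
  filter_upwards [h1, h3, eventually_ge_atTop 2] with n hn1 hn3 hn
  have hQ := hC d β |h| n hβ hn
  rw [Q_abs d hβ] at hQ
  rw [rpow_neg_half, rpow_neg_three_half]
  rw [div_eq_mul_inv, inv_natCast_eq] at hn1
  set r := (Real.sqrt n)⁻¹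
  have hr : 0 ≤ r := by positivity
  set K := Real.sqrt (2 / Real.pi)
  have hK : 0 ≤ K := Real.sqrt_nonneg _
  rw [Real.norm_eq_abs, Real.norm_eq_abs, abs_of_nonneg (pow_nonneg hr 3)]
  set I := ∫ T, Real.cosh T ∂(fieldMeasure (2 * d * β) |h| n)
  have h4 : Q d β h n - K * Real.cosh t * r = (Q d β h n - K * r * I) +
      K * r * (I - Real.cosh t) := by ring
  rw [h4]
  refine (abs_add_le _ _).trans ?_
  rw [abs_mul, abs_of_nonneg (mul_nonneg hK hr)]
  have h5 := mul_le_mul_of_nonneg_left hn3 (by positivity : 0 ≤ C * r ^ 3)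
  have h6 := mul_le_mul_of_nonneg_left hn1 (mul_nonneg hK hr)
  calc _ ≤ C * r ^ 3 * C₃ + K * r * (C₁ * r ^ 2) := add_le_add (hQ.trans h5) h6
    _ = _ := by ring

/-- The expansion of `Q_n` at the critical point. -/
lemma Q_sub_isLittleO_critical {d : ℕ} {β : ℝ} (hβ : 0 ≤ β) (hb : 2 * d * β = 1) :
    (fun n : ℕ => Q d β 0 n - (Real.sqrt (2 / Real.pi) * (n : ℝ) ^ (-(1 / 2) : ℝ)
      + 2 * Real.sqrt 3 * Real.sqrt Real.pi / Real.Gamma (1 / 4) ^ 2 * (n : ℝ)⁻¹))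
      =o[atTop] (fun n : ℕ => (n : ℝ)⁻¹) := by
  obtain ⟨C, hC0, hC⟩ := exists_abs_Q_sub_le
  obtain ⟨C₃, h30, h3⟩ := exists_integral_cosh_cube_le (zero_le_one (α := ℝ)) 0
  rw [← critical_constant]
  set κ := (∫ x : ℝ, Real.exp (-(1 / 12) * x ^ 4) * (x ^ 2 / 2)) /
        ∫ x : ℝ, Real.exp (-(1 / 12) * x ^ 4)
  set K := Real.sqrt (2 / Real.pi)
  have hK : 0 ≤ K := Real.sqrt_nonneg _
  have hlim : Tendsto (fun n : ℕ => C * C₃ * (Real.sqrt n)⁻¹ +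
      K * |Real.sqrt n * (∫ T, Real.cosh T ∂(fieldMeasure 1 0 n) - 1) - κ|) atTop (𝓝 0) := by
    have h1 := (tendsto_sqrt_mul_integral_cosh_sub_one.sub_const κ).abs
    rw [sub_self, abs_zero] at h1
    simpa using (tendsto_inv_sqrt_nat.const_mul (C * C₃)).add (h1.const_mul K)
  rw [isLittleO_iff]
  intro ε hε
  filter_upwards [h3, eventually_ge_atTop 2, hlim.eventually_lt_const hε] with n hn3 hn hlt
  have hn0 : (0 : ℝ) < n := by exact_mod_cast (by omega : 0 < n)
  have hs := Real.sqrt_pos.2 hn0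
  have hQ := hC d β 0 n hβ hn
  rw [hb] at hQ
  rw [rpow_neg_half, inv_natCast_eq]
  set r := (Real.sqrt n)⁻¹ with hr
  have hr0 : 0 < r := by positivity
  have hrs : r * Real.sqrt n = 1 := inv_mul_cancel₀ hs.ne'
  set I := ∫ T, Real.cosh T ∂(fieldMeasure 1 0 n)
  rw [Real.norm_eq_abs, Real.norm_eq_abs, abs_of_nonneg (pow_nonneg hr0.le 2)]
  -- The first bracket is `O(n^{-3/2})`. The second is `n^{-1}` times a quantity tending to 0, which
  -- is why the critical error is only `o(n^{-1})`.
  have h4 : Q d β 0 n - (K * r + K * κ * r ^ 2) = (Q d β 0 n - K * r * I) +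
      K * r ^ 2 * (Real.sqrt n * (I - 1) - κ) := by
    linear_combination (-K * r * (I - 1)) * hrs
  rw [h4]
  refine (abs_add_le _ _).trans ?_
  rw [abs_mul, abs_of_nonneg (by positivity : 0 ≤ K * r ^ 2)]
  have h5 := mul_le_mul_of_nonneg_left hn3 (by positivity : 0 ≤ C * r ^ 3)
  have h6 := mul_le_mul_of_nonneg_right hlt.le (sq_nonneg r)
  calc _ ≤ C * r ^ 3 * C₃ + K * r ^ 2 * |Real.sqrt n * (I - 1) - κ| := by
        linarith [hQ.trans h5]
    _ = (C * C₃ * r + K * |Real.sqrt n * (I - 1) - κ|) * r ^ 2 := by ring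
    _ ≤ _ := h6

lemma isLittleO_rpow_three_half :
    (fun n : ℕ => (n : ℝ) ^ (-(3 / 2) : ℝ)) =o[atTop] (fun n : ℕ => (n : ℝ) ^ (-(1 / 2) : ℝ)) := by
  simp_rw [rpow_neg_half, rpow_neg_three_half]
  have h0 : Tendsto (fun n : ℕ => (Real.sqrt n)⁻¹ ^ 2) atTop (𝓝 0) := by
    simpa only [ne_eq, OfNat.ofNat_ne_zero, not_false_eq_true, zero_pow] using
      tendsto_inv_sqrt_nat.pow 2
  have h1 := (isLittleO_one_iff ℝ).2 h0
  refine (h1.mul_isBigO (isBigO_refl (fun n : ℕ => (Real.sqrt n)⁻¹) atTop)).congr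
    (fun n => ?_) fun n => one_mul _
  ring

lemma isLittleO_inv_rpow_half :
    (fun n : ℕ => (n : ℝ)⁻¹) =o[atTop] (fun n : ℕ => (n : ℝ) ^ (-(1 / 2) : ℝ)) := by
  simp_rw [rpow_neg_half, inv_natCast_eq]
  have h1 := (isLittleO_one_iff ℝ).2 tendsto_inv_sqrt_nat
  exact (h1.mul_isBigO (isBigO_refl (fun n : ℕ => (Real.sqrt n)⁻¹) atTop)).congr
    (fun n => (pow_two _).symm) fun n => one_mul _

lemma isEquivalent_of_sub_isLittleO {f : ℕ → ℝ} {K c : ℝ} (hK : 0 < K) (hc : 0 < c)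
    (hf : (fun n : ℕ => f n - K * c * (n : ℝ) ^ (-(1 / 2) : ℝ)) =o[atTop]
      (fun n : ℕ => (n : ℝ) ^ (-(1 / 2) : ℝ))) :
    f ~[atTop] (fun n : ℕ => (n : ℝ) ^ (-(1 / 2) : ℝ) * K * c) := by
  have h1 : (fun n : ℕ => (n : ℝ) ^ (-(1 / 2) : ℝ) * K * c) =
      fun n : ℕ => (K * c) * (n : ℝ) ^ (-(1 / 2) : ℝ) := by funext n; ring
  rw [h1]
  exact (isLittleO_const_mul_right_iff (mul_pos hK hc).ne').2 hf

lemma sqrt_two_div_pi_pos : 0 < Real.sqrt (2 / Real.pi) :=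
  Real.sqrt_pos.2 (div_pos two_pos Real.pi_pos)

end MainTheorem

end CurieWeiss

theorem theorem1p5 (d : ℕ) (hd : 1 ≤ d) (β : ℝ) (hβ : 0 ≤ β) (h : ℝ) :
    ∃ z t : ℝ,
      IsGreatest (CurieWeiss.meanFieldSolutions d β h) z ∧
      0 ≤ z ∧
      t = 2 * (d : ℝ) * β * z + |h| ∧
      (fun n : ℕ => CurieWeiss.Q d β h n) ~[atTop]
        (fun n : ℕ => (n : ℝ) ^ (-(1 / 2) : ℝ) * Real.sqrt (2 / Real.pi) * Real.cosh t) ∧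
      (h = 0 → β < CurieWeiss.criticalBeta d →
        t = 0 ∧
        (fun n : ℕ => CurieWeiss.Q d β h n
            - Real.sqrt (2 / Real.pi) * (n : ℝ) ^ (-(1 / 2) : ℝ))
          =O[atTop] (fun n : ℕ => (n : ℝ) ^ (-(3 / 2) : ℝ))) ∧
      (h = 0 → β = CurieWeiss.criticalBeta d →
        t = 0 ∧
        (fun n : ℕ => CurieWeiss.Q d β h n
            - (Real.sqrt (2 / Real.pi) * (n : ℝ) ^ (-(1 / 2) : ℝ)
              + 2 * Real.sqrt 3 * Real.sqrt Real.pi / Real.Gamma (1 / 4) ^ 2 * (n : ℝ)⁻¹))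
          =o[atTop] (fun n : ℕ => (n : ℝ)⁻¹)) ∧
      (h = 0 → CurieWeiss.criticalBeta d < β →
        0 < t ∧
        (fun n : ℕ => CurieWeiss.Q d β h n
            - Real.sqrt (2 / Real.pi) * Real.cosh t * (n : ℝ) ^ (-(1 / 2) : ℝ))
          =O[atTop] (fun n : ℕ => (n : ℝ) ^ (-(3 / 2) : ℝ))) ∧
      (h ≠ 0 →
        0 < t ∧
        (fun n : ℕ => CurieWeiss.Q d β h n
            - Real.sqrt (2 / Real.pi) * Real.cosh t * (n : ℝ) ^ (-(1 / 2) : ℝ))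
          =O[atTop] (fun n : ℕ => (n : ℝ) ^ (-(3 / 2) : ℝ))) := by
  open CurieWeiss in
  obtain ⟨z, hz, hz0⟩ := exists_isGreatest_meanFieldSolutions d β h
  have hd0 : (0 : ℝ) < d := by exact_mod_cast hd
  set b : ℝ := 2 * d * β with hbdef
  have hb : 0 ≤ b := by positivity
  obtain ⟨t, htdef⟩ : ∃ t, t = b * z + |h| := ⟨_, rfl⟩
  have ht : 0 ≤ t := by have := mul_nonneg hb hz0; have := abs_nonneg h; linarith
  have hzt : Real.tanh t = z := by rw [htdef]; exact mem_meanFieldSolutions.1 hz.1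
  have heq : b * Real.tanh t = t - |h| := by rw [hzt, htdef]; ring
  have hlt_iff : β < criticalBeta d ↔ b < 1 := by
    rw [criticalBeta, lt_div_iff₀ (by positivity), mul_comm]
  have hgt_iff : criticalBeta d < β ↔ 1 < b := by
    rw [criticalBeta, div_lt_iff₀ (by positivity), mul_comm]
  have heq_iff : β = criticalBeta d ↔ b = 1 := by
    rw [criticalBeta, eq_div_iff (by positivity), mul_comm]
  have hpos : 0 < t → (fun n : ℕ => Q d β h n
      - Real.sqrt (2 / Real.pi) * Real.cosh t * (n : ℝ) ^ (-(1 / 2) : ℝ))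
        =O[atTop] (fun n : ℕ => (n : ℝ) ^ (-(3 / 2) : ℝ)) := fun ht0 =>
    Q_sub_isBigO hβ ht heq (curvature_pos (abs_nonneg h) ht0 heq)
  have hsub : h = 0 → b < 1 → t = 0 ∧ (fun n : ℕ => Q d β h n
      - Real.sqrt (2 / Real.pi) * (n : ℝ) ^ (-(1 / 2) : ℝ))
        =O[atTop] (fun n : ℕ => (n : ℝ) ^ (-(3 / 2) : ℝ)) := by
    intro hh hb1
    have ht0 : t = 0 := by
      -- Here `t = b tanh t ≤ b t` with `b < 1`, which forces `t = 0`.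
      have h1 := tanh_le_self ht
      rw [hh, abs_zero, sub_zero] at heq
      nlinarith [mul_le_mul_of_nonneg_left h1 hb]
    have h2 := Q_sub_isBigO (h := h) hβ ht heq (by rw [ht0]; simpa using hb1)
    rw [ht0, Real.cosh_zero] at h2
    exact ⟨ht0, by simpa using h2⟩
  have hcrit : h = 0 → b = 1 → t = 0 ∧ (fun n : ℕ => Q d β h n
      - (Real.sqrt (2 / Real.pi) * (n : ℝ) ^ (-(1 / 2) : ℝ)
        + 2 * Real.sqrt 3 * Real.sqrt Real.pi / Real.Gamma (1 / 4) ^ 2 * (n : ℝ)⁻¹))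
        =o[atTop] (fun n : ℕ => (n : ℝ)⁻¹) := by
    intro hh hb1
    refine ⟨?_, by rw [hh]; exact Q_sub_isLittleO_critical hβ hb1⟩
    rcases ht.eq_or_lt with ht0 | ht0
    · exact ht0.symm
    -- At `b = 1` the equation `t = tanh t` contradicts the strict cubic gap for `t > 0`.
    have h1 := tanh_le_self_sub ht
    have h2 : 0 < t ^ 3 / (3 * (1 + t ^ 2)) := by positivity
    rw [hh, hb1, abs_zero] at heq
    linarith
  have hsup : h = 0 → 1 < b → 0 < t := by
    intro hh hb1
    -- Small enough that the cubic loss in `tanh y ≥ y - y³/3` at `y = b z₀` stays below the gain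
    -- `(b - 1) z₀`, so that `z₀ ≤ tanh (b z₀)` and a root lies to the right of `z₀ > 0`.
    set z₀ : ℝ := min 1 ((b - 1) / b ^ 3) with hz₀
    have hb0 : 0 < b := by linarith
    have hz₀0 : 0 < z₀ := lt_min one_pos (div_pos (by linarith) (by positivity))
    have hz₀1 : z₀ ≤ 1 := min_le_left _ _
    have hz₀2 : z₀ * b ^ 3 ≤ b - 1 := by
      rw [← le_div_iff₀ (by positivity)]; exact min_le_right _ _
    obtain ⟨z₁, hz₁, hz₁0⟩ := exists_meanFieldSolution_ge (d := d) (β := β) (h := h) hz₀1 (by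
      rw [hh, abs_zero, add_zero]
      refine le_trans ?_ (self_sub_cube_le_tanh (mul_nonneg hb hz₀0.le))
      have h1 : (b * z₀) ^ 3 ≤ (b - 1) * z₀ := by
        calc (b * z₀) ^ 3 = z₀ * b ^ 3 * z₀ * z₀ := by ring
          _ ≤ (b - 1) * z₀ * 1 := by gcongr
          _ = _ := mul_one _
      have h2 : 0 ≤ (b - 1) * z₀ := mul_nonneg (by linarith) hz₀0.le
      linarith)
    have hzpos : 0 < z := hz₀0.trans_le (hz₁0.trans (hz.2 hz₁))
    rw [htdef]
    have := abs_nonneg h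
    have := mul_pos hb0 hzpos
    linarith
  have hne : h ≠ 0 → 0 < t := by
    intro hh
    have := abs_pos.2 hh
    have := mul_nonneg hb hz0
    linarith
  have hposeq : 0 < t → (fun n : ℕ => Q d β h n) ~[atTop]
      (fun n : ℕ => (n : ℝ) ^ (-(1 / 2) : ℝ) * Real.sqrt (2 / Real.pi) * Real.cosh t) :=
    fun ht0 => isEquivalent_of_sub_isLittleO sqrt_two_div_pi_pos (Real.cosh_pos t)
      ((hpos ht0).trans_isLittleO isLittleO_rpow_three_half)
  refine ⟨z, t, hz, hz0, htdef, ?_, fun hh hlt => hsub hh (hlt_iff.1 hlt),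
    fun hh he => hcrit hh (heq_iff.1 he),
    fun hh hgt => ⟨hsup hh (hgt_iff.1 hgt), hpos (hsup hh (hgt_iff.1 hgt))⟩,
    fun hh => ⟨hne hh, hpos (hne hh)⟩⟩
  by_cases hh : h = 0
  · rcases lt_trichotomy b 1 with hb1 | hb1 | hb1
    · obtain ⟨ht0, hO⟩ := hsub hh hb1
      refine isEquivalent_of_sub_isLittleO sqrt_two_div_pi_pos (Real.cosh_pos t) ?_
      rw [ht0, Real.cosh_zero, mul_one]
      exact hO.trans_isLittleO isLittleO_rpow_three_half
    · obtain ⟨ht0, ho⟩ := hcrit hh hb1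
      refine isEquivalent_of_sub_isLittleO sqrt_two_div_pi_pos (Real.cosh_pos t) ?_
      rw [ht0, Real.cosh_zero, mul_one]
      have h1 := (ho.trans isLittleO_inv_rpow_half).add (isLittleO_inv_rpow_half.const_mul_left
        (2 * Real.sqrt 3 * Real.sqrt Real.pi / Real.Gamma (1 / 4) ^ 2))
      refine h1.congr_left fun n => ?_
      ring
    · exact hposeq (hsup hh hb1)
  · exact hposeq (hne hh)
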